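/- **Definitions.** A *rectilinear graph* is a finite plane graph whose edges are nondegenerate horizontal or vertical segments that meet each other and the vertex set only at their endpoints; its weight is the total length of its edges. A *rectilinear Steiner arborescence* (RSA) for a finite set $P$ of points with root $r$ is a rectilinear tree $T$ having all points of $P\cup\{r\}$ as vertices such that every $p\in P$ satisfies $x(r)\le x(p)$, $y(r)\le y(p)$, and the path in $T$ from $p$ to $r$ has length $(x(p)-x(r))+(y(p)-y(r))$. Given disjoint finite sets $P$ of $n$ points and $R$ of $m$ roots in the closed first quadrant of $\mathbb{R}^2$ with $(0,0)\in R$, a *rectilinear Steiner forest arborescence* (RSFA) for $P$ with root set $R$ is a rectilinear forest $F$ having all points of $P$ as vertices such that each connected component of $F$ is an RSA, for the points of $P$ that it contains, rooted at some root in $R$. The *RSFA problem* asks, given $P$ and $R$ (as lists of points with real coordinates), for an RSFA for $P$ with root set $R$ of minimum weight. **Theorem.** The RSFA problem can be solved exactly in $O(mn^2+3^n)$ time. Precisely: there are a single program for the real RAM (a random access machine with unit-cost addition, subtraction and comparison of exact reals and of machine words, and with indirect addressing by words) and a constant $C$ such that, for every instance $(P,R)$ with $n$ points and $m$ roots and every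 word length $w\ge C\,(n+\lfloor\log_2 m\rfloor+1)$, the program, started on $(P,R)$ with $w$-bit words, halts after at most $C\,(mn^2+3^n)$ steps and has output the list of edges of a minimum-weight RSFA for $P$ with root set $R$. -/

import Mathlib

noncomputable section

namespace RSFA

/-! ### Rectilinear plane graphs -/

/-- Points of the plane. Only the coordinates are used, never the norm of the product type. -/
abbrev Pt : Type := ℝ × ℝ

/-- The rectilinear distance of two points. -/
def dist1 (p q : Pt) : ℝ := |p.1 - q.1| + |p.2 - q.2|

theorem dist1_comm (p q : Pt) : dist1 p q = dist1 q p := by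
  simp only [dist1, abs_sub_comm]

/-- The length of the segment with the given pair of endpoints (for a horizontal or vertical
segment the rectilinear and the Euclidean length agree). -/
def edgeLength (e : Sym2 Pt) : ℝ := Sym2.lift ⟨dist1, dist1_comm⟩ e

/-- A finite rectilinear graph: a plane graph whose vertices are points and whose edges are
nondegenerate horizontal or vertical segments, given by their endpoints, that meet each other
(and the vertex set) only at their endpoints. -/
structure RectGraph where
  verts : Finset Pt
  edges : Finset (Sym2 Pt)
  left_mem : ∀ u v, s(u, v) ∈ edges → u ∈ verts
  loopless : ∀ u, s(u, u) ∉ edges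
  axis_parallel : ∀ u v, s(u, v) ∈ edges → u.1 = v.1 ∨ u.2 = v.2
  edge_inter : ∀ u v a b, s(u, v) ∈ edges → s(a, b) ∈ edges → s(u, v) ≠ s(a, b) →
    ∀ z, z ∈ segment ℝ u v → z ∈ segment ℝ a b → (z = u ∨ z = v) ∧ (z = a ∨ z = b)
  vert_inter : ∀ u v, s(u, v) ∈ edges → ∀ z ∈ verts, z ∈ segment ℝ u v → z = u ∨ z = v

namespace RectGraph

/-- The underlying abstract graph, on the type of all points (points that are not vertices are
isolated). -/
def graph (G : RectGraph) : SimpleGraph Pt := SimpleGraph.fromEdgeSet (G.edges : Set (Sym2 Pt))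

/-- The weight `l(G)`, the total length of the edges. -/
def weight (G : RectGraph) : ℝ := ∑ e ∈ G.edges, edgeLength e

/-- The length of a walk. -/
def walkLength (G : RectGraph) {u v : Pt} (π : G.graph.Walk u v) : ℝ :=
  (π.edges.map edgeLength).sum

open Classical in
/-- The subgraph induced by the vertices that lie in `S`. -/
def induce (G : RectGraph) (S : Set Pt) : RectGraph where
  verts := G.verts.filter (fun v => v ∈ S)
  edges := G.edges.filter (fun e => ∀ v ∈ e, v ∈ S)
  left_mem u v h := by
    rw [Finset.mem_filter] at h ⊢
    exact ⟨G.left_mem u v h.1, h.2 u (Sym2.mem_mk_left u v)⟩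
  loopless u h := G.loopless u (Finset.mem_filter.1 h).1
  axis_parallel u v h := G.axis_parallel u v (Finset.mem_filter.1 h).1
  edge_inter u v a b h h' := G.edge_inter u v a b (Finset.mem_filter.1 h).1
    (Finset.mem_filter.1 h').1
  vert_inter u v h z hz := G.vert_inter u v (Finset.mem_filter.1 h).1 z (Finset.mem_filter.1 hz).1

/-- The connected component of `G` that contains the vertex `v`. -/
def component (G : RectGraph) (v : Pt) : RectGraph := G.induce {u | G.graph.Reachable v u}

end RectGraph

/-! ### Arborescences and forest arborescences -/

/-- `p` covers `q`. -/
def Covers (p q : Pt) : Prop := p.1 ≤ q.1 ∧ p.2 ≤ q.2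

/-- `T` is a rectilinear Steiner arborescence for `P` with the root `r`: a rectilinear tree
through `P ∪ {r}` in which each `p ∈ P`, which has to be covered by `r`, is joined to `r` by a
path of length `(x(p) - x(r)) + (y(p) - y(r))`. -/
structure IsRSA (T : RectGraph) (P : Set Pt) (r : Pt) : Prop where
  acyclic : T.graph.IsAcyclic
  connected : ∀ u ∈ T.verts, ∀ v ∈ T.verts, T.graph.Reachable u v
  points_mem : ∀ p ∈ P, p ∈ T.verts
  root_mem : r ∈ T.verts
  covers : ∀ p ∈ P, Covers r p
  path : ∀ p ∈ P, ∃ π : T.graph.Walk p r,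
    π.IsPath ∧ T.walkLength π = (p.1 - r.1) + (p.2 - r.2)

/-- `F` is a rectilinear Steiner forest arborescence for `P` with the root set `R`: a rectilinear
forest through all points of `P`, each connected component of which is a rectilinear Steiner
arborescence, for the points of `P` that it contains, rooted at some root in `R`. -/
structure IsRSFA (F : RectGraph) (P R : Finset Pt) : Prop where
  acyclic : F.graph.IsAcyclic
  points_mem : ∀ p ∈ P, p ∈ F.verts
  component_rsa : ∀ v ∈ F.verts, ∃ r ∈ R,
    IsRSA (F.component v) {p | p ∈ P ∧ p ∈ (F.component v).verts} r

/-- `F` is a minimum-weight rectilinear Steiner forest arborescence. -/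
def IsMinRSFA (F : RectGraph) (P R : Finset Pt) : Prop :=
  IsRSFA F P R ∧ ∀ F' : RectGraph, IsRSFA F' P R → F.weight ≤ F'.weight

/-- An instance of the problem: disjoint finite sets of points and of roots in the (closed) first
quadrant, the origin being a root, both listed without repetition in an arbitrary order. -/
structure Instance where
  pts : List Pt
  roots : List Pt
  pts_nodup : pts.Nodup
  roots_nodup : roots.Nodup
  disjoint : ∀ p ∈ pts, p ∉ roots
  pts_quadrant : ∀ p ∈ pts, 0 ≤ p.1 ∧ 0 ≤ p.2
  roots_quadrant : ∀ r ∈ roots, 0 ≤ r.1 ∧ 0 ≤ r.2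
  origin_mem : (0, 0) ∈ roots

/-- The number of points. -/
def Instance.n (I : Instance) : ℕ := I.pts.length

/-- The number of roots. -/
def Instance.m (I : Instance) : ℕ := I.roots.length

/-! ### The real RAM

A random access machine with word registers, real registers, a word memory and a real memory, both
memories addressed by words. A program can refer to registers by fixed numbers only, so that it
uses finitely many of them. Reals are exact but can only be copied, added, subtracted and compared;
words are natural numbers less than `2 ^ w`, where `w` is the word length, that can be added,
subtracted and compared. Every executed operation and every evaluated test costs one step. -/

/-- The states of the machine; `out` is the list of the segments that have been output. -/
structure State where
  wreg : ℕ → ℕ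
  rreg : ℕ → ℝ
  wmem : ℕ → ℕ
  rmem : ℕ → ℝ
  out : List (Pt × Pt)

/-- All words of the state have at most `w` bits. -/
def State.Fits (w : ℕ) (σ : State) : Prop :=
  (∀ i, σ.wreg i < 2 ^ w) ∧ (∀ i, σ.wmem i < 2 ^ w)

/-- The elementary operations; the arguments (except the constant `c`) are register numbers. -/
inductive Op : Type
  | wconst (d c : ℕ)
  | wadd (d a b : ℕ)
  | wsub (d a b : ℕ)
  | wload (d a : ℕ)
  | wstore (a s : ℕ)
  | radd (d a b : ℕ)
  | rsub (d a b : ℕ)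
  | rload (d a : ℕ)
  | rstore (a s : ℕ)
  | emit (a b c d : ℕ)

/-- The effect of an operation (subtraction of words is truncated at zero). -/
def Op.apply (σ : State) : Op → State
  | .wconst d c => { σ with wreg := Function.update σ.wreg d c }
  | .wadd d a b => { σ with wreg := Function.update σ.wreg d (σ.wreg a + σ.wreg b) }
  | .wsub d a b => { σ with wreg := Function.update σ.wreg d (σ.wreg a - σ.wreg b) }
  | .wload d a => { σ with wreg := Function.update σ.wreg d (σ.wmem (σ.wreg a)) }
  | .wstore a s => { σ with wmem := Function.update σ.wmem (σ.wreg a) (σ.wreg s) }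
  | .radd d a b => { σ with rreg := Function.update σ.rreg d (σ.rreg a + σ.rreg b) }
  | .rsub d a b => { σ with rreg := Function.update σ.rreg d (σ.rreg a - σ.rreg b) }
  | .rload d a => { σ with rreg := Function.update σ.rreg d (σ.rmem (σ.wreg a)) }
  | .rstore a s => { σ with rmem := Function.update σ.rmem (σ.wreg a) (σ.rreg s) }
  | .emit a b c d =>
    { σ with out := σ.out ++ [((σ.rreg a, σ.rreg b), (σ.rreg c, σ.rreg d))] }

/-- The tests: comparison of two word registers or of two real registers. -/
inductive Test : Type
  | wlt (a b : ℕ)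
  | rlt (a b : ℕ)

/-- The test succeeds in the given state. -/
def Test.Holds (σ : State) : Test → Prop
  | .wlt a b => σ.wreg a < σ.wreg b
  | .rlt a b => σ.rreg a < σ.rreg b

/-- Programs. -/
inductive Prog : Type
  | skip
  | op (o : Op)
  | seq (p q : Prog)
  | ite (c : Test) (p q : Prog)
  | loop (c : Test) (p : Prog)

/-- `Exec w p σ t τ`: with word length `w`, the program `p`, started in the state `σ`, terminates
after exactly `t` steps in the state `τ`. An operation whose result does not fit into a word gets
stuck. -/
inductive Exec (w : ℕ) : Prog → State → ℕ → State → Prop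
  | skip (σ : State) : Exec w .skip σ 1 σ
  | op (o : Op) (σ : State) (h : (o.apply σ).Fits w) : Exec w (.op o) σ 1 (o.apply σ)
  | seq {p q : Prog} {σ τ ρ : State} {s t : ℕ} (hp : Exec w p σ s τ) (hq : Exec w q τ t ρ) :
      Exec w (.seq p q) σ (s + t) ρ
  | ite_true {c : Test} {p q : Prog} {σ τ : State} {t : ℕ} (hc : c.Holds σ)
      (hp : Exec w p σ t τ) : Exec w (.ite c p q) σ (1 + t) τ
  | ite_false {c : Test} {p q : Prog} {σ τ : State} {t : ℕ} (hc : ¬ c.Holds σ)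
      (hq : Exec w q σ t τ) : Exec w (.ite c p q) σ (1 + t) τ
  | loop_done {c : Test} {p : Prog} {σ : State} (hc : ¬ c.Holds σ) :
      Exec w (.loop c p) σ 1 σ
  | loop_step {c : Test} {p : Prog} {σ τ ρ : State} {s t : ℕ} (hc : c.Holds σ)
      (hp : Exec w p σ s τ) (hl : Exec w (.loop c p) τ t ρ) :
      Exec w (.loop c p) σ (1 + s + t) ρ

/-- The machine is deterministic. -/
theorem Exec.deterministic {w : ℕ} {p : Prog} {σ τ τ' : State} {t t' : ℕ}
    (h : Exec w p σ t τ) (h' : Exec w p σ t' τ') : t = t' ∧ τ = τ' := by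
  induction h generalizing t' τ' with
  | skip σ => cases h'; exact ⟨rfl, rfl⟩
  | op o σ h => cases h'; exact ⟨rfl, rfl⟩
  | seq hp hq ihp ihq =>
    cases h' with
    | seq hp' hq' =>
      obtain ⟨rfl, rfl⟩ := ihp hp'
      obtain ⟨rfl, rfl⟩ := ihq hq'
      exact ⟨rfl, rfl⟩
  | ite_true hc hp ih =>
    cases h' with
    | ite_true _ hp' => obtain ⟨rfl, rfl⟩ := ih hp'; exact ⟨rfl, rfl⟩
    | ite_false hc' _ => exact absurd hc hc'
  | ite_false hc hp ih =>
    cases h' with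
    | ite_true hc' _ => exact absurd hc' hc
    | ite_false _ hp' => obtain ⟨rfl, rfl⟩ := ih hp'; exact ⟨rfl, rfl⟩
  | loop_done hc =>
    cases h' with
    | loop_done _ => exact ⟨rfl, rfl⟩
    | loop_step hc' _ _ => exact absurd hc' hc
  | loop_step hc hp hl ihp ihl =>
    cases h' with
    | loop_done hc' => exact absurd hc hc'
    | loop_step _ hp' hl' =>
      obtain ⟨rfl, rfl⟩ := ihp hp'
      obtain ⟨rfl, rfl⟩ := ihl hl'
      exact ⟨rfl, rfl⟩

/-- The initial state for an instance: the word registers 0 and 1 hold `n` and `m`, and the real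
memory holds, from address 0 on, the coordinates of the points followed by those of the roots.
Everything else is zero, and nothing has been output. -/
def Instance.input (I : Instance) : State where
  wreg i := if i = 0 then I.n else if i = 1 then I.m else 0
  rreg _ := 0
  wmem _ := 0
  rmem i := ((I.pts ++ I.roots).flatMap (fun p => [p.1, p.2])).getD i 0
  out := []

/-- The output `L` is a list of the edges of `F`, each listed once, and `F` has no vertices besides
the endpoints of these edges. -/
def Describes (L : List (Pt × Pt)) (F : RectGraph) : Prop :=
  (L.map (fun e => s(e.1, e.2))).Nodup ∧
  (∀ e : Sym2 Pt, e ∈ F.edges ↔ e ∈ L.map (fun e => s(e.1, e.2))) ∧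
  (∀ v : Pt, v ∈ F.verts ↔ ∃ e ∈ F.edges, v ∈ e)

end RSFA

end

/-!
The problem is solved by dynamic programming over the subsets of `P`.

*From graphs to networks.* Directed away from the origin, the edges of a forest arborescence form a
network (`Net`): a finite set of directed axis-parallel edges along which every point of `P` can be
reached from a root (`IsRSFA.net`). In such a network edges may cross or overlap, but in one of
minimum weight they do not. No edge can enter a vertex that is reachable otherwise
(`MinNet.not_rch_erase`), so that no vertex has two entering edges and no root has any; and
subdividing an edge at an interior point leaves the network minimum, so that the same applies to the
interior points of edges. Hence a minimum network is a plane forest, and it is a forest arborescence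
(`MinNet.isRSFA`). The two problems have the same solutions.

*The recursion.* The length of a monotone path is the difference of the heights `x + y` of its ends.
For a set `S` of points let `corner S` be the highest point that covers all of them. A tree for `S`
rooted at the origin runs to the corner of `S` and branches there into trees for the parts of a
partition (`treeCost`); a forest for `S` is a single tree that hangs from the highest root covering
the corner, or is composed of two forests (`forestCost`). No network is cheaper than this recursion
says (`forestCost_le_wt`): push all points towards their roots, always the highest one first, and
let those that meet continue jointly; then each edge is used once, and its length pays for the
increase of the tree costs. Conversely, tracing the recursion back draws a network of at most this
weight (`Pending`). The edges that are drawn might overlap or coincide a priori, but as their total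
length is at most the minimum they form a minimum network, hence a plane graph, and no edge is
listed twice (`exists_describes`).

*The running time.* There are `3 ^ n` pairs of a set and one of its subsets. The machine has neither
bit operations nor multiplication, so the pairs are generated by additions: from the list of pairs
for the first `i` points, the list of those whose set has the last element `i` arises in the same
order by adding `i` to the set, and to the subset or not (`subsetPair`). In this order the codes of
the sets never decrease, and the empty subset comes last for each set, which marks the end of the
search for the best partition (`BestSplit`). While the list is traversed it is extended, so that
generating it and evaluating the recursion take a constant time per pair. The best root for a corner
depends only on the two points that determine its coordinates, so a table of `n ^ 2` entries
suffices, each computed by one scan of the `m` roots. The output pass visits the `2 ^ n` sets in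
the order of decreasing codes and replaces every marked one by its parts.

Programs are verified by weakest preconditions for the parts without loops (`Prog.wp`) and by a
rule for loops with a known number of iterations (`Terminates.loop`).
-/

noncomputable section

open Relation

set_option linter.unusedSimpArgs false

namespace RSFA

/-! ### Heights and covering -/

/-- The height of a point, its rectilinear distance from the origin for points of the first
quadrant. Along a monotone path the length is the difference of heights. -/
def hgt (z : Pt) : ℝ := z.1 + z.2

theorem Covers.refl (u : Pt) : Covers u u := ⟨le_rfl, le_rfl⟩

theorem Covers.trans {u v z : Pt} (h : Covers u v) (h' : Covers v z) : Covers u z :=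
  ⟨h.1.trans h'.1, h.2.trans h'.2⟩

theorem Covers.antisymm {u v : Pt} (h : Covers u v) (h' : Covers v u) : u = v :=
  Prod.ext (le_antisymm h.1 h'.1) (le_antisymm h.2 h'.2)

theorem Covers.hgt_le {u v : Pt} (h : Covers u v) : hgt u ≤ hgt v := add_le_add h.1 h.2

theorem Covers.hgt_lt {u v : Pt} (h : Covers u v) (hne : u ≠ v) : hgt u < hgt v := by
  refine lt_of_le_of_ne h.hgt_le fun he => hne ?_
  have h1 := h.1
  have h2 := h.2
  simp only [hgt] at he
  exact Prod.ext (by linarith) (by linarith)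

theorem dist1_of_covers {u v : Pt} (h : Covers u v) : dist1 u v = hgt v - hgt u := by
  have h1 := h.1
  have h2 := h.2
  simp only [dist1, hgt, abs_of_nonpos (sub_nonpos.2 h1), abs_of_nonpos (sub_nonpos.2 h2)]
  ring

theorem hgt_sub_le_dist1 (u v : Pt) : hgt u - hgt v ≤ dist1 u v := by
  have h1 := le_abs_self (u.1 - v.1)
  have h2 := le_abs_self (u.2 - v.2)
  simp only [hgt, dist1]
  linarith

theorem covers_of_dist1_eq {u v : Pt} (h : dist1 u v = hgt u - hgt v) : Covers v u := by
  have h1 := le_abs_self (u.1 - v.1)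
  have h2 := le_abs_self (u.2 - v.2)
  have h3 := neg_le_abs (u.1 - v.1)
  have h4 := neg_le_abs (u.2 - v.2)
  simp only [hgt, dist1] at h
  constructor <;> linarith

theorem dist1_nonneg (u v : Pt) : 0 ≤ dist1 u v := add_nonneg (abs_nonneg _) (abs_nonneg _)

/-! ### Networks -/

/-- `v` can be reached from `u` along the directed edges in `N`. -/
def Reach (N : Set (Pt × Pt)) : Pt → Pt → Prop := ReflTransGen fun u v => (u, v) ∈ N

/-- `v` can be reached from some root. -/
def Rch (N : Set (Pt × Pt)) (R : Finset Pt) (v : Pt) : Prop := ∃ r ∈ R, Reach N r v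

theorem Reach.mono {N N' : Set (Pt × Pt)} (h : N ⊆ N') {u v : Pt} (hr : Reach N u v) :
    Reach N' u v :=
  ReflTransGen.mono (r := fun u v => (u, v) ∈ N) (fun _ _ he => h he) _ _ hr

theorem Rch.mono {N N' : Set (Pt × Pt)} (h : N ⊆ N') {R : Finset Pt} {v : Pt} (hr : Rch N R v) :
    Rch N' R v := by
  obtain ⟨r, hr, hp⟩ := hr
  exact ⟨r, hr, hp.mono h⟩

theorem Rch.of_root {N : Set (Pt × Pt)} {R : Finset Pt} {r : Pt} (hr : r ∈ R) : Rch N R r :=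
  ⟨r, hr, .refl⟩

theorem Rch.tail {N : Set (Pt × Pt)} {R : Finset Pt} {u v : Pt} (hr : Rch N R u)
    (he : (u, v) ∈ N) : Rch N R v := by
  obtain ⟨r, hr, hp⟩ := hr
  exact ⟨r, hr, ReflTransGen.tail hp he⟩

theorem Rch.trans {N : Set (Pt × Pt)} {R : Finset Pt} {u v : Pt} (hr : Rch N R u)
    (he : Reach N u v) : Rch N R v := by
  obtain ⟨r, hr, hp⟩ := hr
  exact ⟨r, hr, ReflTransGen.trans hp he⟩

/-- Induction along the paths from the roots. -/
theorem Rch.induct {N : Set (Pt × Pt)} {R : Finset Pt} {p : Pt → Prop} (hroot : ∀ r ∈ R, p r)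
    (hstep : ∀ u v, Rch N R u → p u → (u, v) ∈ N → p v) {v : Pt} (h : Rch N R v) : p v := by
  obtain ⟨r, hr, hp⟩ := h
  induction hp with
  | refl => exact hroot r hr
  | tail hab hbc ih => exact hstep _ _ ⟨r, hr, hab⟩ ih hbc

/-- A network: a finite set of directed axis-parallel edges, each leading away from the origin,
along which every point of `P` can be reached from some root. -/
structure Net (R P : Finset Pt) (N : Finset (Pt × Pt)) : Prop where
  axis : ∀ e ∈ N, e.1.1 = e.2.1 ∨ e.1.2 = e.2.2
  covers : ∀ e ∈ N, Covers e.1 e.2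
  ne : ∀ e ∈ N, e.1 ≠ e.2
  rch : ∀ p ∈ P, Rch N R p

/-- The total length of a finite set of edges. -/
def wt (N : Finset (Pt × Pt)) : ℝ := ∑ e ∈ N, dist1 e.1 e.2

/-- A network of minimum weight. -/
def MinNet (R P : Finset Pt) (N : Finset (Pt × Pt)) : Prop :=
  Net R P N ∧ ∀ N', Net R P N' → wt N ≤ wt N'

theorem wt_nonneg (N : Finset (Pt × Pt)) : 0 ≤ wt N :=
  Finset.sum_nonneg fun _ _ => dist1_nonneg _ _

theorem wt_erase {N : Finset (Pt × Pt)} {e : Pt × Pt} (he : e ∈ N) :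
    wt (N.erase e) + dist1 e.1 e.2 = wt N :=
  Finset.sum_erase_add _ _ he

theorem wt_insert_le (N : Finset (Pt × Pt)) (e : Pt × Pt) :
    wt (insert e N) ≤ wt N + dist1 e.1 e.2 := by
  by_cases he : e ∈ N
  · rw [Finset.insert_eq_of_mem he]
    exact le_add_of_nonneg_right (dist1_nonneg _ _)
  · exact (Finset.sum_insert he).le.trans (add_comm _ _).le

section
variable {R P : Finset Pt} {N : Finset (Pt × Pt)}

theorem Net.hgt_lt (h : Net R P N) {u v : Pt} (he : (u, v) ∈ N) : hgt u < hgt v :=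
  (h.covers _ he).hgt_lt (h.ne _ he)

theorem Net.covers_of_reach (h : Net R P N) {u v : Pt} (hr : Reach N u v) : Covers u v := by
  induction hr with
  | refl => exact Covers.refl _
  | tail _ hbc ih => exact ih.trans (h.covers _ hbc)

/-- A path to `v` does not use an edge into another point that is at least as high. -/
theorem reach_erase_of_hgt_le (hN : ∀ e ∈ N, Covers e.1 e.2 ∧ e.1 ≠ e.2) {a v b z : Pt}
    (hr : Reach N a v) (hv : hgt v ≤ hgt z) (hne : v ≠ z) : Reach (N.erase (b, z)) a v := by
  induction hr with
  | refl => exact .refl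
  | @tail c d hac hcd ih =>
    have hlt : hgt c < hgt d := (hN _ hcd).1.hgt_lt (hN _ hcd).2
    refine ReflTransGen.tail (ih (hlt.le.trans hv) ?_) ?_
    · rintro rfl
      exact absurd hv (not_le.2 hlt)
    · exact Finset.mem_coe.2 (Finset.mem_erase.2 ⟨fun h => hne (congrArg Prod.snd h), hcd⟩)

theorem MinNet.false_of_erase (h : MinNet R P N) {e : Pt × Pt} (he : e ∈ N)
    (hr : ∀ p ∈ P, Rch (N.erase e) R p) : False := by
  have h1 : Net R P (N.erase e) :=
    ⟨fun x hx => h.1.axis x (Finset.mem_of_mem_erase hx),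
      fun x hx => h.1.covers x (Finset.mem_of_mem_erase hx),
      fun x hx => h.1.ne x (Finset.mem_of_mem_erase hx), hr⟩
  have h2 := h.2 _ h1
  have h3 := wt_erase he
  have h4 := dist1_of_covers (h.1.covers e he)
  have h5 := h.1.hgt_lt (u := e.1) (v := e.2) he
  linarith

/-- In a minimum network no edge has an endpoint that can be reached without it. -/
theorem MinNet.not_rch_erase (h : MinNet R P N) {b v : Pt} (he : (b, v) ∈ N) :
    ¬ Rch (N.erase (b, v)) R v := by
  intro hv
  refine h.false_of_erase he fun p hp => ?_
  refine Rch.induct (fun r hr => Rch.of_root hr) (fun c d _ hc hcd => ?_) (h.1.rch p hp)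
  by_cases hd : (c, d) = (b, v)
  · obtain rfl : d = v := congrArg Prod.snd hd
    exact hv
  · exact hc.tail (Finset.mem_coe.2 (Finset.mem_erase.2 ⟨hd, hcd⟩))

theorem MinNet.rch_start (h : MinNet R P N) {u v : Pt} (he : (u, v) ∈ N) : Rch N R u := by
  by_contra hu
  refine h.false_of_erase he fun p hp => ?_
  refine Rch.induct (fun r hr => Rch.of_root hr) (fun c d hc0 hc hcd => ?_) (h.1.rch p hp)
  refine hc.tail (Finset.mem_coe.2 (Finset.mem_erase.2 ⟨fun hd => hu ?_, hcd⟩))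
  obtain rfl : c = u := congrArg Prod.fst hd
  exact hc0

theorem MinNet.rch_end (h : MinNet R P N) {u v : Pt} (he : (u, v) ∈ N) : Rch N R v :=
  (h.rch_start he).tail he

theorem MinNet.unique_pred (h : MinNet R P N) {a b v : Pt} (ha : (a, v) ∈ N) (hb : (b, v) ∈ N) :
    a = b := by
  by_contra hne
  refine h.not_rch_erase hb ?_
  obtain ⟨r, hr, hp⟩ := h.rch_start ha
  have hlt := h.1.hgt_lt ha
  refine Rch.tail ⟨r, hr, reach_erase_of_hgt_le (fun e he => ⟨h.1.covers e he, h.1.ne e he⟩) hp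
    hlt.le ?_⟩ (u := a) ?_
  · rintro rfl; exact lt_irrefl _ hlt
  · exact Finset.mem_coe.2 (Finset.mem_erase.2 ⟨fun hd => hne (congrArg Prod.fst hd), ha⟩)

theorem MinNet.root_no_pred (h : MinNet R P N) {a r : Pt} (hr : r ∈ R) : (a, r) ∉ N :=
  fun ha => h.not_rch_erase ha (Rch.of_root hr)

end

/-! ### Minimum networks are plane forests -/

theorem covers_of_mem_segment {a b z : Pt} (hab : Covers a b) (hz : z ∈ segment ℝ a b) :
    Covers a z ∧ Covers z b := by
  obtain ⟨s, t, hs, ht, hst, rfl⟩ := hz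
  obtain rfl : s = 1 - t := by linarith
  have h1 := hab.1
  have h2 := hab.2
  refine ⟨⟨?_, ?_⟩, ?_, ?_⟩ <;> simp only [Prod.fst_add, Prod.snd_add, Prod.smul_fst, Prod.smul_snd,
    smul_eq_mul] <;> nlinarith

theorem axis_of_mem_segment {a b z : Pt} (hab : Covers a b) (hz : z ∈ segment ℝ a b)
    (h : a.1 = b.1 ∨ a.2 = b.2) : (a.1 = z.1 ∨ a.2 = z.2) ∧ (z.1 = b.1 ∨ z.2 = b.2) := by
  obtain ⟨⟨h1, h2⟩, h3, h4⟩ := covers_of_mem_segment hab hz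
  rcases h with h | h
  · exact ⟨.inl (by linarith), .inl (by linarith)⟩
  · exact ⟨.inr (by linarith), .inr (by linarith)⟩

section
variable {R P : Finset Pt} {N : Finset (Pt × Pt)}

/-- The network in which the edge `(a, b)` is subdivided at `z`. -/
def subdivide (N : Finset (Pt × Pt)) (a b z : Pt) : Finset (Pt × Pt) :=
  insert (a, z) (insert (z, b) (N.erase (a, b)))

theorem Net.subdivide (h : Net R P N) {a b z : Pt} (hab : (a, b) ∈ N) (hz : z ∈ segment ℝ a b)
    (hza : z ≠ a) (hzb : z ≠ b) : Net R P (subdivide N a b z) := by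
  have hc := covers_of_mem_segment (h.covers _ hab) hz
  have hx := axis_of_mem_segment (h.covers _ hab) hz (h.axis _ hab)
  constructor
  · intro e he
    simp only [RSFA.subdivide, Finset.mem_insert, Finset.mem_erase] at he
    rcases he with rfl | rfl | he
    exacts [hx.1, hx.2, h.axis e he.2]
  · intro e he
    simp only [RSFA.subdivide, Finset.mem_insert, Finset.mem_erase] at he
    rcases he with rfl | rfl | he
    exacts [hc.1, hc.2, h.covers e he.2]
  · intro e he
    simp only [RSFA.subdivide, Finset.mem_insert, Finset.mem_erase] at he
    rcases he with rfl | rfl | he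
    exacts [hza.symm, hzb, h.ne e he.2]
  · intro p hp
    refine Rch.induct (fun r hr => Rch.of_root hr) (fun c d _ hc hcd => ?_) (h.rch p hp)
    by_cases hd : (c, d) = (a, b)
    · obtain ⟨rfl, rfl⟩ := Prod.ext_iff.1 hd
      exact (hc.tail (v := z) (by simp [RSFA.subdivide])).tail (by simp [RSFA.subdivide])
    · refine hc.tail ?_
      have hcd' : (c, d) ∈ N := hcd
      simp only [RSFA.subdivide, Finset.coe_insert, Finset.coe_erase]
      exact .inr (.inr ⟨hcd', hd⟩)

theorem wt_subdivide_le (h : Net R P N) {a b z : Pt} (hab : (a, b) ∈ N)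
    (hz : z ∈ segment ℝ a b) : wt (subdivide N a b z) ≤ wt N := by
  have hc := covers_of_mem_segment (h.covers _ hab) hz
  have h1 := wt_insert_le (insert (z, b) (N.erase (a, b))) (a, z)
  have h2 := wt_insert_le (N.erase (a, b)) (z, b)
  have h3 := wt_erase hab
  have h4 := dist1_of_covers (h.covers _ hab)
  have h5 := dist1_of_covers hc.1
  have h6 := dist1_of_covers hc.2
  simp only [subdivide] at *
  linarith

theorem MinNet.subdivide (h : MinNet R P N) {a b z : Pt} (hab : (a, b) ∈ N)
    (hz : z ∈ segment ℝ a b) (hza : z ≠ a) (hzb : z ≠ b) : MinNet R P (subdivide N a b z) :=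
  ⟨h.1.subdivide hab hz hza hzb, fun N' hN' => (wt_subdivide_le h.1 hab hz).trans (h.2 N' hN')⟩

theorem MinNet.interior_not_root (h : MinNet R P N) {a b z : Pt} (hab : (a, b) ∈ N)
    (hz : z ∈ segment ℝ a b) (hza : z ≠ a) (hzb : z ≠ b) : z ∉ R := fun hr =>
  (h.subdivide hab hz hza hzb).root_no_pred (a := a) hr (by simp [RSFA.subdivide])

theorem MinNet.interior_not_end (h : MinNet R P N) {a b c z : Pt} (hab : (a, b) ∈ N)
    (hz : z ∈ segment ℝ a b) (hza : z ≠ a) (hzb : z ≠ b) : (c, z) ∉ N := by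
  intro hcz
  have hmin := h.subdivide hab hz hza hzb
  have hcz' : (c, z) ∈ N.erase (a, b) :=
    Finset.mem_erase.2 ⟨fun he => hzb (Prod.ext_iff.1 he).2, hcz⟩
  obtain rfl : c = a := hmin.unique_pred
    (Finset.mem_insert_of_mem (Finset.mem_insert_of_mem hcz')) (Finset.mem_insert_self _ _)
  -- The edge `(a, z)` was present already, so that the subdivision has saved weight.
  have hle := h.2 _ hmin.1
  have hc := covers_of_mem_segment (h.1.covers _ hab) hz
  have h2 := wt_insert_le (N.erase (c, b)) (z, b)
  have h3 := wt_erase hab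
  have h4 := dist1_of_covers (h.1.covers _ hab)
  have h6 := dist1_of_covers hc.2
  have h7 := hc.1.hgt_lt hza.symm
  simp only [RSFA.subdivide, Finset.insert_eq_of_mem (Finset.mem_insert_of_mem hcz')] at *
  linarith

theorem MinNet.interior_not_start (h : MinNet R P N) {a b d z : Pt} (hab : (a, b) ∈ N)
    (hz : z ∈ segment ℝ a b) (hza : z ≠ a) (hzb : z ≠ b) : (z, d) ∉ N := by
  intro hzd
  obtain ⟨r, hr, hp⟩ := h.rch_start hzd
  rcases ReflTransGen.cases_tail hp with rfl | ⟨c, _, hcz⟩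
  · exact h.interior_not_root hab hz hza hzb hr
  · exact h.interior_not_end hab hz hza hzb hcz

theorem MinNet.interior_disjoint (h : MinNet R P N) {a b c d z : Pt} (hab : (a, b) ∈ N)
    (hz : z ∈ segment ℝ a b) (hza : z ≠ a) (hzb : z ≠ b) (hcd : (c, d) ∈ N)
    (hne : (c, d) ≠ (a, b)) : z ∉ segment ℝ c d := by
  intro hz'
  by_cases hzc : z = c
  · subst hzc; exact h.interior_not_start hab hz hza hzb hcd
  by_cases hzd : z = d
  · subst hzd; exact h.interior_not_end hab hz hza hzb hcd
  refine (h.subdivide hab hz hza hzb).interior_not_end (a := c) (b := d) (c := a) (z := z) ?_ hz'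
    hzc hzd (by simp [RSFA.subdivide])
  exact Finset.mem_insert_of_mem (Finset.mem_insert_of_mem (Finset.mem_erase.2 ⟨hne, hcd⟩))

theorem MinNet.mem_endpoint (h : MinNet R P N) {a b c d z : Pt} (hab : (a, b) ∈ N)
    (hcd : (c, d) ∈ N) (hne : (a, b) ≠ (c, d)) (hz : z ∈ segment ℝ a b)
    (hz' : z ∈ segment ℝ c d) : z = a ∨ z = b := by
  by_contra hcon
  obtain ⟨h1, h2⟩ := not_or.1 hcon
  exact h.interior_disjoint hab hz h1 h2 hcd hne.symm hz'

theorem mem_image_sym2 {u v : Pt} :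
    s(u, v) ∈ N.image (fun e => s(e.1, e.2)) ↔ (u, v) ∈ N ∨ (v, u) ∈ N := by
  simp only [Finset.mem_image, Sym2.eq_iff]
  constructor
  · rintro ⟨e, he, ⟨rfl, rfl⟩ | ⟨rfl, rfl⟩⟩
    exacts [.inl he, .inr he]
  · rintro (he | he)
    exacts [⟨_, he, .inl ⟨rfl, rfl⟩⟩, ⟨_, he, .inr ⟨rfl, rfl⟩⟩]

theorem mem_endpoints {v : Pt} :
    v ∈ N.image Prod.fst ∪ N.image Prod.snd ↔ (∃ d, (v, d) ∈ N) ∨ ∃ c, (c, v) ∈ N := by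
  simp only [Finset.mem_union, Finset.mem_image]
  refine or_congr ⟨?_, ?_⟩ ⟨?_, ?_⟩
  · rintro ⟨e, he, rfl⟩; exact ⟨_, he⟩
  · rintro ⟨d, hd⟩; exact ⟨_, hd, rfl⟩
  · rintro ⟨e, he, rfl⟩; exact ⟨_, he⟩
  · rintro ⟨d, hd⟩; exact ⟨_, hd, rfl⟩

/-- The plane graph formed by the edges of a minimum network. -/
def MinNet.toRectGraph (h : MinNet R P N) : RectGraph where
  verts := N.image Prod.fst ∪ N.image Prod.snd
  edges := N.image fun e => s(e.1, e.2)
  left_mem u v he :=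
    mem_endpoints.2 ((mem_image_sym2.1 he).imp (fun he => ⟨v, he⟩) fun he => ⟨v, he⟩)
  loopless u he := by
    rcases mem_image_sym2.1 he with he | he <;> exact h.1.ne _ he rfl
  axis_parallel u v he := by
    rcases mem_image_sym2.1 he with he | he
    · exact h.1.axis _ he
    · exact (h.1.axis _ he).imp Eq.symm Eq.symm
  edge_inter := by
    -- The general case follows from the one in which both edges are directed as in the network.
    have key : ∀ u v a b, (u, v) ∈ N → (a, b) ∈ N → s(u, v) ≠ s(a, b) →
        ∀ z, z ∈ segment ℝ u v → z ∈ segment ℝ a b → (z = u ∨ z = v) ∧ (z = a ∨ z = b) := by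
      intro u v a b hu ha hne z hz hz'
      have hne' : (u, v) ≠ (a, b) := fun h => hne (by
        obtain ⟨rfl, rfl⟩ := Prod.ext_iff.1 h; rfl)
      exact ⟨h.mem_endpoint hu ha hne' hz hz', h.mem_endpoint ha hu hne'.symm hz' hz⟩
    intro u v a b hu ha hne z hz hz'
    rcases mem_image_sym2.1 hu with hu | hu <;> rcases mem_image_sym2.1 ha with ha | ha
    · exact key u v a b hu ha hne z hz hz'
    · have := key u v b a hu ha (by rwa [Sym2.eq_swap (a := b)]) z hz (segment_symm ℝ a b ▸ hz')
      exact ⟨this.1, this.2.symm⟩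
    · have := key v u a b hu ha (by rwa [Sym2.eq_swap (a := v)]) z (segment_symm ℝ u v ▸ hz) hz'
      exact ⟨this.1.symm, this.2⟩
    · have := key v u b a hu ha (by rwa [Sym2.eq_swap (a := v), Sym2.eq_swap (a := b)]) z
        (segment_symm ℝ u v ▸ hz) (segment_symm ℝ a b ▸ hz')
      exact ⟨this.1.symm, this.2.symm⟩
  vert_inter := by
    have key : ∀ u v, (u, v) ∈ N → ∀ z ∈ N.image Prod.fst ∪ N.image Prod.snd,
        z ∈ segment ℝ u v → z = u ∨ z = v := by
      intro u v hu z hz hzs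
      by_contra hcon
      obtain ⟨h1, h2⟩ := not_or.1 hcon
      rcases mem_endpoints.1 hz with ⟨d, hd⟩ | ⟨c, hc⟩
      · exact h.interior_not_start hu hzs h1 h2 hd
      · exact h.interior_not_end hu hzs h1 h2 hc
    intro u v hu z hz hzs
    rcases mem_image_sym2.1 hu with hu | hu
    · exact key u v hu z hz hzs
    · exact (key v u hu z hz (segment_symm ℝ u v ▸ hzs)).symm

theorem MinNet.mem_edges (h : MinNet R P N) {u v : Pt} :
    s(u, v) ∈ h.toRectGraph.edges ↔ (u, v) ∈ N ∨ (v, u) ∈ N := mem_image_sym2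

theorem MinNet.mem_verts (h : MinNet R P N) {v : Pt} :
    v ∈ h.toRectGraph.verts ↔ (∃ d, (v, d) ∈ N) ∨ ∃ c, (c, v) ∈ N := mem_endpoints

theorem adj_iff {G : RectGraph} {u v : Pt} : G.graph.Adj u v ↔ s(u, v) ∈ G.edges := by
  simp only [RectGraph.graph, SimpleGraph.fromEdgeSet_adj, Finset.mem_coe, and_iff_left_iff_imp]
  rintro he rfl
  exact G.loopless u he

theorem MinNet.adj_iff (h : MinNet R P N) {u v : Pt} :
    h.toRectGraph.graph.Adj u v ↔ (u, v) ∈ N ∨ (v, u) ∈ N := by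
  rw [RSFA.adj_iff, h.mem_edges]

theorem MinNet.weight_eq (h : MinNet R P N) : h.toRectGraph.weight = wt N := by
  refine Finset.sum_image ?_
  rintro ⟨a, b⟩ he ⟨c, d⟩ he' heq
  rcases Sym2.eq_iff.1 heq with ⟨h1, h2⟩ | ⟨h1, h2⟩
  · exact Prod.ext h1 h2
  · simp only at h1 h2
    subst h1 h2
    exact absurd (h.1.hgt_lt he) (not_lt.2 (h.1.hgt_lt he').le)

/-- An edge `(u, v)` of a minimum network is a bridge, since the points that can be reached from
`v` are joined to the others by this edge only. -/
theorem MinNet.isAcyclic (h : MinNet R P N) : h.toRectGraph.graph.IsAcyclic := by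
  have key : ∀ u v, (u, v) ∈ N →
      ¬ (h.toRectGraph.graph.deleteEdges {s(v, u)}).Reachable v u := by
    intro u v huv hr
    rw [SimpleGraph.reachable_iff_reflTransGen] at hr
    have hmem : ∀ z, ReflTransGen (h.toRectGraph.graph.deleteEdges {s(v, u)}).Adj
        v z → Reach N v z := by
      intro z hz
      induction hz with
      | refl => exact .refl
      | @tail c d _ hcd ih =>
        simp only [SimpleGraph.deleteEdges_adj, h.adj_iff, Set.mem_singleton_iff] at hcd
        obtain ⟨hcd | hcd, hne⟩ := hcd
        · exact ReflTransGen.tail ih hcd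
        · rcases ReflTransGen.cases_tail ih with rfl | ⟨c', hc', hc'c⟩
          · obtain rfl := h.unique_pred hcd huv
            exact absurd rfl hne
          · obtain rfl := h.unique_pred hcd hc'c
            exact hc'
    exact absurd (h.1.covers_of_reach (hmem u hr)).hgt_le (not_le.2 (h.1.hgt_lt huv))
  rw [SimpleGraph.isAcyclic_iff_forall_adj_isBridge]
  intro u v huv
  rw [SimpleGraph.isBridge_iff]
  rcases h.adj_iff.1 huv with he | he
  · intro hr
    exact key u v he (by rw [Sym2.eq_swap]; exact hr.symm)
  · exact key v u he

end

/-! ### Minimum networks are forest arborescences -/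

section
variable {R P : Finset Pt} {N : Finset (Pt × Pt)}

theorem mem_component_verts {G : RectGraph} {u v : Pt} :
    u ∈ (G.component v).verts ↔ u ∈ G.verts ∧ G.graph.Reachable v u := by
  simp [RectGraph.component, RectGraph.induce]

theorem mem_component_edges {G : RectGraph} {v a b : Pt} :
    s(a, b) ∈ (G.component v).edges ↔
      s(a, b) ∈ G.edges ∧ G.graph.Reachable v a ∧ G.graph.Reachable v b := by
  simp [RectGraph.component, RectGraph.induce]

theorem component_graph_le (G : RectGraph) (v : Pt) : (G.component v).graph ≤ G.graph := by
  intro a b hab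
  rw [adj_iff] at hab ⊢
  exact (mem_component_edges.1 hab).1

theorem component_adj {G : RectGraph} {v a b : Pt} (ha : G.graph.Reachable v a)
    (hab : G.graph.Adj a b) : (G.component v).graph.Adj a b :=
  adj_iff.2 (mem_component_edges.2 ⟨adj_iff.1 hab, ha, ha.trans hab.reachable⟩)

theorem component_reachable {G : RectGraph} {v a b : Pt} (ha : G.graph.Reachable v a)
    (hab : G.graph.Reachable a b) : (G.component v).graph.Reachable a b := by
  rw [SimpleGraph.reachable_iff_reflTransGen] at hab
  induction hab with
  | refl => exact .refl _
  | tail hac hcd ih =>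
    refine ih.trans (SimpleGraph.Adj.reachable (component_adj (ha.trans ?_) hcd))
    rwa [SimpleGraph.reachable_iff_reflTransGen]

theorem MinNet.reachable_of_reach (h : MinNet R P N) {u v : Pt} (hr : Reach N u v) :
    h.toRectGraph.graph.Reachable u v := by
  induction hr with
  | refl => exact .refl _
  | tail _ hcd ih => exact ih.trans (SimpleGraph.Adj.reachable (h.adj_iff.2 (.inl hcd)))

/-- The vertices below a root `r` form a union of connected components. -/
theorem MinNet.reach_of_reachable (h : MinNet R P N) {r u v : Pt} (hr : r ∈ R)
    (hu : Reach N r u) (huv : h.toRectGraph.graph.Reachable u v) : Reach N r v := by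
  rw [SimpleGraph.reachable_iff_reflTransGen] at huv
  induction huv with
  | refl => exact hu
  | @tail c d _ hcd ih =>
    rcases h.adj_iff.1 hcd with hcd | hcd
    · exact ReflTransGen.tail ih hcd
    · rcases ReflTransGen.cases_tail ih with rfl | ⟨c', hc', hc'c⟩
      · exact absurd hcd (h.root_no_pred hr)
      · obtain rfl := h.unique_pred hcd hc'c
        exact hc'

/-- A directed path is a path in the graph, of length the difference of heights. -/
theorem MinNet.exists_path (h : MinNet R P N) {v r p : Pt}
    (hv : h.toRectGraph.graph.Reachable v r) (hp : Reach N r p) :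
    ∃ π : (h.toRectGraph.component v).graph.Walk p r,
      π.IsPath ∧ (h.toRectGraph.component v).walkLength π = hgt p - hgt r ∧
        ∀ z ∈ π.support, hgt z ≤ hgt p := by
  induction hp with
  | refl => exact ⟨.nil, .nil, by simp [RectGraph.walkLength], by simp⟩
  | @tail c d hrc hcd ih =>
    obtain ⟨π, hπ, hlen, hsup⟩ := ih
    have hlt := h.1.hgt_lt hcd
    have hadj : (h.toRectGraph.component v).graph.Adj d c :=
      (component_adj (hv.trans (h.reachable_of_reach hrc)) (h.adj_iff.2 (.inl hcd))).symm
    refine ⟨.cons hadj π, ?_, ?_, ?_⟩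
    · rw [SimpleGraph.Walk.cons_isPath_iff]
      exact ⟨hπ, fun hd => absurd (hsup d hd) (not_le.2 hlt)⟩
    · simp only [RectGraph.walkLength, SimpleGraph.Walk.edges_cons, List.map_cons,
        List.sum_cons] at hlen ⊢
      rw [hlen, edgeLength, Sym2.lift_mk]
      simp only
      rw [dist1_comm, dist1_of_covers (h.1.covers _ hcd)]
      ring
    · intro z hz
      rw [SimpleGraph.Walk.support_cons, List.mem_cons] at hz
      rcases hz with rfl | hz
      exacts [le_rfl, (hsup z hz).trans hlt.le]

theorem MinNet.isRSFA (h : MinNet R P N) (hPR : ∀ p ∈ P, p ∉ R) : IsRSFA h.toRectGraph P R := by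
  refine ⟨h.isAcyclic, fun p hp => ?_, fun v hv => ?_⟩
  · obtain ⟨r, hr, hrp⟩ := h.1.rch p hp
    rcases ReflTransGen.cases_tail hrp with rfl | ⟨c, _, hc⟩
    · exact absurd hr (hPR _ hp)
    · exact h.mem_verts.2 (.inr ⟨c, hc⟩)
  · have hrch : Rch N R v := by
      rcases h.mem_verts.1 hv with ⟨d, hd⟩ | ⟨c, hc⟩
      exacts [h.rch_start hd, h.rch_end hc]
    obtain ⟨r, hr, hrv⟩ := hrch
    have hvr : h.toRectGraph.graph.Reachable v r := (h.reachable_of_reach hrv).symm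
    have hreach : ∀ p ∈ (h.toRectGraph.component v).verts, Reach N r p := fun p hp =>
      h.reach_of_reachable hr hrv (mem_component_verts.1 hp).2
    refine ⟨r, hr, h.isAcyclic.anti (component_graph_le _ _), fun a ha b hb => ?_,
      fun p hp => hp.2, ?_, fun p hp => h.1.covers_of_reach (hreach p hp.2), fun p hp => ?_⟩
    · have ha' := (mem_component_verts.1 ha).2
      exact component_reachable ha' (ha'.symm.trans (mem_component_verts.1 hb).2)
    · refine mem_component_verts.2 ⟨?_, hvr⟩
      rcases ReflTransGen.cases_head hrv with rfl | ⟨d, hd, _⟩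
      exacts [hv, h.mem_verts.2 (.inl ⟨d, hd⟩)]
    · obtain ⟨π, hπ, hlen, -⟩ := h.exists_path hvr (hreach p hp.2)
      exact ⟨π, hπ, hlen.trans (by simp only [hgt]; ring)⟩

end

/-! ### Every forest arborescence is a network -/

open Classical in
/-- The edges of a rectilinear graph, directed away from the origin. -/
def RectGraph.toNet (G : RectGraph) : Finset (Pt × Pt) :=
  (G.verts ×ˢ G.verts).filter fun e => s(e.1, e.2) ∈ G.edges ∧ Covers e.1 e.2

theorem RectGraph.mem_toNet {G : RectGraph} {u v : Pt} :
    (u, v) ∈ G.toNet ↔ s(u, v) ∈ G.edges ∧ Covers u v := by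
  simp only [toNet, Finset.mem_filter, Finset.mem_product, and_iff_right_iff_imp]
  exact fun h => ⟨G.left_mem u v h.1, G.left_mem v u (Sym2.eq_swap ▸ h.1)⟩

theorem RectGraph.wt_toNet (G : RectGraph) : wt G.toNet = G.weight := by
  have himg : G.edges = G.toNet.image (fun e => s(e.1, e.2)) := by
    ext e
    induction e using Sym2.ind with | _ u v => ?_
    rw [mem_image_sym2 (N := G.toNet), mem_toNet, mem_toNet, Sym2.eq_swap (a := v), ← and_or_left]
    refine ⟨fun h => ⟨h, ?_⟩, fun h => h.1⟩
    rcases G.axis_parallel u v h with hx | hx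
    · rcases le_total u.2 v.2 with hy | hy
      exacts [.inl ⟨hx.le, hy⟩, .inr ⟨hx.ge, hy⟩]
    · rcases le_total u.1 v.1 with hy | hy
      exacts [.inl ⟨hy, hx.le⟩, .inr ⟨hy, hx.ge⟩]
  rw [weight, himg]
  refine (Finset.sum_image (s := G.toNet) (g := fun e => s(e.1, e.2)) (f := edgeLength) ?_).symm
  rintro ⟨a, b⟩ he ⟨c, d⟩ he' heq
  rcases Sym2.eq_iff.1 heq with ⟨h1, h2⟩ | ⟨h1, h2⟩
  · exact Prod.ext h1 h2
  · simp only at h1 h2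
    subst h1 h2
    rw [(mem_toNet.1 he).2.antisymm (mem_toNet.1 he').2]

/-- A walk whose length is the difference of the heights of its ends descends in every step. -/
theorem reach_of_walk {G : RectGraph} {N : Set (Pt × Pt)}
    (hN : ∀ u v, s(u, v) ∈ G.edges → Covers u v → (u, v) ∈ N) {u v : Pt}
    (π : G.graph.Walk u v) :
    hgt u - hgt v ≤ G.walkLength π ∧ (G.walkLength π = hgt u - hgt v → Reach N v u) := by
  induction π with
  | nil => exact ⟨by simp [RectGraph.walkLength], fun _ => .refl⟩
  | @cons u w v hadj π ih =>
    have hlen : G.walkLength (.cons hadj π) = dist1 u w + G.walkLength π := by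
      simp only [RectGraph.walkLength, SimpleGraph.Walk.edges_cons, List.map_cons, List.sum_cons]
      rfl
    have hge := hgt_sub_le_dist1 u w
    have h1 := ih.1
    rw [hlen]
    refine ⟨by linarith, fun heq => ReflTransGen.tail (ih.2 (by linarith)) (hN _ _ ?_ ?_)⟩
    · rw [Sym2.eq_swap]; exact adj_iff.1 hadj
    · exact covers_of_dist1_eq (by linarith)

theorem IsRSFA.net {F : RectGraph} {R P : Finset Pt} (h : IsRSFA F P R) : Net R P F.toNet := by
  refine ⟨fun e he => F.axis_parallel _ _ (RectGraph.mem_toNet.1 he).1,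
    fun e he => (RectGraph.mem_toNet.1 he).2, fun e he heq => ?_, fun p hp => ?_⟩
  · refine F.loopless e.1 ?_
    have := (RectGraph.mem_toNet.1 he).1
    rwa [← heq] at this
  · obtain ⟨r, hr, hT⟩ := h.component_rsa p (h.points_mem p hp)
    obtain ⟨π, -, hlen⟩ := hT.path p
      ⟨hp, mem_component_verts.2 ⟨h.points_mem p hp, .refl _⟩⟩
    refine ⟨r, hr, (reach_of_walk (fun u v huv hc => ?_) π).2
      (hlen.trans (by simp only [hgt]; ring))⟩
    exact RectGraph.mem_toNet.2 ⟨(mem_component_edges.1 huv).1, hc⟩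

/-- A list of edges of minimum total length that forms a network describes a minimum-weight
forest arborescence. Minimality also rules out repetitions in the list. -/
theorem exists_describes {R P : Finset Pt} {L : List (Pt × Pt)} (hPR : ∀ p ∈ P, p ∉ R)
    (hL : Net R P L.toFinset)
    (hmin : ∀ N, Net R P N → (L.map fun e => dist1 e.1 e.2).sum ≤ wt N) :
    ∃ F, Describes L F ∧ IsMinRSFA F P R := by
  have hle : ∀ l : List (Pt × Pt), (∀ e ∈ l, e.1 ≠ e.2 ∧ Covers e.1 e.2) →
      wt l.toFinset ≤ (l.map fun e => dist1 e.1 e.2).sum ∧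
        ((l.map fun e => dist1 e.1 e.2).sum ≤ wt l.toFinset → l.Nodup) := by
    intro l
    induction l with
    | nil => simp [wt]
    | cons e l ih =>
      intro hl
      have ih := ih fun x hx => hl x (List.mem_cons_of_mem _ hx)
      have he := hl e List.mem_cons_self
      have hpos : 0 < dist1 e.1 e.2 := by
        rw [dist1_of_covers he.2]
        exact sub_pos.2 (he.2.hgt_lt he.1)
      rw [List.toFinset_cons, List.map_cons, List.sum_cons, List.nodup_cons]
      by_cases hmem : e ∈ l
      · rw [Finset.insert_eq_of_mem (List.mem_toFinset.2 hmem)]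
        exact ⟨by linarith, fun h => by linarith⟩
      · have : wt (insert e l.toFinset) = dist1 e.1 e.2 + wt l.toFinset :=
          Finset.sum_insert (by simpa using hmem)
        rw [this]
        exact ⟨by linarith, fun h => ⟨hmem, ih.2 (by linarith)⟩⟩
  have hedge : ∀ e ∈ L, e.1 ≠ e.2 ∧ Covers e.1 e.2 := fun e he =>
    ⟨hL.ne e (List.mem_toFinset.2 he), hL.covers e (List.mem_toFinset.2 he)⟩
  have hle := hle L hedge
  have hM : MinNet R P L.toFinset := ⟨hL, fun N hN => hle.1.trans (hmin N hN)⟩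
  refine ⟨hM.toRectGraph, ⟨?_, ?_, ?_⟩, hM.isRSFA hPR, fun F' hF' => ?_⟩
  · refine (List.nodup_map_iff_inj_on (hle.2 (hmin _ hL))).2 ?_
    intro e he e' he' heq
    rcases Sym2.eq_iff.1 heq with ⟨h1, h2⟩ | ⟨h1, h2⟩
    · exact Prod.ext h1 h2
    · have h3 := (hedge e' he').2
      rw [← h1, ← h2] at h3
      exact absurd ((hedge e he).2.antisymm h3) (hedge e he).1
  · intro e
    simp [MinNet.toRectGraph]
  · intro v
    rw [hM.mem_verts]
    constructor
    · rintro (⟨d, hd⟩ | ⟨c, hc⟩)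
      · exact ⟨_, hM.mem_edges.2 (.inl hd), Sym2.mem_mk_left _ _⟩
      · exact ⟨_, hM.mem_edges.2 (.inl hc), Sym2.mem_mk_right _ _⟩
    · rintro ⟨e, he, hv⟩
      obtain ⟨w, rfl⟩ := hv
      rcases hM.mem_edges.1 he with he | he
      exacts [.inl ⟨_, he⟩, .inr ⟨_, he⟩]
  · rw [hM.weight_eq, ← F'.wt_toNet]
    exact hM.2 _ hF'.net

/-! ### The recursion for the minimum weight -/

/-- The componentwise minimum of the points with indices in `S`, the highest point that covers all
of them (the origin if `S` is empty). -/
def corner (pt : ℕ → Pt) (S : Finset ℕ) : Pt :=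
  if h : S.Nonempty then (S.inf' h fun i => (pt i).1, S.inf' h fun i => (pt i).2) else (0, 0)

/-- The highest root in the list `l` that covers `z`, the first one in case of a tie; the origin
is taken to be a root. -/
def bestRoot (l : List Pt) (z : Pt) : Pt :=
  open Classical in l.foldl (fun b r => if Covers r z ∧ hgt b < hgt r then r else b) (0, 0)

/-- The least value of `V A + V (S \ A)` over the partitions of `S` into nonempty sets `A` and
`S \ A`. -/
def splitInf (V : Finset ℕ → ℝ) (S : Finset ℕ) : ℝ :=
  ⨅ A : {A : Finset ℕ // A ⊂ S ∧ A.Nonempty}, (V A + V (S \ A))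

/-- The minimum weight of an arborescence for the points with indices in `S` that is rooted at the
origin: two arborescences for the parts of some partition share the way to the corner of `S`. -/
def treeCost (pt : ℕ → Pt) (S : Finset ℕ) : ℝ :=
  if 1 < S.card then
    (⨅ A : {A : Finset ℕ // A ⊂ S ∧ A.Nonempty},
      (treeCost pt A + treeCost pt (S \ A))) - hgt (corner pt S)
  else hgt (corner pt S)
termination_by S.card
decreasing_by
  · exact Finset.card_lt_card A.2.1
  · exact Finset.card_lt_card (Finset.sdiff_ssubset A.2.1.subset A.2.2)

/-- The minimum weight of a forest arborescence for the points with indices in `S`: a single tree,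
hanging from the highest possible root, or two forests for the parts of some partition. -/
def forestCost (pt : ℕ → Pt) (l : List Pt) (S : Finset ℕ) : ℝ :=
  if S = ∅ then 0
  else if 1 < S.card then
    min (treeCost pt S - hgt (bestRoot l (corner pt S)))
      (⨅ A : {A : Finset ℕ // A ⊂ S ∧ A.Nonempty},
        (forestCost pt l A + forestCost pt l (S \ A)))
  else treeCost pt S - hgt (bestRoot l (corner pt S))
termination_by S.card
decreasing_by
  · exact Finset.card_lt_card A.2.1
  · exact Finset.card_lt_card (Finset.sdiff_ssubset A.2.1.subset A.2.2)

section
variable {pt : ℕ → Pt} {l : List Pt} {S A B : Finset ℕ} {V : Finset ℕ → ℝ}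

theorem corner_eq (h : S.Nonempty) :
    corner pt S = (S.inf' h fun i => (pt i).1, S.inf' h fun i => (pt i).2) := dif_pos h

theorem covers_corner_iff (h : S.Nonempty) {z : Pt} :
    Covers z (corner pt S) ↔ ∀ i ∈ S, Covers z (pt i) := by
  simp only [corner_eq h, Covers, Finset.le_inf'_iff]
  exact ⟨fun h i hi => ⟨h.1 i hi, h.2 i hi⟩, fun h => ⟨fun i hi => (h i hi).1,
    fun i hi => (h i hi).2⟩⟩

theorem corner_covers {i : ℕ} (hi : i ∈ S) : Covers (corner pt S) (pt i) :=
  (covers_corner_iff ⟨i, hi⟩).1 (Covers.refl _) i hi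

theorem corner_covers_corner (hA : A.Nonempty) (hAS : A ⊆ S) :
    Covers (corner pt S) (corner pt A) :=
  (covers_corner_iff hA).2 fun _ hi => corner_covers (hAS hi)

@[simp] theorem corner_singleton (i : ℕ) : corner pt {i} = pt i := by
  simp [corner_eq (Finset.singleton_nonempty i)]

theorem corner_insert {i : ℕ} (h : S.Nonempty) :
    corner pt (insert i S) =
      (min (pt i).1 (corner pt S).1, min (pt i).2 (corner pt S).2) := by
  rw [corner_eq h, corner_eq (Finset.insert_nonempty i S), Finset.inf'_insert h,
    Finset.inf'_insert h]

theorem bestRoot_foldl (z : Pt) (l : List Pt) (b : Pt) (hb : Covers b z) :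
    let c := open Classical in
      l.foldl (fun b r => if Covers r z ∧ hgt b < hgt r then r else b) b
    Covers c z ∧ (c = b ∨ c ∈ l) ∧ hgt b ≤ hgt c ∧ ∀ r ∈ l, Covers r z → hgt r ≤ hgt c := by
  induction l generalizing b with
  | nil => exact ⟨hb, .inl rfl, le_rfl, by simp⟩
  | cons r l ih =>
    simp only [List.foldl_cons]
    split_ifs with hr
    · obtain ⟨h1, h2, h3, h4⟩ := ih r hr.1
      refine ⟨h1, .inr (List.mem_cons.2 h2), hr.2.le.trans h3, fun r' hr' hc => ?_⟩
      rcases List.mem_cons.1 hr' with rfl | hr'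
      exacts [h3, h4 r' hr' hc]
    · obtain ⟨h1, h2, h3, h4⟩ := ih b hb
      refine ⟨h1, h2.imp_right (List.mem_cons_of_mem _), h3, fun r' hr' hc => ?_⟩
      rcases List.mem_cons.1 hr' with rfl | hr'
      · exact (not_lt.1 fun h => hr ⟨hc, h⟩).trans h3
      · exact h4 r' hr' hc

theorem bestRoot_covers {z : Pt} (hz : Covers (0, 0) z) : Covers (bestRoot l z) z :=
  (bestRoot_foldl z l _ hz).1

theorem bestRoot_mem {z : Pt} (hz : Covers (0, 0) z) (hl : (0, 0) ∈ l) : bestRoot l z ∈ l :=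
  (bestRoot_foldl z l _ hz).2.1.elim (fun h => by rw [bestRoot, h]; exact hl) id

theorem hgt_le_bestRoot {z r : Pt} (hz : Covers (0, 0) z) (hr : r ∈ l) (hc : Covers r z) :
    hgt r ≤ hgt (bestRoot l z) :=
  (bestRoot_foldl z l _ hz).2.2.2 r hr hc

theorem finite_splits (S : Finset ℕ) : Finite {A : Finset ℕ // A ⊂ S ∧ A.Nonempty} :=
  Set.Finite.to_subtype ((S.powerset.finite_toSet).subset fun _ hA =>
    Finset.mem_coe.2 (Finset.mem_powerset.2 hA.1.subset))

theorem splitInf_le (hA : A ⊂ S) (hne : A.Nonempty) : splitInf V S ≤ V A + V (S \ A) := by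
  have := finite_splits S
  exact ciInf_le (Set.finite_range _).bddBelow (⟨A, hA, hne⟩ : {A // A ⊂ S ∧ A.Nonempty})

theorem one_lt_card_of_split (hA : A ⊂ S) (hne : A.Nonempty) : 1 < S.card :=
  (Nat.succ_le_of_lt (Finset.card_pos.2 hne)).trans_lt (Finset.card_lt_card hA)

theorem exists_splitInf (h : 1 < S.card) :
    ∃ A, A ⊂ S ∧ A.Nonempty ∧ splitInf V S = V A + V (S \ A) := by
  have := finite_splits S
  obtain ⟨i, hi⟩ := Finset.card_pos.1 (zero_lt_one.trans h)
  have : Nonempty {A : Finset ℕ // A ⊂ S ∧ A.Nonempty} :=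
    ⟨{i}, by
      refine Finset.ssubset_iff_subset_ne.2 ⟨Finset.singleton_subset_iff.2 hi, ?_⟩
      rintro rfl
      simp at h, Finset.singleton_nonempty i⟩
  obtain ⟨A, hA⟩ := exists_eq_ciInf_of_finite
    (f := fun A : {A : Finset ℕ // A ⊂ S ∧ A.Nonempty} => V A + V (S \ A))
  exact ⟨A, A.2.1, A.2.2, hA.symm⟩

theorem insert_sdiff_ssubset {i : ℕ} (hi : i ∉ S) (hA : A ⊆ S) : A ⊂ insert i S :=
  (Finset.ssubset_iff_of_subset (hA.trans (Finset.subset_insert i S))).2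
    ⟨i, Finset.mem_insert_self i S, fun h => hi (hA h)⟩

/-- It suffices to consider the partitions in which a fixed element lies in the second part. -/
theorem splitInf_insert {i : ℕ} (hi : i ∉ S) {v : ℝ}
    (hv : ∃ A ⊆ S, A.Nonempty ∧ v = V A + V (insert i S \ A))
    (hmin : ∀ A ⊆ S, A.Nonempty → v ≤ V A + V (insert i S \ A)) :
    splitInf V (insert i S) = v := by
  refine le_antisymm ?_ ?_
  · obtain ⟨A, hA, hne, rfl⟩ := hv
    exact splitInf_le (insert_sdiff_ssubset hi hA) hne
  · obtain ⟨A, hA, hne, -⟩ := hv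
    obtain ⟨B, hB, hBne, heq⟩ := exists_splitInf (V := V)
      (one_lt_card_of_split (insert_sdiff_ssubset hi hA) hne)
    rw [heq]
    by_cases hiB : i ∈ B
    · have h1 : insert i S \ B ⊆ S := by
        intro j hj
        rw [Finset.mem_sdiff, Finset.mem_insert] at hj
        rcases hj.1 with rfl | h
        exacts [absurd hiB hj.2, h]
      have h2 := hmin _ h1 (Finset.sdiff_nonempty.2 hB.2)
      rw [Finset.sdiff_sdiff_eq_self hB.subset] at h2
      linarith
    · refine hmin B (fun j hj => ?_) hBne
      rcases Finset.mem_insert.1 (hB.subset hj) with rfl | h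
      exacts [absurd hj hiB, h]

theorem treeCost_of_one_lt (h : 1 < S.card) :
    treeCost pt S = splitInf (treeCost pt) S - hgt (corner pt S) := by
  rw [treeCost, if_pos h]; rfl

theorem treeCost_singleton (i : ℕ) : treeCost pt {i} = hgt (pt i) := by
  rw [treeCost, if_neg (by simp), corner_singleton]

theorem treeCost_le (hA : A ⊂ S) (hne : A.Nonempty) :
    treeCost pt S ≤ treeCost pt A + treeCost pt (S \ A) - hgt (corner pt S) := by
  rw [treeCost_of_one_lt (one_lt_card_of_split hA hne)]
  exact sub_le_sub_right (splitInf_le hA hne) _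

theorem hgt_corner_le_treeCost (h : S.Nonempty) : hgt (corner pt S) ≤ treeCost pt S := by
  induction S using Finset.strongInduction with | _ S ih => ?_
  by_cases h1 : 1 < S.card
  · obtain ⟨A, hA, hne, heq⟩ := exists_splitInf (V := treeCost pt) h1
    rw [treeCost_of_one_lt h1, heq]
    have hne' := Finset.sdiff_nonempty.2 hA.2
    have h2 := ih A hA hne
    have h3 := ih (S \ A) (Finset.sdiff_ssubset hA.subset hne) hne'
    have h4 := (corner_covers_corner (pt := pt) hne hA.subset).hgt_le
    have h5 := (corner_covers_corner (pt := pt) hne' Finset.sdiff_subset).hgt_le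
    linarith
  · rw [treeCost, if_neg h1]

@[simp] theorem forestCost_empty : forestCost pt l ∅ = 0 := by
  rw [forestCost, if_pos rfl]

theorem forestCost_of_one_lt (h : 1 < S.card) :
    forestCost pt l S = min (treeCost pt S - hgt (bestRoot l (corner pt S)))
      (splitInf (forestCost pt l) S) := by
  rw [forestCost, if_neg (by rintro rfl; simp at h), if_pos h]; rfl

theorem forestCost_singleton (i : ℕ) :
    forestCost pt l {i} = treeCost pt {i} - hgt (bestRoot l (corner pt {i})) := by
  rw [forestCost, if_neg (by simp), if_neg (by simp)]

theorem forestCost_le_tree (h : S.Nonempty) :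
    forestCost pt l S ≤ treeCost pt S - hgt (bestRoot l (corner pt S)) := by
  rw [forestCost, if_neg h.ne_empty]
  split_ifs
  exacts [min_le_left _ _, le_rfl]

theorem forestCost_le_split (hA : A ⊂ S) (hne : A.Nonempty) :
    forestCost pt l S ≤ forestCost pt l A + forestCost pt l (S \ A) := by
  rw [forestCost_of_one_lt (one_lt_card_of_split hA hne)]
  exact (min_le_right _ _).trans (splitInf_le hA hne)

theorem forestCost_union_le (h : Disjoint A B) :
    forestCost pt l (A ∪ B) ≤ forestCost pt l A + forestCost pt l B := by
  rcases A.eq_empty_or_nonempty with rfl | hA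
  · simp
  rcases B.eq_empty_or_nonempty with rfl | hB
  · simp
  have h1 : A ⊂ A ∪ B := by
    refine (Finset.ssubset_iff_of_subset Finset.subset_union_left).2 ?_
    obtain ⟨i, hi⟩ := hB
    exact ⟨i, Finset.mem_union_right _ hi, fun hiA => Finset.disjoint_left.1 h hiA hi⟩
  have h2 := forestCost_le_split (pt := pt) (l := l) h1 hA
  rwa [Finset.union_sdiff_cancel_left h] at h2

theorem forestCost_cases (h : S.Nonempty) :
    forestCost pt l S = treeCost pt S - hgt (bestRoot l (corner pt S)) ∨
      ∃ A, A ⊂ S ∧ A.Nonempty ∧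
        forestCost pt l S = forestCost pt l A + forestCost pt l (S \ A) := by
  by_cases h1 : 1 < S.card
  · rw [forestCost_of_one_lt h1]
    obtain ⟨A, hA, hne, heq⟩ := exists_splitInf (V := forestCost pt l) h1
    rcases min_cases (treeCost pt S - hgt (bestRoot l (corner pt S)))
      (splitInf (forestCost pt l) S) with h | h
    · exact .inl h.1
    · exact .inr ⟨A, hA, hne, h.1.trans heq⟩
  · rw [forestCost, if_neg h.ne_empty, if_neg h1]
    exact .inl rfl

theorem origin_covers_corner (h : S.Nonempty) (hq : ∀ i ∈ S, Covers (0, 0) (pt i)) :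
    Covers (0, 0) (corner pt S) := (covers_corner_iff h).2 hq

theorem forestCost_nonneg (hq : ∀ i ∈ S, Covers (0, 0) (pt i)) : 0 ≤ forestCost pt l S := by
  induction S using Finset.strongInduction with | _ S ih => ?_
  rcases S.eq_empty_or_nonempty with rfl | h
  · simp
  rcases forestCost_cases (pt := pt) (l := l) h with heq | ⟨A, hA, hne, heq⟩
  · have h1 := hgt_corner_le_treeCost (pt := pt) h
    have h2 := (bestRoot_covers (l := l) (origin_covers_corner h hq)).hgt_le
    linarith
  · have h1 := ih A hA fun i hi => hq i (hA.subset hi)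
    have h2 := ih (S \ A) (Finset.sdiff_ssubset hA.subset hne)
      fun i hi => hq i (Finset.sdiff_subset hi)
    linarith

/-! ### The recursion bounds the weight of every network from below -/

/-- The minimum weight of an arborescence rooted at `z`, which has to cover the points; the value
is 0 if there are no points. -/
def treeCostFrom (pt : ℕ → Pt) (z : Pt) (S : Finset ℕ) : ℝ :=
  if S = ∅ then 0 else treeCost pt S - hgt z

theorem treeCostFrom_union_le {z : Pt} (h : Disjoint A B) (hA : ∀ i ∈ A, Covers z (pt i))
    (hB : ∀ i ∈ B, Covers z (pt i)) :
    treeCostFrom pt z (A ∪ B) ≤ treeCostFrom pt z A + treeCostFrom pt z B := by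
  rcases A.eq_empty_or_nonempty with rfl | hAne
  · simp [treeCostFrom]
  rcases B.eq_empty_or_nonempty with rfl | hBne
  · simp [treeCostFrom]
  have hne : (A ∪ B).Nonempty := hAne.mono Finset.subset_union_left
  have h1 : A ⊂ A ∪ B := by
    refine (Finset.ssubset_iff_of_subset Finset.subset_union_left).2 ?_
    obtain ⟨i, hi⟩ := hBne
    exact ⟨i, Finset.mem_union_right _ hi, fun hiA => Finset.disjoint_left.1 h hiA hi⟩
  have h2 := treeCost_le (pt := pt) h1 hAne
  rw [Finset.union_sdiff_cancel_left h] at h2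
  have h3 : Covers z (corner pt (A ∪ B)) := (covers_corner_iff hne).2 fun i hi =>
    (Finset.mem_union.1 hi).elim (hA i) (hB i)
  have h4 := h3.hgt_le
  simp only [treeCostFrom, hAne.ne_empty, hBne.ne_empty, hne.ne_empty, if_false]
  linarith

theorem forestCost_le_sum (S : Finset ℕ) (loc : ℕ → Pt) (Z : Finset Pt) :
    forestCost pt l (S.filter fun i => loc i ∈ Z) ≤
      ∑ z ∈ Z, forestCost pt l (S.filter fun i => loc i = z) := by
  induction Z using Finset.induction_on with
  | empty => simp
  | insert z Z hz ih =>
    rw [Finset.sum_insert hz]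
    have h1 : (S.filter fun i => loc i ∈ insert z Z) =
        (S.filter fun i => loc i = z) ∪ S.filter fun i => loc i ∈ Z := by
      ext i; simp only [Finset.mem_filter, Finset.mem_insert, Finset.mem_union]; tauto
    rw [h1]
    refine (forestCost_union_le ?_).trans (add_le_add_right ih _)
    rw [Finset.disjoint_filter]
    rintro i - rfl
    exact hz

/-- The points are moved down to the roots along the edges of the network, always the highest ones
first; those that meet continue jointly. Every edge is used once only, and pays for the way. -/
theorem forestCost_le_of_moves {n : ℕ} (hq : ∀ i < n, Covers (0, 0) (pt i))
    (N : Finset (Pt × Pt)) (hN : ∀ e ∈ N, Covers e.1 e.2 ∧ e.1 ≠ e.2) (loc : ℕ → Pt)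
    (hloc : ∀ i < n, Covers (loc i) (pt i)) (hrch : ∀ i < n, Rch N l.toFinset (loc i))
    (Z : Finset Pt) (hZ : ∀ i < n, loc i ∈ Z) :
    forestCost pt l (Finset.range n) ≤
      ∑ z ∈ Z, treeCostFrom pt z ((Finset.range n).filter fun i => loc i = z) + wt N := by
  induction hcard : N.card generalizing N loc Z with
  | zero =>
    obtain rfl := Finset.card_eq_zero.1 hcard
    have hroot : ∀ i < n, loc i ∈ l := by
      intro i hi
      obtain ⟨r, hr, hp⟩ := hrch i hi
      rcases ReflTransGen.cases_tail hp with h | ⟨c, _, hc⟩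
      · rw [h]; exact List.mem_toFinset.1 hr
      · simp at hc
    have h1 := forestCost_le_sum (pt := pt) (l := l) (Finset.range n) loc Z
    rw [Finset.filter_true_of_mem fun i hi => hZ i (Finset.mem_range.1 hi)] at h1
    refine (h1.trans (Finset.sum_le_sum fun z _ => ?_)).trans
      (le_add_of_nonneg_right (wt_nonneg _))
    rw [treeCostFrom]
    split_ifs with hS
    · rw [hS, forestCost_empty]
    · have hne := Finset.nonempty_iff_ne_empty.2 hS
      have hz : z ∈ l := by
        obtain ⟨i, hi⟩ := hne
        rw [Finset.mem_filter, Finset.mem_range] at hi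
        exact hi.2 ▸ hroot i hi.1
      refine (forestCost_le_tree hne).trans (sub_le_sub_left (hgt_le_bestRoot ?_ hz ?_) _)
      · refine origin_covers_corner hne fun i hi => hq i ?_
        simp only [Finset.mem_filter, Finset.mem_range] at hi
        exact hi.1
      · refine (covers_corner_iff hne).2 fun i hi => ?_
        simp only [Finset.mem_filter, Finset.mem_range] at hi
        exact hi.2 ▸ hloc i hi.1
  | succ k ih =>
    by_cases hroot : ∀ i < n, loc i ∈ l.toFinset
    · -- No point has to be moved any more, so that some edge can be dropped.
      obtain ⟨e, he⟩ := (Finset.card_pos (s := N)).1 (by omega)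
      have h1 := ih (N.erase e) (fun x hx => hN x (Finset.mem_of_mem_erase hx)) loc hloc
        (fun i hi => Rch.of_root (hroot i hi)) Z hZ
        (by rw [Finset.card_erase_of_mem he, hcard]; rfl)
      have h2 := wt_erase he
      have h3 := dist1_nonneg e.1 e.2
      linarith
    push Not at hroot
    obtain ⟨i₀, hi₀, hmax⟩ := Finset.exists_max_image
      ((Finset.range n).filter fun i => loc i ∉ l.toFinset) (fun i => hgt (loc i)) (by
        obtain ⟨i, hi, hir⟩ := hroot
        exact ⟨i, Finset.mem_filter.2 ⟨Finset.mem_range.2 hi, hir⟩⟩)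
    rw [Finset.mem_filter, Finset.mem_range] at hi₀
    generalize hz : loc i₀ = z at *
    obtain ⟨r, hr, hp⟩ := hrch i₀ hi₀.1
    rw [hz] at hp
    rcases ReflTransGen.cases_tail hp with h | ⟨u, hu, huz⟩
    · exact absurd (h ▸ hr) hi₀.2
    have huz' : (u, z) ∈ N := huz
    have hlt : hgt u < hgt z := (hN _ huz').1.hgt_lt (hN _ huz').2
    have hne : u ≠ z := (hN _ huz').2
    have hu' : Rch (N.erase (u, z)) l.toFinset u :=
      ⟨r, hr, reach_erase_of_hgt_le hN hu hlt.le hne⟩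
    have hcov : ∀ i < n, Covers (if loc i = z then u else loc i) (pt i) := by
      intro i hi
      split_ifs with h
      · exact (hN _ huz').1.trans (h ▸ hloc i hi)
      · exact hloc i hi
    have h1 := ih (N.erase (u, z)) (fun x hx => hN x (Finset.mem_of_mem_erase hx))
      (fun i => if loc i = z then u else loc i) hcov (fun i hi => ?_) (insert u Z) (fun i hi => ?_)
      (by rw [Finset.card_erase_of_mem huz', hcard]; rfl)
    · have h2 := wt_erase huz'
      have h3 := dist1_of_covers (hN _ huz').1
      set F : Pt → Finset ℕ := fun v => (Finset.range n).filter fun i => loc i = v with hF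
      set F' : Pt → Finset ℕ := fun v =>
        (Finset.range n).filter fun i => (if loc i = z then u else loc i) = v with hF'
      have hzZ : z ∈ insert u Z := Finset.mem_insert_of_mem (hz ▸ hZ i₀ hi₀.1)
      have hFz : F z ≠ ∅ := Finset.ne_empty_of_mem
        (Finset.mem_filter.2 ⟨Finset.mem_range.2 hi₀.1, hz⟩)
      have hsum : ∑ v ∈ insert u Z, treeCostFrom pt v (F v) = ∑ v ∈ Z, treeCostFrom pt v (F v) := by
        by_cases huZ : u ∈ Z
        · rw [Finset.insert_eq_of_mem huZ]
        · rw [Finset.sum_insert huZ]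
          have : F u = ∅ := Finset.filter_eq_empty_iff.2 fun i hi h =>
            huZ (h ▸ hZ i (Finset.mem_range.1 hi))
          simp [this, treeCostFrom]
      have hle : ∀ v ∈ insert u Z, treeCostFrom pt v (F' v) ≤ treeCostFrom pt v (F v) +
          (if v = u then treeCostFrom pt z (F z) + (hgt z - hgt u) else 0) -
          (if v = z then treeCostFrom pt z (F z) else 0) := by
        intro v _
        by_cases hvu : v = u
        · subst hvu
          have hunion : F' v = F v ∪ F z := by
            ext i
            simp only [hF, hF', Finset.mem_filter, Finset.mem_union]
            split_ifs with h
            · simp [h, hne.symm]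
            · simp [h]
          have hdisj : Disjoint (F v) (F z) := by
            rw [Finset.disjoint_filter]
            rintro i - h h'
            exact hne (h.symm.trans h')
          have h4 : treeCostFrom pt v (F z) = treeCostFrom pt z (F z) + (hgt z - hgt v) := by
            simp only [treeCostFrom, hFz, if_false]; ring
          rw [hunion, if_pos rfl, if_neg hne, ← h4, sub_zero]
          refine treeCostFrom_union_le hdisj (fun i hi => ?_) fun i hi => ?_
          · simp only [hF, Finset.mem_filter, Finset.mem_range] at hi
            exact hi.2 ▸ hloc i hi.1
          · simp only [hF, Finset.mem_filter, Finset.mem_range] at hi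
            have := hcov i hi.1
            rwa [if_pos hi.2] at this
        · by_cases hvz : v = z
          · subst hvz
            have : F' v = ∅ := by
              refine Finset.filter_eq_empty_iff.2 fun i _ => ?_
              split_ifs with h
              exacts [hne, h]
            simp [this, treeCostFrom, hvu]
          · have : F' v = F v := by
              refine Finset.filter_congr fun i _ => ?_
              split_ifs with h
              · simp [h, Ne.symm hvz, Ne.symm hvu]
              · rfl
            simp [this, hvu, hvz]
      have h5 := Finset.sum_le_sum hle
      rw [Finset.sum_sub_distrib, Finset.sum_add_distrib, Finset.sum_ite_eq', Finset.sum_ite_eq',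
        if_pos (Finset.mem_insert_self u Z), if_pos hzZ, hsum] at h5
      simp only at h2
      linarith
    · split_ifs with h
      · exact hu'
      · by_cases hr : loc i ∈ l.toFinset
        · exact Rch.of_root hr
        · obtain ⟨r', hr', hp'⟩ := hrch i hi
          exact ⟨r', hr', reach_erase_of_hgt_le hN hp'
            (hmax i (Finset.mem_filter.2 ⟨Finset.mem_range.2 hi, hr⟩)) h⟩
    · split_ifs with h
      · exact Finset.mem_insert_self _ _
      · exact Finset.mem_insert_of_mem (hZ i hi)

theorem forestCost_le_wt {n : ℕ} (hq : ∀ i < n, Covers (0, 0) (pt i))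
    {N : Finset (Pt × Pt)} {P : Finset Pt} (hP : ∀ i < n, pt i ∈ P)
    (hinj : ∀ i < n, ∀ j < n, pt i = pt j → i = j) (hN : Net l.toFinset P N) :
    forestCost pt l (Finset.range n) ≤ wt N := by
  have h := forestCost_le_of_moves hq N (fun e he => ⟨hN.covers e he, hN.ne e he⟩) pt
    (fun i _ => Covers.refl _) (fun i hi => hN.rch _ (hP i hi)) ((Finset.range n).image pt)
    (fun i hi => Finset.mem_image_of_mem _ (Finset.mem_range.2 hi))
  -- The points start at their own places, from where nothing is to be paid.
  rw [Finset.sum_eq_zero fun z hz => ?_, zero_add] at h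
  · exact h
  obtain ⟨i, hi, rfl⟩ := Finset.mem_image.1 hz
  have hfib : ((Finset.range n).filter fun j => pt j = pt i) = {i} := by
    ext j
    simp only [Finset.mem_filter, Finset.mem_range, Finset.mem_singleton] at hi ⊢
    exact ⟨fun h => hinj j h.1 i hi h.2, by rintro rfl; exact ⟨hi, rfl⟩⟩
  rw [hfib, treeCostFrom, if_neg (Finset.singleton_ne_empty i), treeCost_singleton, sub_self]

end

/-! ### Tracing back the recursion -/

/-- The total length of a list of edges. -/
def listWt (L : List (Pt × Pt)) : ℝ := (L.map fun e => dist1 e.1 e.2).sum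

theorem listWt_append (L L' : List (Pt × Pt)) : listWt (L ++ L') = listWt L + listWt L' := by
  simp [listWt]

/-- A monotone path from `u` to `v` with at most one bend. -/
def link (u v : Pt) : List (Pt × Pt) :=
  (if u.1 < v.1 then [(u, (v.1, u.2))] else []) ++ (if u.2 < v.2 then [((v.1, u.2), v)] else [])

theorem link_spec {u v : Pt} (h : Covers u v) :
    (∀ e ∈ link u v, (e.1.1 = e.2.1 ∨ e.1.2 = e.2.2) ∧ Covers e.1 e.2 ∧ e.1 ≠ e.2) ∧
      listWt (link u v) = hgt v - hgt u ∧ Reach {e | e ∈ link u v} u v := by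
  obtain ⟨u1, u2⟩ := u
  obtain ⟨v1, v2⟩ := v
  obtain ⟨h1, h2⟩ := h
  simp only at h1 h2
  refine ⟨fun e he => ?_, ?_, ?_⟩
  · simp only [link, List.mem_append, List.mem_ite_nil_right, List.mem_singleton] at he
    rcases he with ⟨h3, rfl⟩ | ⟨h3, rfl⟩
    · exact ⟨.inr rfl, ⟨h1, le_rfl⟩, fun h => h3.ne (congrArg Prod.fst h)⟩
    · exact ⟨.inl rfl, ⟨le_rfl, h2⟩, fun h => h3.ne (congrArg Prod.snd h)⟩
  · rw [link, listWt_append]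
    have e1 : listWt (if u1 < v1 then [((u1, u2), ((v1, u2) : Pt))] else []) = v1 - u1 := by
      split_ifs with h3
      · rw [listWt, List.map_singleton, List.sum_singleton,
          dist1_of_covers (u := (u1, u2)) (v := (v1, u2)) ⟨h1, le_rfl⟩]
        simp only [hgt]; ring
      · have : u1 = v1 := le_antisymm h1 (not_lt.1 h3)
        simp [listWt, this]
    have e2 : listWt (if u2 < v2 then [((v1, u2), ((v1, v2) : Pt))] else []) = v2 - u2 := by
      split_ifs with h3
      · rw [listWt, List.map_singleton, List.sum_singleton,
          dist1_of_covers (u := (v1, u2)) (v := (v1, v2)) ⟨le_rfl, h2⟩]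
        simp only [hgt]; ring
      · have : u2 = v2 := le_antisymm h2 (not_lt.1 h3)
        simp [listWt, this]
    simp only [e1, e2, hgt]
    ring
  · have e1 : Reach {e | e ∈ link (u1, u2) (v1, v2)} (u1, u2) (v1, u2) := by
      by_cases h3 : u1 < v1
      · exact ReflTransGen.single (by simp [link, h3])
      · have : u1 = v1 := le_antisymm h1 (not_lt.1 h3)
        rw [this]; exact .refl
    refine ReflTransGen.trans e1 ?_
    by_cases h3 : u2 < v2
    · exact ReflTransGen.single (by simp [link, h3])
    · rw [le_antisymm h2 (not_lt.1 h3)]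

/-- An intermediate state of the construction of an optimal network: the edges in the list `L` have
been drawn; what remains to be drawn are optimal forests for the sets in `hm`, and optimal trees,
rooted at their corners, for the sets in `km`. -/
structure Pending (pt : ℕ → Pt) (l : List Pt) (n : ℕ) (hm km : Finset (Finset ℕ))
    (L : List (Pt × Pt)) : Prop where
  hm_sub : ∀ T ∈ hm, T.Nonempty ∧ T ⊆ Finset.range n
  km_sub : ∀ T ∈ km, T.Nonempty ∧ T ⊆ Finset.range n
  edges : ∀ e ∈ L, (e.1.1 = e.2.1 ∨ e.1.2 = e.2.2) ∧ Covers e.1 e.2 ∧ e.1 ≠ e.2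
  cost : listWt L + ∑ T ∈ hm, forestCost pt l T + ∑ T ∈ km, (treeCost pt T - hgt (corner pt T)) ≤
    forestCost pt l (Finset.range n)
  km_rch : ∀ T ∈ km, Rch {e | e ∈ L} l.toFinset (corner pt T)
  rch : ∀ i < n, (∃ T, (T ∈ hm ∨ T ∈ km) ∧ i ∈ T) ∨ Rch {e | e ∈ L} l.toFinset (pt i)

section
variable {pt : ℕ → Pt} {l : List Pt} {n : ℕ} {hm km : Finset (Finset ℕ)} {L : List (Pt × Pt)}
  {T A : Finset ℕ}

theorem sum_insert_le {f : Finset ℕ → ℝ} {s : Finset (Finset ℕ)} (h : 0 ≤ f A) :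
    ∑ T ∈ insert A s, f T ≤ f A + ∑ T ∈ s, f T := by
  by_cases hA : A ∈ s
  · rw [Finset.insert_eq_of_mem hA]
    linarith
  · rw [Finset.sum_insert hA]

theorem pending_init (hn : 0 < n) : Pending pt l n {Finset.range n} ∅ [] where
  hm_sub T hT := by
    rw [Finset.mem_singleton.1 hT]
    exact ⟨⟨0, Finset.mem_range.2 hn⟩, le_rfl⟩
  km_sub := by simp
  edges := by simp
  cost := by simp [listWt]
  km_rch := by simp
  rch i hi := .inl ⟨_, .inl (Finset.mem_singleton_self _), Finset.mem_range.2 hi⟩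

theorem Pending.split_forest (h : Pending pt l n hm km L) (hq : ∀ i < n, Covers (0, 0) (pt i))
    (hT : T ∈ hm) (hA : A ⊂ T) (hne : A.Nonempty)
    (heq : forestCost pt l T = forestCost pt l A + forestCost pt l (T \ A)) :
    Pending pt l n (insert A (insert (T \ A) (hm.erase T))) km L := by
  have hTn := (h.hm_sub T hT).2
  have hA' : (T \ A).Nonempty := Finset.sdiff_nonempty.2 hA.2
  refine ⟨fun U hU => ?_, h.km_sub, h.edges, ?_, h.km_rch, fun i hi => ?_⟩
  · simp only [Finset.mem_insert, Finset.mem_erase] at hU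
    rcases hU with rfl | rfl | hU
    exacts [⟨hne, hA.subset.trans hTn⟩, ⟨hA', Finset.sdiff_subset.trans hTn⟩, h.hm_sub U hU.2]
  · have h1 := h.cost
    have hr : ∀ U ⊆ T, 0 ≤ forestCost pt l U := fun U hU =>
      forestCost_nonneg fun i hi => hq i (Finset.mem_range.1 (hTn (hU hi)))
    have h2 := sum_insert_le (f := forestCost pt l) (s := insert (T \ A) (hm.erase T))
      (hr A hA.subset)
    have h3 := sum_insert_le (f := forestCost pt l) (s := hm.erase T)
      (hr (T \ A) Finset.sdiff_subset)
    have h4 := Finset.sum_erase_add hm (forestCost pt l) hT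
    linarith
  · rcases h.rch i hi with ⟨U, hU, hiU⟩ | h
    · left
      by_cases hUT : U = T ∧ U ∈ hm
      · obtain ⟨rfl, -⟩ := hUT
        by_cases hiA : i ∈ A
        · exact ⟨A, by simp, hiA⟩
        · exact ⟨U \ A, by simp, Finset.mem_sdiff.2 ⟨hiU, hiA⟩⟩
      · refine ⟨U, hU.imp_left fun hU => ?_, hiU⟩
        simp only [Finset.mem_insert, Finset.mem_erase]
        exact .inr (.inr ⟨fun h => hUT ⟨h, hU⟩, hU⟩)
    · exact .inr h

theorem Pending.root_tree (h : Pending pt l n hm km L) (hl : (0, 0) ∈ l)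
    (hq : ∀ i < n, Covers (0, 0) (pt i)) (hT : T ∈ hm)
    (heq : forestCost pt l T = treeCost pt T - hgt (bestRoot l (corner pt T))) :
    Pending pt l n (hm.erase T) (insert T km)
      (L ++ link (bestRoot l (corner pt T)) (corner pt T)) := by
  have hTn := h.hm_sub T hT
  have h0 : Covers (0, 0) (corner pt T) :=
    origin_covers_corner hTn.1 fun i hi => hq i (Finset.mem_range.1 (hTn.2 hi))
  obtain ⟨e1, e2, e3⟩ := link_spec (bestRoot_covers (l := l) h0)
  have hsub : {e | e ∈ L} ⊆ {e | e ∈ L ++ link (bestRoot l (corner pt T)) (corner pt T)} :=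
    fun e he => List.mem_append_left _ he
  refine ⟨fun U hU => h.hm_sub U (Finset.mem_of_mem_erase hU), fun U hU => ?_, fun e he => ?_, ?_,
    fun U hU => ?_, fun i hi => ?_⟩
  · rcases Finset.mem_insert.1 hU with rfl | hU
    exacts [hTn, h.km_sub U hU]
  · exact (List.mem_append.1 he).elim (h.edges e) (e1 e)
  · have h1 := h.cost
    have h2 := sum_insert_le (f := fun T => treeCost pt T - hgt (corner pt T)) (s := km) (A := T)
      (sub_nonneg.2 (hgt_corner_le_treeCost hTn.1))
    have h4 := Finset.sum_erase_add hm (forestCost pt l) hT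
    rw [listWt_append, e2]
    linarith
  · rcases Finset.mem_insert.1 hU with rfl | hU
    · refine Rch.trans (Rch.of_root (List.mem_toFinset.2 (bestRoot_mem h0 hl))) (e3.mono ?_)
      exact fun e he => List.mem_append_right _ he
    · exact (h.km_rch U hU).mono hsub
  · rcases h.rch i hi with ⟨U, hU, hiU⟩ | h
    · left
      refine ⟨U, ?_, hiU⟩
      simp only [Finset.mem_erase, Finset.mem_insert]
      tauto
    · exact .inr (h.mono hsub)

theorem Pending.leaf (h : Pending pt l n hm km L) {i : ℕ} (hT : {i} ∈ km) :
    Pending pt l n hm (km.erase {i}) L := by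
  refine ⟨h.hm_sub, fun U hU => h.km_sub U (Finset.mem_of_mem_erase hU), h.edges, ?_,
    fun U hU => h.km_rch U (Finset.mem_of_mem_erase hU), fun j hj => ?_⟩
  · have h1 := h.cost
    have h4 := Finset.sum_erase_add km (fun T => treeCost pt T - hgt (corner pt T)) hT
    simp only [treeCost_singleton, corner_singleton] at h4
    linarith
  · by_cases hji : j = i
    · subst hji
      have := h.km_rch _ hT
      rw [corner_singleton] at this
      exact .inr this
    · rcases h.rch j hj with ⟨U, hU, hiU⟩ | h
      · refine .inl ⟨U, hU.imp_right fun hU => Finset.mem_erase.2 ⟨?_, hU⟩, hiU⟩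
        rintro rfl
        exact hji (Finset.mem_singleton.1 hiU)
      · exact .inr h

theorem Pending.split_tree (h : Pending pt l n hm km L)
    (hT : T ∈ km) (hA : A ⊂ T) (hne : A.Nonempty)
    (heq : treeCost pt T = treeCost pt A + treeCost pt (T \ A) - hgt (corner pt T)) :
    Pending pt l n hm (insert A (insert (T \ A) (km.erase T)))
      (L ++ link (corner pt T) (corner pt A) ++ link (corner pt T) (corner pt (T \ A))) := by
  have hTn := (h.km_sub T hT).2
  have hA' : (T \ A).Nonempty := Finset.sdiff_nonempty.2 hA.2
  obtain ⟨e1, e2, e3⟩ := link_spec (corner_covers_corner (pt := pt) hne hA.subset)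
  obtain ⟨f1, f2, f3⟩ := link_spec (corner_covers_corner (pt := pt) hA' Finset.sdiff_subset)
  have hsub : {e | e ∈ L} ⊆ {e | e ∈ L ++ link (corner pt T) (corner pt A) ++
      link (corner pt T) (corner pt (T \ A))} :=
    fun e he => List.mem_append_left _ (List.mem_append_left _ he)
  refine ⟨h.hm_sub, fun U hU => ?_, fun e he => ?_, ?_, fun U hU => ?_, fun i hi => ?_⟩
  · simp only [Finset.mem_insert, Finset.mem_erase] at hU
    rcases hU with rfl | rfl | hU
    exacts [⟨hne, hA.subset.trans hTn⟩, ⟨hA', Finset.sdiff_subset.trans hTn⟩, h.km_sub U hU.2]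
  · rcases List.mem_append.1 he with he | he
    exacts [(List.mem_append.1 he).elim (h.edges e) (e1 e), f1 e he]
  · have h1 := h.cost
    have h2 := sum_insert_le (f := fun T => treeCost pt T - hgt (corner pt T)) (A := A)
      (s := insert (T \ A) (km.erase T)) (sub_nonneg.2 (hgt_corner_le_treeCost hne))
    have h3 := sum_insert_le (f := fun T => treeCost pt T - hgt (corner pt T)) (A := T \ A)
      (s := km.erase T) (sub_nonneg.2 (hgt_corner_le_treeCost hA'))
    have h4 := Finset.sum_erase_add km (fun T => treeCost pt T - hgt (corner pt T)) hT
    rw [listWt_append, listWt_append, e2, f2]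
    linarith
  · have hTr := (h.km_rch T hT).mono hsub
    simp only [Finset.mem_insert, Finset.mem_erase] at hU
    rcases hU with rfl | rfl | hU
    · exact hTr.trans (e3.mono fun e he => List.mem_append_left _ (List.mem_append_right _ he))
    · exact hTr.trans (f3.mono fun e he => List.mem_append_right _ he)
    · exact (h.km_rch U hU.2).mono hsub
  · rcases h.rch i hi with ⟨U, hU, hiU⟩ | h
    · left
      by_cases hUT : U = T ∧ U ∈ km
      · obtain ⟨rfl, -⟩ := hUT
        by_cases hiA : i ∈ A
        · exact ⟨A, by simp, hiA⟩
        · exact ⟨U \ A, by simp, Finset.mem_sdiff.2 ⟨hiU, hiA⟩⟩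
      · refine ⟨U, hU.imp_right fun hU => ?_, hiU⟩
        simp only [Finset.mem_insert, Finset.mem_erase]
        exact .inr (.inr ⟨fun h => hUT ⟨h, hU⟩, hU⟩)
    · exact .inr (h.mono hsub)

/-- When nothing is pending, an optimal network has been drawn. -/
theorem Pending.exists_describes (h : Pending pt l n ∅ ∅ L)
    (hq : ∀ i < n, Covers (0, 0) (pt i)) (hinj : ∀ i < n, ∀ j < n, pt i = pt j → i = j)
    (hPR : ∀ i < n, pt i ∉ l) :
    ∃ F, Describes L F ∧ IsMinRSFA F ((Finset.range n).image pt) l.toFinset := by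
  have hcost : listWt L ≤ forestCost pt l (Finset.range n) := by simpa using h.cost
  have hcoe : (L.toFinset : Set (Pt × Pt)) = {e | e ∈ L} := by ext; simp
  refine RSFA.exists_describes (fun p hp => ?_) ⟨fun e he => (h.edges e (List.mem_toFinset.1 he)).1,
    fun e he => (h.edges e (List.mem_toFinset.1 he)).2.1,
    fun e he => (h.edges e (List.mem_toFinset.1 he)).2.2, fun p hp => ?_⟩ fun N hN =>
      hcost.trans (forestCost_le_wt hq
        (fun i hi => Finset.mem_image_of_mem _ (Finset.mem_range.2 hi)) hinj hN)
  · obtain ⟨i, hi, rfl⟩ := Finset.mem_image.1 hp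
    rw [List.mem_toFinset]
    exact hPR i (Finset.mem_range.1 hi)
  · obtain ⟨i, hi, rfl⟩ := Finset.mem_image.1 hp
    rw [hcoe]
    simpa using h.rch i (Finset.mem_range.1 hi)

/-- The case of no points. -/
theorem pending_of_zero : Pending pt l 0 ∅ ∅ [] :=
  ⟨by simp, by simp, by simp, by simp [listWt], by simp, by simp⟩

end

/-! ### Binary codes of finite sets -/

/-- The number whose binary digits are given by the finite set `S`. -/
def code (S : Finset ℕ) : ℕ := ∑ i ∈ S, 2 ^ i

section
variable {i n : ℕ} {S A : Finset ℕ}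

@[simp] theorem code_empty : code ∅ = 0 := rfl

theorem code_insert (hi : i ∉ S) : code (insert i S) = 2 ^ i + code S := Finset.sum_insert hi

theorem code_singleton (i : ℕ) : code {i} = 2 ^ i := Finset.sum_singleton _ _

theorem code_sdiff (h : A ⊆ S) : code (S \ A) + code A = code S := Finset.sum_sdiff h

theorem code_injective : Function.Injective code := Finset.geomSum_injective le_rfl

theorem code_lt (h : S ⊆ Finset.range n) : code S < 2 ^ n :=
  Nat.geomSum_lt le_rfl fun _ hk => Finset.mem_range.1 (h hk)

theorem subset_range_of_code_lt (h : code S < 2 ^ n) : S ⊆ Finset.range n := by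
  intro j hj
  have h1 : 2 ^ j ≤ code S :=
    Finset.single_le_sum (f := fun i => 2 ^ i) (fun _ _ => Nat.zero_le _) hj
  exact Finset.mem_range.2 ((Nat.pow_lt_pow_iff_right (by norm_num)).1 (h1.trans_lt h))

theorem code_pos (h : S.Nonempty) : 0 < code S :=
  Finset.sum_pos (fun _ _ => by positivity) h

theorem code_eq_zero : code S = 0 ↔ S = ∅ := by
  rw [← code_empty, code_injective.eq_iff]

theorem code_lt_code (h : A ⊂ S) : code A < code S := by
  have h1 := code_sdiff h.subset
  have h2 := code_pos (Finset.sdiff_nonempty.2 h.2)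
  omega

theorem code_range_add_one (n : ℕ) : code (Finset.range n) + 1 = 2 ^ n := by
  induction n with
  | zero => rfl
  | succ n ih =>
    rw [Finset.range_add_one, code_insert (by simp), pow_succ]
    omega

theorem exists_code (n v : ℕ) (h : v < 2 ^ n) : ∃ S ⊆ Finset.range n, code S = v := by
  induction n generalizing v with
  | zero => exact ⟨∅, by simp, by simp at h; simp [h]⟩
  | succ n ih =>
    by_cases hv : v < 2 ^ n
    · obtain ⟨S, hS, rfl⟩ := ih v hv
      exact ⟨S, hS.trans (Finset.range_mono (Nat.le_succ n)), rfl⟩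
    · rw [pow_succ] at h
      obtain ⟨S, hS, hc⟩ := ih (v - 2 ^ n) (by omega)
      refine ⟨insert n S, ?_, ?_⟩
      · rw [Finset.range_add_one]; exact Finset.insert_subset_insert n hS
      · rw [code_insert fun h => absurd (Finset.mem_range.1 (hS h)) (lt_irrefl n), hc]
        omega

end

/-! ### Listing the subsets of all sets -/

/-- The entry number `x` in the list of all pairs of a finite set and one of its subsets. The pairs
are sorted by the code of the set, and among the subsets of a set the empty one comes last. The
entries below `3 ^ i` belong to the subsets of `range i`; each of them gives two entries after
these, by adding `i` to the set and in the first of the two also to the subset. -/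
def subsetPair (x : ℕ) : Finset ℕ × Finset ℕ :=
  if h : x = 0 then (∅, ∅) else
    let i := Nat.log 3 x
    let y := subsetPair ((x - 3 ^ i) / 2)
    (insert i y.1, if (x - 3 ^ i) % 2 = 0 then insert i y.2 else y.2)
decreasing_by
  have : 0 < 3 ^ Nat.log 3 x := by positivity
  omega

section
variable {i a x : ℕ}

theorem subsetPair_zero : subsetPair 0 = (∅, ∅) := by rw [subsetPair]; rfl

theorem subsetPair_step (ha : a < 3 ^ i) {b : ℕ} (hb : b < 2) :
    subsetPair (3 ^ i + 2 * a + b) = (insert i (subsetPair a).1,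
      if b = 0 then insert i (subsetPair a).2 else (subsetPair a).2) := by
  have hlog : Nat.log 3 (3 ^ i + 2 * a + b) = i :=
    (Nat.log_eq_iff (.inr ⟨by norm_num, by positivity⟩)).2 ⟨by omega, by rw [pow_succ]; omega⟩
  have h0 : 3 ^ i + 2 * a + b ≠ 0 := by positivity
  have h1 : 3 ^ i + 2 * a + b - 3 ^ i = 2 * a + b := by omega
  rw [subsetPair, dif_neg h0]
  simp only [hlog, h1]
  rw [show (2 * a + b) / 2 = a by omega, show (2 * a + b) % 2 = b by omega]

theorem subsetPair_even (ha : a < 3 ^ i) :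
    subsetPair (3 ^ i + 2 * a) = (insert i (subsetPair a).1, insert i (subsetPair a).2) :=
  subsetPair_step ha (b := 0) (by norm_num)

theorem subsetPair_odd (ha : a < 3 ^ i) :
    subsetPair (3 ^ i + 2 * a + 1) = (insert i (subsetPair a).1, (subsetPair a).2) :=
  subsetPair_step ha (b := 1) (by norm_num)

theorem exists_eq_of_lt_pow (hx : x < 3 ^ (i + 1)) (h : ¬ x < 3 ^ i) :
    ∃ a < 3 ^ i, x = 3 ^ i + 2 * a ∨ x = 3 ^ i + 2 * a + 1 := by
  rw [pow_succ] at hx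
  exact ⟨(x - 3 ^ i) / 2, by omega, by omega⟩

theorem subsetPair_subset (hx : x < 3 ^ i) :
    (subsetPair x).1 ⊆ Finset.range i ∧ (subsetPair x).2 ⊆ (subsetPair x).1 := by
  induction i generalizing x with
  | zero =>
    obtain rfl : x = 0 := by simpa using hx
    simp [subsetPair_zero]
  | succ i ih =>
    by_cases h : x < 3 ^ i
    · exact ⟨(ih h).1.trans (Finset.range_mono (Nat.le_succ i)), (ih h).2⟩
    · obtain ⟨a, ha, rfl | rfl⟩ := exists_eq_of_lt_pow hx h
      · rw [subsetPair_even ha, Finset.range_add_one]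
        exact ⟨Finset.insert_subset_insert _ (ih ha).1, Finset.insert_subset_insert _ (ih ha).2⟩
      · rw [subsetPair_odd ha, Finset.range_add_one]
        exact ⟨Finset.insert_subset_insert _ (ih ha).1,
          (ih ha).2.trans (Finset.subset_insert _ _)⟩

theorem notMem_subsetPair (hx : x < 3 ^ i) : i ∉ (subsetPair x).1 := fun h =>
  absurd (Finset.mem_range.1 ((subsetPair_subset hx).1 h)) (lt_irrefl i)

theorem subsetPair_pow (i : ℕ) : (subsetPair (3 ^ i)).1 = {i} := by
  have := subsetPair_even (a := 0) (i := i) (by positivity)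
  rw [mul_zero, add_zero] at this
  rw [this, subsetPair_zero]; rfl

/-- The list passes to the next set exactly after the empty subset. -/
theorem code_subsetPair_succ (hx : x < 3 ^ i) :
    code (subsetPair (x + 1)).1 =
      code (subsetPair x).1 + if (subsetPair x).2 = ∅ then 1 else 0 := by
  induction i generalizing x with
  | zero =>
    obtain rfl : x = 0 := by simpa using hx
    have := subsetPair_pow 0
    rw [zero_add, if_pos (by rw [subsetPair_zero]), subsetPair_zero]
    rw [pow_zero] at this
    rw [this]; rfl
  | succ i ih =>
    by_cases h : x < 3 ^ i
    · exact ih h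
    · obtain ⟨a, ha, rfl | rfl⟩ := exists_eq_of_lt_pow hx h
      · rw [subsetPair_odd ha, subsetPair_even ha, if_neg (Finset.insert_ne_empty _ _)]; rfl
      · suffices hsuff : code (subsetPair (3 ^ i + 2 * a + 1 + 1)).1 =
            2 ^ i + code (subsetPair (a + 1)).1 by
          rw [hsuff, subsetPair_odd ha, code_insert (notMem_subsetPair ha), ih ha, add_assoc]
        by_cases ha' : a + 1 < 3 ^ i
        · rw [show 3 ^ i + 2 * a + 1 + 1 = 3 ^ i + 2 * (a + 1) by ring, subsetPair_even ha',
            code_insert (notMem_subsetPair ha')]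
        · have e1 : a + 1 = 3 ^ i := by omega
          have e2 : 3 ^ i + 2 * a + 1 + 1 = 3 ^ (i + 1) := by rw [pow_succ]; omega
          rw [e1, e2, subsetPair_pow, subsetPair_pow, code_singleton, code_singleton, pow_succ]
          ring

theorem code_subsetPair_mono {x y : ℕ} (h : x ≤ y) :
    code (subsetPair x).1 ≤ code (subsetPair y).1 := by
  induction y, h using Nat.le_induction with
  | base => exact le_rfl
  | succ y _ ih =>
    rw [code_subsetPair_succ (i := y) (Nat.lt_pow_self (by norm_num))]
    omega

theorem exists_subsetPair {S A : Finset ℕ} (hS : S ⊆ Finset.range i) (hA : A ⊆ S) :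
    ∃ x < 3 ^ i, subsetPair x = (S, A) := by
  induction i generalizing S A with
  | zero =>
    obtain rfl : S = ∅ := by simpa using hS
    obtain rfl : A = ∅ := by simpa using hA
    exact ⟨0, by norm_num, subsetPair_zero⟩
  | succ i ih =>
    have hpow : 3 ^ (i + 1) = 3 * 3 ^ i := by rw [pow_succ]; ring
    by_cases hi : i ∈ S
    · have hS' : S.erase i ⊆ Finset.range i := by
        intro j hj
        have := Finset.mem_range.1 (hS (Finset.mem_of_mem_erase hj))
        have := Finset.ne_of_mem_erase hj
        exact Finset.mem_range.2 (by omega)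
      obtain ⟨a, ha, heq⟩ := ih hS' (Finset.erase_subset_erase i hA)
      by_cases hiA : i ∈ A
      · refine ⟨3 ^ i + 2 * a, by omega, ?_⟩
        rw [subsetPair_even ha, heq, Finset.insert_erase hi, Finset.insert_erase hiA]
      · refine ⟨3 ^ i + 2 * a + 1, by omega, ?_⟩
        rw [subsetPair_odd ha, heq, Finset.insert_erase hi, Finset.erase_eq_of_notMem hiA]
    · have hS' : S ⊆ Finset.range i := by
        intro j hj
        have := Finset.mem_range.1 (hS hj)
        have : j ≠ i := by rintro rfl; exact hi hj
        exact Finset.mem_range.2 (by omega)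
      obtain ⟨x, hx, heq⟩ := ih hS' hA
      exact ⟨x, by omega, heq⟩

/-- When the empty subset of a set is reached, all others have been listed. -/
theorem exists_lt_subsetPair {a : ℕ} (ha : (subsetPair a).2 = ∅) {A : Finset ℕ}
    (hA : A ⊆ (subsetPair a).1) (hne : A.Nonempty) :
    ∃ x < a, subsetPair x = ((subsetPair a).1, A) := by
  have hlt : a < 3 ^ a := Nat.lt_pow_self (by norm_num)
  obtain ⟨x, -, heq⟩ := exists_subsetPair (subsetPair_subset hlt).1 hA
  refine ⟨x, ?_, heq⟩
  by_contra hx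
  rcases (not_lt.1 hx).eq_or_lt with rfl | hx
  · rw [heq] at ha
    exact hne.ne_empty ha
  · have h1 := code_subsetPair_mono (Nat.succ_le_of_lt hx)
    rw [Nat.succ_eq_add_one, code_subsetPair_succ hlt, if_pos ha, heq] at h1
    simp at h1

end

/-! ### Reasoning about programs -/

/-- With word length `w`, the program `p`, started in `σ`, terminates within `T` steps in a state
that satisfies `Q`. -/
def Terminates (w : ℕ) (p : Prog) (T : ℕ) (σ : State) (Q : State → Prop) : Prop :=
  ∃ t τ, Exec w p σ t τ ∧ t ≤ T ∧ τ.Fits w ∧ Q τ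

section
variable {w : ℕ} {p q : Prog} {T T₁ T₂ : ℕ} {σ : State} {Q Q' : State → Prop}

theorem Terminates.mono (h : Terminates w p T₁ σ Q) (hT : T₁ ≤ T₂) (hQ : ∀ τ, Q τ → Q' τ) :
    Terminates w p T₂ σ Q' := by
  obtain ⟨t, τ, h1, h2, h3, h4⟩ := h
  exact ⟨t, τ, h1, h2.trans hT, h3, hQ τ h4⟩

theorem Terminates.seq (hp : Terminates w p T₁ σ Q')
    (hq : ∀ τ, τ.Fits w → Q' τ → Terminates w q T₂ τ Q) :
    Terminates w (.seq p q) (T₁ + T₂) σ Q := by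
  obtain ⟨t, τ, h1, h2, h3, h4⟩ := hp
  obtain ⟨t', τ', h1', h2', h3', h4'⟩ := hq τ h3 h4
  exact ⟨t + t', τ', .seq h1 h1', add_le_add h2 h2', h3', h4'⟩

/-- A loop with a known number of iterations; `Inv k` holds after `k` of them. -/
theorem Terminates.loop {c : Test} {Inv : ℕ → State → Prop} {N : ℕ} {T : ℕ → ℕ}
    (hbody : ∀ k < N, ∀ τ, τ.Fits w → Inv k τ → c.Holds τ ∧ Terminates w p (T k) τ (Inv (k + 1)))
    (hend : ∀ τ, Inv N τ → ¬ c.Holds τ) (hfits : σ.Fits w) (h0 : Inv 0 σ) :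
    Terminates w (.loop c p) (∑ k ∈ Finset.range N, (1 + T k) + 1) σ (Inv N) := by
  suffices h : ∀ j ≤ N, ∀ τ, τ.Fits w → Inv (N - j) τ →
      Terminates w (.loop c p) (∑ k ∈ Finset.Ico (N - j) N, (1 + T k) + 1) τ (Inv N) by
    have := h N le_rfl σ hfits (by rwa [Nat.sub_self])
    rwa [Nat.sub_self, ← Finset.range_eq_Ico] at this
  intro j
  induction j with
  | zero =>
    intro _ τ hτ hI
    exact ⟨1, τ, .loop_done (hend τ hI), by omega, hτ, hI⟩
  | succ j ih =>
    intro hj τ hτ hI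
    obtain ⟨hc, t, ρ, h1, h2, h3, h4⟩ := hbody (N - (j + 1)) (by omega) τ hτ hI
    rw [show N - (j + 1) + 1 = N - j by omega] at h4
    obtain ⟨t', ρ', h1', h2', h3', h4'⟩ := ih (by omega) ρ h3 h4
    refine ⟨1 + t + t', ρ', .loop_step hc h1 h1', ?_, h3', h4'⟩
    rw [Finset.sum_eq_sum_Ico_succ_bot (by omega), show N - (j + 1) + 1 = N - j by omega]
    omega

/-- The result of the operation is less than `b`. Only additions and constants can overflow. -/
def Op.Safe (b : ℕ) (σ : State) : Op → Prop
  | .wconst _ c => c < b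
  | .wadd _ x y => σ.wreg x + σ.wreg y < b
  | _ => True

/-- A sequence of operations. -/
def Prog.block : List Op → Prog
  | [] => .skip
  | o :: os => .seq (.op o) (Prog.block os)

/-- The weakest precondition of a program without loops, for words less than `b`. -/
def Prog.wp (b : ℕ) : Prog → (State → Prop) → State → Prop
  | .skip, Q, σ => Q σ
  | .op o, Q, σ => o.Safe b σ ∧ Q (o.apply σ)
  | .seq p q, Q, σ => p.wp b (q.wp b Q) σ
  | .ite c p q, Q, σ => (c.Holds σ → p.wp b Q σ) ∧ (¬ c.Holds σ → q.wp b Q σ)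
  | .loop _ _, _, _ => False

/-- A bound on the number of steps of a program without loops (a loop is given the value 0, for
which `Prog.wp` makes up by being false). -/
def Prog.cost : Prog → ℕ
  | .skip => 1
  | .op _ => 1
  | .seq p q => p.cost + q.cost
  | .ite _ p q => 1 + max p.cost q.cost
  | .loop _ _ => 0

theorem fits_update {f : ℕ → ℕ} {b d v : ℕ} (hf : ∀ i, f i < b) (hv : v < b) (i : ℕ) :
    Function.update f d v i < b := by
  rw [Function.update_apply]
  split_ifs
  exacts [hv, hf i]

theorem Op.fits_apply {o : Op} (h : o.Safe (2 ^ w) σ) (hσ : σ.Fits w) : (o.apply σ).Fits w := by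
  obtain ⟨h1, h2⟩ := hσ
  cases o <;> refine ⟨?_, ?_⟩ <;> first | exact h1 | exact h2 | skip
  · exact fits_update h1 h
  · exact fits_update h1 h
  · exact fits_update h1 ((Nat.sub_le _ _).trans_lt (h1 _))
  · exact fits_update h1 (h2 _)
  · exact fits_update h2 (h1 _)

theorem Prog.wp_sound (h : p.wp (2 ^ w) Q σ) (hσ : σ.Fits w) : Terminates w p p.cost σ Q := by
  induction p generalizing σ Q with
  | skip => exact ⟨1, σ, .skip σ, le_rfl, hσ, h⟩
  | op o =>
    have hf := o.fits_apply h.1 hσ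
    exact ⟨1, _, .op o σ hf, le_rfl, hf, h.2⟩
  | seq p q ihp ihq => exact (ihp h hσ).seq fun τ hτ hq => ihq hq hτ
  | ite c p q ihp ihq =>
    by_cases hc : c.Holds σ
    · obtain ⟨t, τ, h1, h2, h3⟩ := ihp (h.1 hc) hσ
      exact ⟨1 + t, τ, .ite_true hc h1, add_le_add_right (h2.trans (le_max_left _ _)) 1, h3⟩
    · obtain ⟨t, τ, h1, h2, h3⟩ := ihq (h.2 hc) hσ
      exact ⟨1 + t, τ, .ite_false hc h1, add_le_add_right (h2.trans (le_max_right _ _)) 1, h3⟩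
  | loop c p => exact h.elim

theorem Prog.wp_terminates {T : ℕ} (hT : p.cost ≤ T) (hσ : σ.Fits w) (h : p.wp (2 ^ w) Q σ) :
    Terminates w p T σ Q := (p.wp_sound h hσ).mono hT fun _ => id

theorem Prog.wp_mono {b : ℕ} (h : p.wp b Q σ) (hQ : ∀ τ, Q τ → Q' τ) : p.wp b Q' σ := by
  induction p generalizing σ Q Q' with
  | skip => exact hQ σ h
  | op o => exact ⟨h.1, hQ _ h.2⟩
  | seq p q ihp ihq => exact ihp h fun τ hτ => ihq hτ hQ
  | ite c p q ihp ihq => exact ⟨fun hc => ihp (h.1 hc) hQ, fun hc => ihq (h.2 hc) hQ⟩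
  | loop c p => exact h

theorem Prog.wp_seq {b : ℕ} (hp : p.wp b Q' σ) (hq : ∀ τ, Q' τ → q.wp b Q τ) :
    (Prog.seq p q).wp b Q σ := by
  rw [Prog.wp]
  exact Prog.wp_mono hp hq

end

/-! ### The program: initialization and the table of the best roots

Layout of the memories, with `D = 2 * n + 2 * m` and `E = D + 2 * n * n`. The real memory holds the
input below `D`, from `D` on the coordinates of the best root for the abscissa of the point `i` and
the ordinate of the point `j`, at `D + 2 * (n * i + j)`, and for the set with code `c`, at
`E + 8 * c + k`, the cost of an optimal tree (`k = 0`), that of an optimal forest (`k = 1`) and the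
coordinates of the corner (`k = 2, 3`).

The word memory consists of records of 8 words. The first word of the record `x` holds the second
component of the entry `x` of the list of pairs; in the record `c` the following four belong to the
set with code `c`: where its corner gets its abscissa and its ordinate from, and how an optimal tree
and an optimal forest branch. The words 5 and 6 mark the sets for which a forest, or a tree, remains
to be drawn during the output. Codes of sets are always stored multiplied by 8. -/

/-- Sequential composition. -/
infixr:60 " ;; " => Prog.seq

/-- Word register `10 + c` holds the constant `c`, register 2 the number `2 * n`, and register 3
the address `2 * n + 2 * m` of the table of the best roots. -/
def initProg : Prog := .block [.wconst 11 1, .wconst 12 2, .wconst 13 3, .wconst 14 4,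
  .wconst 15 5, .wconst 16 6, .wconst 18 8, .wadd 2 0 0, .wadd 3 1 1, .wadd 3 2 3, .wadd 20 3 10]

/-- Compares the root at the address in register 23 with the best one so far. -/
def rootStep : Prog :=
  .block [.rload 3 23, .wadd 24 23 11, .rload 4 24, .radd 8 3 4, .wadd 23 23 12] ;;
  .ite (.rlt 1 3) .skip (.ite (.rlt 2 4) .skip (.ite (.rlt 7 8)
    (.block [.radd 5 3 0, .radd 6 4 0, .radd 7 8 0]) .skip))

/-- Reads the ordinate and starts with the origin as the best root. -/
def columnPre : Prog :=
  .block [.rload 2 22, .radd 5 0 0, .radd 6 0 0, .radd 7 0 0, .wadd 23 2 10]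

/-- Enters the best root into the table. -/
def columnPost : Prog :=
  .block [.rstore 20 5, .wadd 20 20 11, .rstore 20 6, .wadd 20 20 11, .wadd 22 22 12]

/-- Finds the best root for the abscissa in real register 1 and the ordinate of the point to which
register 22 points. -/
def columnStep : Prog := columnPre ;; .loop (.wlt 23 3) rootStep ;; columnPost

/-- Reads the abscissa. -/
def rowPre : Prog := .block [.rload 1 21, .wadd 22 11 10]

/-- Passes to the next abscissa. -/
def rowPost : Prog := .block [.wadd 21 21 12]

/-- Finds the best roots for one abscissa and all ordinates. -/
def rowStep : Prog := rowPre ;; .loop (.wlt 22 2) columnStep ;; rowPost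

/-- Writes the table of the best roots for all pairs of an abscissa and an ordinate. -/
def rootTableProg : Prog := .loop (.wlt 21 2) rowStep

/-! ### Correctness of the table of the best roots -/

/-- The registers that keep their values throughout the program. -/
structure Consts (n m : ℕ) (f : ℕ → ℕ) : Prop where
  r2 : f 2 = 2 * n
  r3 : f 3 = 2 * n + 2 * m
  r10 : f 10 = 0
  r11 : f 11 = 1
  r12 : f 12 = 2
  r13 : f 13 = 3
  r14 : f 14 = 4
  r15 : f 15 = 5
  r16 : f 16 = 6
  r18 : f 18 = 8

@[simp] theorem consts_update {n m : ℕ} {f : ℕ → ℕ} {d v : ℕ} (hd : 19 ≤ d) :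
    Consts n m (Function.update f d v) ↔ Consts n m f := by
  constructor <;> rintro ⟨h1, h2, h3, h4, h5, h6, h7, h8, h9, h10⟩
  · rw [Function.update_of_ne (by omega)] at h1 h2 h3 h4 h5 h6 h7 h8 h9 h10
    exact ⟨h1, h2, h3, h4, h5, h6, h7, h8, h9, h10⟩
  · constructor <;> rw [Function.update_of_ne (by omega)] <;> assumption

-- With these rules `simp` executes a program without loops symbolically.
attribute [simp] Prog.wp Prog.block Op.Safe Op.apply Test.Holds

/-- The entry number `k` of a list of points. -/
def nth (l : List Pt) (k : ℕ) : Pt := l.getD k (0, 0)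

theorem bestRoot_take_succ {l : List Pt} {k : ℕ} (hk : k < l.length) (z : Pt) :
    bestRoot (l.take (k + 1)) z = open Classical in
      if Covers (nth l k) z ∧ hgt (bestRoot (l.take k) z) < hgt (nth l k)
      then nth l k else bestRoot (l.take k) z := by
  rw [bestRoot, List.take_succ_eq_append_getElem hk, List.foldl_append, nth,
    List.getD_eq_getElem _ _ hk]
  rfl

/-- The first `k` roots have been compared for the corner `z`; `σ₀` is the state before the scan. -/
structure ScanInv (pt : ℕ → Pt) (l : List Pt) (n m : ℕ) (σ₀ : State) (z : Pt) (k : ℕ) (σ : State) :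
    Prop where
  consts : Consts n m σ.wreg
  r20 : σ.wreg 20 = σ₀.wreg 20
  r21 : σ.wreg 21 = σ₀.wreg 21
  r22 : σ.wreg 22 = σ₀.wreg 22
  r23 : σ.wreg 23 = 2 * n + 2 * k
  q0 : σ.rreg 0 = 0
  q1 : σ.rreg 1 = z.1
  q2 : σ.rreg 2 = z.2
  q5 : σ.rreg 5 = (bestRoot (l.take k) z).1
  q6 : σ.rreg 6 = (bestRoot (l.take k) z).2
  q7 : σ.rreg 7 = hgt (bestRoot (l.take k) z)
  rmem : σ.rmem = σ₀.rmem
  wmem : σ.wmem = σ₀.wmem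
  out : σ.out = σ₀.out

/-- The coordinates of the input in the real memory. -/
structure InputMem (pt : ℕ → Pt) (l : List Pt) (n : ℕ) (f : ℕ → ℝ) : Prop where
  pt_fst : ∀ i < n, f (2 * i) = (pt i).1
  pt_snd : ∀ i < n, f (2 * i + 1) = (pt i).2
  root_fst : ∀ k < l.length, f (2 * n + 2 * k) = (nth l k).1
  root_snd : ∀ k < l.length, f (2 * n + 2 * k + 1) = (nth l k).2

section
variable {pt : ℕ → Pt} {l : List Pt} {n : ℕ} {b : ℕ}

theorem rootStep_wp {σ₀ : State} {z : Pt} {k : ℕ} (hk : k < l.length)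
    (hb : 2 * n + 2 * l.length + 8 ≤ b) (hmem : InputMem pt l n σ₀.rmem) {σ : State}
    (h : ScanInv pt l n l.length σ₀ z k σ) :
    rootStep.wp b (ScanInv pt l n l.length σ₀ z (k + 1)) σ := by
  have h1 := hmem.root_fst k hk
  have h2 := hmem.root_snd k hk
  obtain ⟨hc, h20, h21, h22, h23, q0, q1, q2, q5, q6, q7, hr, hw, ho⟩ := h
  rw [← hr] at h1 h2
  simp [rootStep, h23, q0, q1, q2, q7, hc.r11, hc.r12, h1, h2]
  have h3 := bestRoot_take_succ hk z
  refine ⟨by omega, by omega, fun hx => ?_, fun hx => ⟨fun hy => ?_, fun hy => ⟨fun hs => ?_,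
    fun hs => ?_⟩⟩⟩
  · rw [if_neg fun h => absurd hx (not_lt.2 h.1.1)] at h3
    constructor <;> simp [*, mul_add, add_assoc]
  · rw [if_neg fun h => absurd hy (not_lt.2 h.1.2)] at h3
    constructor <;> simp [*, mul_add, add_assoc]
  · rw [if_pos ⟨⟨hx, hy⟩, hs⟩] at h3
    constructor <;> simp [*, mul_add, add_assoc, hgt]
  · rw [if_neg fun h => absurd h.2 (not_lt.2 hs)] at h3
    constructor <;> simp [*, mul_add, add_assoc]

/-- The table holds the best roots for the corners `((pt i).1, (pt j).2)` with `n * i + j < c`. -/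
def RootTable (pt : ℕ → Pt) (l : List Pt) (n c : ℕ) (f : ℕ → ℝ) : Prop :=
  ∀ i < n, ∀ j < n, n * i + j < c →
    f (2 * n + 2 * l.length + 2 * (n * i + j)) = (bestRoot l ((pt i).1, (pt j).2)).1 ∧
    f (2 * n + 2 * l.length + 2 * (n * i + j) + 1) = (bestRoot l ((pt i).1, (pt j).2)).2

/-- The table is filled in before the entry for the abscissa `i` and the ordinate `j`. -/
structure ColumnInv (pt : ℕ → Pt) (l : List Pt) (n i j : ℕ) (σ : State) : Prop where
  consts : Consts n l.length σ.wreg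
  r20 : σ.wreg 20 = 2 * n + 2 * l.length + 2 * (n * i + j)
  r21 : σ.wreg 21 = 2 * i
  r22 : σ.wreg 22 = 2 * j + 1
  q0 : σ.rreg 0 = 0
  q1 : σ.rreg 1 = (pt i).1
  inp : InputMem pt l n σ.rmem
  table : RootTable pt l n (n * i + j) σ.rmem
  wmem : ∀ x, σ.wmem x = 0
  out : σ.out = []

/-- The table is filled in for the abscissas of the first `i` points. -/
structure RowInv (pt : ℕ → Pt) (l : List Pt) (n i : ℕ) (σ : State) : Prop where
  consts : Consts n l.length σ.wreg
  r20 : σ.wreg 20 = 2 * n + 2 * l.length + 2 * (n * i)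
  r21 : σ.wreg 21 = 2 * i
  q0 : σ.rreg 0 = 0
  inp : InputMem pt l n σ.rmem
  table : RootTable pt l n (n * i) σ.rmem
  wmem : ∀ x, σ.wmem x = 0
  out : σ.out = []

theorem columnPre_wp {i j : ℕ} (hj : j < n) (hb : 2 * n + 2 * l.length + 8 ≤ b) {σ : State}
    (h : ColumnInv pt l n i j σ) :
    columnPre.wp b (ScanInv pt l n l.length σ ((pt i).1, (pt j).2) 0) σ := by
  have h1 := h.inp.pt_snd j hj
  obtain ⟨hc, h20, h21, h22, q0, q1, hi, ht, hw, ho⟩ := h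
  simp [columnPre, *, hc.r2, hc.r10, hc.r11, hc.r12]
  refine ⟨by omega, ?_⟩
  constructor <;> simp [*, hgt, bestRoot, hc.r10, hc.r2]

theorem update_eq {α : Type*} {f : ℕ → α} {x y : ℕ} {v : α} (h : x = y) :
    Function.update f x v y = v := by
  rw [h, Function.update_self]

theorem InputMem.update {f : ℕ → ℝ} (h : InputMem pt l n f) {x : ℕ} {v : ℝ}
    (hx : 2 * n + 2 * l.length ≤ x) : InputMem pt l n (Function.update f x v) := by
  obtain ⟨h1, h2, h3, h4⟩ := h
  constructor <;> intro i hi <;> rw [Function.update_of_ne (by omega)] <;> apply_assumption <;>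
    assumption

theorem columnPost_wp {i j : ℕ} (hi : i < n) (hj : j < n)
    (hb : 2 * n + 2 * l.length + 2 * (n * n) + 8 ≤ b) {σ₀ : State}
    (h₀ : ColumnInv pt l n i j σ₀) {σ : State}
    (h : ScanInv pt l n l.length σ₀ ((pt i).1, (pt j).2) l.length σ) :
    columnPost.wp b (ColumnInv pt l n i (j + 1)) σ := by
  have hlt : n * i + j < n * n := by nlinarith
  obtain ⟨hc', h20', h21', h22', q0', q1', hi', ht', hw', ho'⟩ := h₀
  obtain ⟨hc, h20, h21, h22, h23, q0, q1, q2, q5, q6, q7, hr, hw, ho⟩ := h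
  rw [List.take_length] at q5 q6
  simp [columnPost, *, hc.r11, hc.r12]
  refine ⟨by omega, by omega, by omega, ?_⟩
  constructor <;> simp [*, mul_add, add_assoc]
  · exact (hi'.update (by omega)).update (by omega)
  · intro i' hi'' j' hj'' hlt'
    rcases Nat.lt_or_ge (n * i' + j') (n * i + j) with h | h
    · have := ht' i' hi'' j' hj'' h
      rw [← this.1, ← this.2]
      constructor <;> (rw [Function.update_of_ne (by omega), Function.update_of_ne (by omega)])
    · have h1 : n * i' + j' = n * i + j := by omega
      obtain ⟨rfl, rfl⟩ : i' = i ∧ j' = j := by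
        have e1 := congrArg (· / n) h1
        have e2 := congrArg (· % n) h1
        simpa [Nat.mul_add_div (show 0 < n by omega), Nat.div_eq_of_lt, hj, hj'',
          Nat.mul_add_mod, Nat.mod_eq_of_lt] using And.intro e1 e2
      constructor
      · rw [Function.update_of_ne (by omega), update_eq (by omega)]
      · rw [update_eq (by omega)]

theorem columnStep_terminates {w i j : ℕ} (hi : i < n) (hj : j < n)
    (hb : 2 * n + 2 * l.length + 2 * (n * n) + 8 ≤ 2 ^ w) {σ : State} (hσ : σ.Fits w)
    (h : ColumnInv pt l n i j σ) :
    Terminates w columnStep (20 * l.length + 20) σ (ColumnInv pt l n i (j + 1)) := by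
  have h1 := (Prog.wp_sound (columnPre_wp hj (by omega) h) hσ).seq
    (q := .loop (.wlt 23 3) rootStep ;; columnPost) (T₂ := 20 * l.length + 14)
    (Q := ColumnInv pt l n i (j + 1)) ?_
  · exact h1.mono (by simp [columnPre, Prog.cost]; omega) fun _ => id
  intro τ hτ hI
  have h2 := (Terminates.loop (c := .wlt 23 3) (p := rootStep) (N := l.length) (T := fun _ => 13)
    (Inv := ScanInv pt l n l.length σ ((pt i).1, (pt j).2))
    (fun k hk ρ hρ hI => ⟨?_, Prog.wp_terminates (by simp [rootStep, Prog.cost]) hρ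
      (rootStep_wp hk (by omega) h.inp hI)⟩)
    (fun ρ hI => ?_) hτ hI).seq (q := columnPost) (T₂ := 6) fun ρ hρ hI =>
      Prog.wp_terminates (by simp [columnPost, Prog.cost]) hρ (columnPost_wp hi hj hb h hI)
  · exact h2.mono (by simp; omega) fun _ => id
  · simp [hI.r23, hI.consts.r3]; omega
  · simp [hI.r23, hI.consts.r3]

theorem rowPre_wp {i : ℕ} (hi : i < n) (hb : 2 * n + 2 * l.length + 8 ≤ b) {σ : State}
    (h : RowInv pt l n i σ) : rowPre.wp b (ColumnInv pt l n i 0) σ := by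
  have h1 := h.inp.pt_fst i hi
  obtain ⟨hc, h20, h21, q0, hi, ht, hw, ho⟩ := h
  simp [rowPre, *, hc.r11, hc.r10]
  refine ⟨by omega, ?_⟩
  constructor <;> simp [*]

theorem rowPost_wp {i : ℕ} (hi : i < n) (hb : 2 * n + 2 * l.length + 8 ≤ b) {σ : State}
    (h : ColumnInv pt l n i n σ) : rowPost.wp b (RowInv pt l n (i + 1)) σ := by
  obtain ⟨hc, h20, h21, h22, q0, q1, hi, ht, hw, ho⟩ := h
  have e : n * (i + 1) = n * i + n := by ring
  simp [rowPost, *, hc.r12]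
  refine ⟨by omega, ?_⟩
  constructor <;> simp [*, mul_add]

theorem rowStep_terminates {w i : ℕ} (hi : i < n)
    (hb : 2 * n + 2 * l.length + 2 * (n * n) + 8 ≤ 2 ^ w) {σ : State} (hσ : σ.Fits w)
    (h : RowInv pt l n i σ) :
    Terminates w rowStep (n * (20 * l.length + 21) + 10) σ (RowInv pt l n (i + 1)) := by
  have h1 := (Prog.wp_sound (rowPre_wp hi (by omega) h) hσ).seq
    (q := .loop (.wlt 22 2) columnStep ;; rowPost) (T₂ := n * (20 * l.length + 21) + 6)
    (Q := RowInv pt l n (i + 1)) ?_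
  · exact h1.mono (by simp [rowPre, Prog.cost]; omega) fun _ => id
  intro τ hτ hI
  have h2 := (Terminates.loop (c := .wlt 22 2) (p := columnStep) (N := n)
    (T := fun _ => 20 * l.length + 20) (Inv := ColumnInv pt l n i)
    (fun k hk ρ hρ hI => ⟨?_, columnStep_terminates hi hk hb hρ hI⟩)
    (fun ρ hI => ?_) hτ hI).seq (q := rowPost) (T₂ := 2) (Q := RowInv pt l n (i + 1))
      fun ρ hρ hI => Prog.wp_terminates (by simp [rowPost, Prog.cost]) hρ
        (rowPost_wp hi (by omega) hI)
  · exact h2.mono (by simp [Finset.sum_const]; ring_nf; omega) fun _ => id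
  · simp [hI.r22, hI.consts.r2]; omega
  · simp [hI.r22, hI.consts.r2]

theorem rootTable_terminates {w : ℕ}
    (hb : 2 * n + 2 * l.length + 2 * (n * n) + 8 ≤ 2 ^ w) {σ : State} (hσ : σ.Fits w)
    (h : RowInv pt l n 0 σ) :
    Terminates w rootTableProg (n * (n * (20 * l.length + 21) + 11) + 1) σ (RowInv pt l n n) := by
  have h1 := Terminates.loop (c := .wlt 21 2) (p := rowStep) (N := n)
    (T := fun _ => n * (20 * l.length + 21) + 10) (Inv := RowInv pt l n)
    (fun k hk ρ hρ hI => ⟨?_, rowStep_terminates hk hb hρ hI⟩) (fun ρ hI => ?_) hσ h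
  · exact h1.mono (by simp; ring_nf; omega) fun _ => id
  · simp [hI.r21, hI.consts.r2]; omega
  · simp [hI.r21, hI.consts.r2]

end

/-! ### The program: the tables of costs -/

/-- Word registers 4 to 7 hold the addresses of the four tables of reals that are indexed by sets.
At first only the pair of the empty set and its empty subset has been listed. -/
def basesProg : Prog := .block [.wadd 4 20 10, .wadd 5 4 11, .wadd 6 4 12, .wadd 7 4 13,
  .wconst 21 0, .wconst 25 0, .wadd 26 18 10, .wadd 28 18 10, .wconst 33 0, .wconst 34 0]

/-- Reads the next subset `A` and lists the two subsets that arise from it. -/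
def pairPre : Prog := .block [.wload 31 30, .wadd 24 31 27, .wstore 28 24, .wadd 28 28 18,
  .wstore 28 31, .wadd 28 28 18, .wadd 30 30 18]

/-- Records the current partition as the best one for trees. -/
def takeTree : Prog := .block [.radd 5 3 0, .wadd 33 31 10]

/-- Records the current partition as the best one for forests. -/
def takeForest : Prog := .block [.radd 6 12 0, .wadd 34 31 10]

/-- Computes the values of the current partition, for trees and for forests. -/
def candidatePre : Prog := .block [.wsub 32 26 31,
  .wadd 24 4 31, .rload 3 24, .wadd 24 4 32, .rload 4 24, .radd 3 3 4,
  .wadd 24 5 31, .rload 12 24, .wadd 24 5 32, .rload 13 24, .radd 12 12 13]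

/-- Compares the partition of the current set into `A` and the rest with the best ones so far. -/
def candidateStep : Prog := candidatePre ;;
  .ite (.wlt 10 33)
    (.ite (.rlt 3 5) takeTree .skip ;; .ite (.rlt 12 6) takeForest .skip)
    (takeTree ;; takeForest)

/-- Computes the corner of the current set. -/
def cornerProg : Prog :=
  .block [.wsub 32 26 27, .radd 7 1 0, .radd 8 2 0, .wadd 35 25 10, .wadd 36 21 10] ;;
  .ite (.wlt 10 32)
    (.block [.wadd 24 6 32, .rload 3 24] ;;
      .ite (.rlt 3 7) (.block [.radd 7 3 0, .wadd 24 32 11, .wload 35 24]) .skip ;;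
      .block [.wadd 24 7 32, .rload 3 24] ;;
      .ite (.rlt 3 8) (.block [.radd 8 3 0, .wadd 24 32 12, .wload 36 24]) .skip)
    .skip

/-- Computes the costs of the current set from those of its partitions. -/
def costProg : Prog :=
  .block [.radd 9 7 8, .wadd 24 3 35, .wadd 24 24 36, .rload 10 24, .wadd 24 24 11,
    .rload 11 24] ;;
  .ite (.wlt 10 33) (.block [.rsub 12 5 9]) (.block [.radd 12 9 0]) ;;
  .block [.rsub 13 12 10, .rsub 13 13 11] ;;
  .ite (.wlt 10 34) (.ite (.rlt 13 6) (.block [.wadd 34 10 10]) (.block [.radd 13 6 0])) .skip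

/-- Enters the current set into the tables and passes to the next one. -/
def enterProg : Prog :=
  .block [.wadd 24 4 26, .rstore 24 12, .wadd 24 5 26, .rstore 24 13, .wadd 24 6 26, .rstore 24 7,
    .wadd 24 7 26, .rstore 24 8, .wadd 24 26 11, .wstore 24 35, .wadd 24 26 12, .wstore 24 36,
    .wadd 24 26 13, .wstore 24 33, .wadd 24 26 14, .wstore 24 34, .wconst 33 0, .wconst 34 0,
    .wadd 26 26 18]

/-- Processes one entry of the list of pairs: a candidate for a partition of the current set, or, at
the empty subset, which comes last, the completion of this set. -/
def pairStep : Prog :=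
  pairPre ;; .ite (.wlt 10 31) candidateStep (cornerProg ;; costProg ;; enterProg)

/-- Reads the new point; the list read so far will be traversed up to its present end. -/
def stagePre : Prog := .block [.wadd 27 26 10, .wadd 29 28 10, .wconst 30 0, .rload 1 21,
  .wadd 24 21 11, .rload 2 24]

/-- Passes to the next point. -/
def stagePost : Prog := .block [.wadd 21 21 12, .wadd 25 25 2]

/-- Enters all sets of which the point to which register 21 points is the last element. -/
def stageStep : Prog := stagePre ;; .loop (.wlt 30 29) pairStep ;; stagePost

/-- Fills in the tables for all sets of points. -/
def tableProg : Prog := .loop (.wlt 21 2) stageStep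

/-! ### The best partition so far -/

/-- The subset `A` of the current set has been listed before. -/
def Seen (a : ℕ) (A : Finset ℕ) : Prop := ∃ x < a, subsetPair x = ((subsetPair a).1, A)

/-- `cur` is the scaled code of the best listed part `A` of a partition, or 0 if there is none, and
`best` the value of the partition. -/
def BestSplit (V : Finset ℕ → ℝ) (i a cur : ℕ) (best : ℝ) : Prop :=
  (cur = 0 ∧ ∀ A, ¬ Seen a A) ∨ ∃ A, Seen a A ∧ A.Nonempty ∧ cur = 8 * code A ∧
    best = V A + V (insert i (subsetPair a).1 \ A) ∧
    ∀ B, Seen a B → best ≤ V B + V (insert i (subsetPair a).1 \ B)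

section
variable {V : Finset ℕ → ℝ} {i a cur : ℕ} {best : ℝ}

theorem subsetPair_succ (h : (subsetPair a).2.Nonempty) :
    (subsetPair (a + 1)).1 = (subsetPair a).1 := by
  refine code_injective ?_
  rw [code_subsetPair_succ (i := a) (Nat.lt_pow_self (by norm_num)), if_neg h.ne_empty, add_zero]

theorem seen_succ (h : (subsetPair a).2.Nonempty) {A : Finset ℕ} :
    Seen (a + 1) A ↔ Seen a A ∨ A = (subsetPair a).2 := by
  simp only [Seen, subsetPair_succ h]
  constructor
  · rintro ⟨x, hx, heq⟩
    rcases Nat.lt_succ_iff_lt_or_eq.1 hx with hx | rfl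
    · exact .inl ⟨x, hx, heq⟩
    · exact .inr (by rw [heq])
  · rintro (⟨x, hx, heq⟩ | rfl)
    · exact ⟨x, hx.trans (Nat.lt_succ_self a), heq⟩
    · exact ⟨a, Nat.lt_succ_self a, rfl⟩

theorem BestSplit.first (h : BestSplit V i a 0 best) (hne : (subsetPair a).2.Nonempty) :
    BestSplit V i (a + 1) (8 * code (subsetPair a).2)
      (V (subsetPair a).2 + V (insert i (subsetPair a).1 \ (subsetPair a).2)) := by
  rcases h with ⟨-, h⟩ | ⟨A, -, hA, h0, -⟩
  · refine .inr ⟨_, (seen_succ hne).2 (.inr rfl), hne, rfl, by rw [subsetPair_succ hne], ?_⟩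
    intro B hB
    rcases (seen_succ hne).1 hB with hB | rfl
    · exact absurd hB (h B)
    · rw [subsetPair_succ hne]
  · have := code_pos hA
    omega

theorem BestSplit.keep (h : BestSplit V i a cur best) (hne : (subsetPair a).2.Nonempty)
    (hcur : cur ≠ 0)
    (hle : best ≤ V (subsetPair a).2 + V (insert i (subsetPair a).1 \ (subsetPair a).2)) :
    BestSplit V i (a + 1) cur best := by
  rcases h with ⟨h, -⟩ | ⟨A, hs, hA, h0, h1, h2⟩
  · exact absurd h hcur
  · refine .inr ⟨A, (seen_succ hne).2 (.inl hs), hA, h0, by rw [subsetPair_succ hne, h1], ?_⟩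
    intro B hB
    rw [subsetPair_succ hne]
    rcases (seen_succ hne).1 hB with hB | rfl
    exacts [h2 B hB, hle]

theorem BestSplit.take (h : BestSplit V i a cur best) (hne : (subsetPair a).2.Nonempty)
    (hcur : cur ≠ 0)
    (hlt : V (subsetPair a).2 + V (insert i (subsetPair a).1 \ (subsetPair a).2) < best) :
    BestSplit V i (a + 1) (8 * code (subsetPair a).2)
      (V (subsetPair a).2 + V (insert i (subsetPair a).1 \ (subsetPair a).2)) := by
  rcases h with ⟨h, -⟩ | ⟨A, hs, hA, h0, h1, h2⟩
  · exact absurd h hcur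
  · refine .inr ⟨_, (seen_succ hne).2 (.inr rfl), hne, rfl, by rw [subsetPair_succ hne], ?_⟩
    intro B hB
    rw [subsetPair_succ hne]
    rcases (seen_succ hne).1 hB with hB | rfl
    exacts [hlt.le.trans (h2 B hB), le_rfl]

theorem BestSplit.eq_zero_iff (h : BestSplit V i a cur best) : cur = 0 ↔ ∀ A, ¬ Seen a A := by
  rcases h with h | ⟨A, hs, hA, h0, -⟩
  · exact iff_of_true h.1 h.2
  · have := code_pos hA
    exact iff_of_false (by omega) fun h => h A hs

theorem BestSplit.reset (h : a = 0 ∨ ∃ c, a = c + 1 ∧ (subsetPair c).2 = ∅) (best : ℝ) :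
    BestSplit V i a 0 best := by
  refine .inl ⟨rfl, ?_⟩
  rintro A ⟨x, hx, heq⟩
  rcases h with rfl | ⟨c, rfl, hc⟩
  · omega
  · have h1 := code_subsetPair_mono (Nat.lt_succ_iff.1 hx)
    have h2 := code_subsetPair_succ (i := c) (Nat.lt_pow_self (by norm_num))
    rw [if_pos hc] at h2
    rw [heq] at h1
    simp only at h1
    omega

/-- When all partitions of the current set have been seen, the best one is optimal. -/
theorem BestSplit.final (h : BestSplit V i a cur best) (ha : a < 3 ^ i)
    (he : (subsetPair a).2 = ∅) (hJ : (subsetPair a).1.Nonempty) :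
    cur ≠ 0 ∧ splitInf V (insert i (subsetPair a).1) = best ∧
      ∃ A, A ⊂ insert i (subsetPair a).1 ∧ A.Nonempty ∧ cur = 8 * code A ∧
        best = V A + V (insert i (subsetPair a).1 \ A) := by
  have hi := notMem_subsetPair ha
  have hseen : ∀ A ⊆ (subsetPair a).1, A.Nonempty → Seen a A := fun A hA hne =>
    exists_lt_subsetPair he hA hne
  have hsub : ∀ A, Seen a A → A ⊆ (subsetPair a).1 := by
    rintro A ⟨x, hx, heq⟩
    have := (subsetPair_subset (hx.trans ha)).2
    rwa [heq] at this
  rcases h with ⟨-, h⟩ | ⟨A, hs, hA, h0, h1, h2⟩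
  · exact absurd (hseen _ subset_rfl hJ) (h _)
  · have := code_pos hA
    exact ⟨by omega, splitInf_insert hi ⟨A, hsub A hs, hA, h1⟩
      fun B hB hne => h2 B (hseen B hB hne), A, insert_sdiff_ssubset hi (hsub A hs), hA, h0, h1⟩

theorem BestSplit.final_empty (h : BestSplit V i a cur best) (ha : a < 3 ^ i)
    (hJ : (subsetPair a).1 = ∅) : cur = 0 := by
  rcases h with h | ⟨A, ⟨x, hx, heq⟩, hA, -⟩
  · exact h.1
  · have := (subsetPair_subset (hx.trans ha)).2
    rw [heq, hJ] at this
    exact absurd (Finset.subset_empty.1 this) hA.ne_empty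

end

/-! ### Correctness of the tables of costs -/

/-- Word registers 4 to 7 hold the addresses of the tables of reals that are indexed by sets. -/
structure Bases (E : ℕ) (f : ℕ → ℕ) : Prop where
  r4 : f 4 = E
  r5 : f 5 = E + 1
  r6 : f 6 = E + 2
  r7 : f 7 = E + 3

@[simp] theorem bases_update {E : ℕ} {f : ℕ → ℕ} {d v : ℕ} (hd : 19 ≤ d) :
    Bases E (Function.update f d v) ↔ Bases E f := by
  constructor <;> rintro ⟨h1, h2, h3, h4⟩
  · rw [Function.update_of_ne (by omega)] at h1 h2 h3 h4
    exact ⟨h1, h2, h3, h4⟩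
  · constructor <;> rw [Function.update_of_ne (by omega)] <;> assumption

/-- The number `c` tells how an optimal tree for `T` branches at its corner. -/
def TreeChoice (pt : ℕ → Pt) (T : Finset ℕ) (c : ℕ) : Prop :=
  (c = 0 ∧ ∃ i, T = {i}) ∨ ∃ A, A ⊂ T ∧ A.Nonempty ∧ c = 8 * code A ∧
    treeCost pt T = treeCost pt A + treeCost pt (T \ A) - hgt (corner pt T)

/-- The number `c` tells whether an optimal forest for `T` is a single tree, or how it is composed
of two forests. -/
def ForestChoice (pt : ℕ → Pt) (l : List Pt) (T : Finset ℕ) (c : ℕ) : Prop :=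
  (c = 0 ∧ forestCost pt l T = treeCost pt T - hgt (bestRoot l (corner pt T))) ∨
    ∃ A, A ⊂ T ∧ A.Nonempty ∧ c = 8 * code A ∧
      forestCost pt l T = forestCost pt l A + forestCost pt l (T \ A)

/-- The tables hold the right values for the set `T`. -/
structure TableAt (pt : ℕ → Pt) (l : List Pt) (n E : ℕ) (rm : ℕ → ℝ) (wm : ℕ → ℕ)
    (T : Finset ℕ) : Prop where
  tree : rm (E + 8 * code T) = treeCost pt T
  forest : rm (E + 1 + 8 * code T) = forestCost pt l T
  fst : rm (E + 2 + 8 * code T) = (corner pt T).1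
  snd : rm (E + 3 + 8 * code T) = (corner pt T).2
  row : ∃ i ∈ T, wm (8 * code T + 1) = 2 * (n * i) ∧ (pt i).1 = (corner pt T).1
  col : ∃ j ∈ T, wm (8 * code T + 2) = 2 * j ∧ (pt j).2 = (corner pt T).2
  treeChoice : TreeChoice pt T (wm (8 * code T + 3))
  forestChoice : ForestChoice pt l T (wm (8 * code T + 4))

theorem TableAt.congr {pt : ℕ → Pt} {l : List Pt} {n E : ℕ} {rm rm' : ℕ → ℝ} {wm wm' : ℕ → ℕ}
    {T : Finset ℕ} (h : TableAt pt l n E rm wm T)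
    (hr : ∀ k < 4, rm' (E + k + 8 * code T) = rm (E + k + 8 * code T))
    (hw : ∀ k < 4, wm' (8 * code T + (k + 1)) = wm (8 * code T + (k + 1))) :
    TableAt pt l n E rm' wm' T := by
  obtain ⟨h1, h2, h3, h4, h5, h6, h7, h8⟩ := h
  have e0 := hw 0 (by norm_num)
  have e1 := hw 1 (by norm_num)
  have e2 := hw 2 (by norm_num)
  have e3 := hw 3 (by norm_num)
  simp only [zero_add, Nat.reduceAdd] at e0 e1 e2 e3
  exact ⟨(hr 0 (by norm_num)).trans h1, (hr 1 (by norm_num)).trans h2,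
    (hr 2 (by norm_num)).trans h3, (hr 3 (by norm_num)).trans h4, by rwa [e0], by rwa [e1],
    by rwa [e2], by rwa [e3]⟩

/-- The address of the tables of reals that are indexed by sets. -/
def tableBase (l : List Pt) (n : ℕ) : ℕ := 2 * n + 2 * l.length + 2 * (n * n)

/-- The state while the sets with last element `i` are entered: the entry number `a` of the list of
subsets is being processed, and the first `c` entries have been read and copied. -/
structure PairInv (pt : ℕ → Pt) (l : List Pt) (n i a c : ℕ) (σ : State) : Prop where
  consts : Consts n l.length σ.wreg
  bases : Bases (tableBase l n) σ.wreg
  r21 : σ.wreg 21 = 2 * i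
  r25 : σ.wreg 25 = 2 * (n * i)
  r26 : σ.wreg 26 = 8 * (2 ^ i + code (subsetPair a).1)
  r27 : σ.wreg 27 = 8 * 2 ^ i
  r28 : σ.wreg 28 = 8 * (3 ^ i + 2 * c)
  r29 : σ.wreg 29 = 8 * 3 ^ i
  r30 : σ.wreg 30 = 8 * c
  q0 : σ.rreg 0 = 0
  q1 : σ.rreg 1 = (pt i).1
  q2 : σ.rreg 2 = (pt i).2
  inp : InputMem pt l n σ.rmem
  roots : RootTable pt l n (n * n) σ.rmem
  list : ∀ x < 3 ^ i + 2 * c, σ.wmem (8 * x) = 8 * code (subsetPair x).2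
  marks : ∀ x, σ.wmem (8 * x + 5) = 0 ∧ σ.wmem (8 * x + 6) = 0
  table : ∀ T : Finset ℕ, T.Nonempty → code T < 2 ^ i + code (subsetPair a).1 →
    TableAt pt l n (tableBase l n) σ.rmem σ.wmem T
  out : σ.out = []

/-- The state before the entry number `a` is processed: registers 33 and 34 hold the best parts so
far, real registers 5 and 6 the values of the partitions. -/
structure StageInv (pt : ℕ → Pt) (l : List Pt) (n i a : ℕ) (σ : State) : Prop where
  pair : PairInv pt l n i a a σ
  bestTree : BestSplit (treeCost pt) i a (σ.wreg 33) (σ.rreg 5)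
  bestForest : BestSplit (forestCost pt l) i a (σ.wreg 34) (σ.rreg 6)

/-- Words less than `b` suffice for all addresses. -/
def Bound (l : List Pt) (n b : ℕ) : Prop :=
  tableBase l n + 16 * 2 ^ n + 16 * 3 ^ n + 64 ≤ b

/-- The entry number `a` has been read into register 31. -/
structure MidInv (pt : ℕ → Pt) (l : List Pt) (n i a : ℕ) (σ : State) : Prop where
  pair : PairInv pt l n i a (a + 1) σ
  bestTree : BestSplit (treeCost pt) i a (σ.wreg 33) (σ.rreg 5)
  bestForest : BestSplit (forestCost pt l) i a (σ.wreg 34) (σ.rreg 6)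
  r31 : σ.wreg 31 = 8 * code (subsetPair a).2

section
variable {pt : ℕ → Pt} {l : List Pt} {n i a b : ℕ}

theorem pow_facts (hi : i < n) (a : ℕ) (ha : a < 3 ^ i) : 2 * 2 ^ i ≤ 2 ^ n ∧ 3 * 3 ^ i ≤ 3 ^ n ∧
    code (subsetPair a).1 < 2 ^ i ∧ code (subsetPair a).2 < 2 ^ i := by
  have hs := subsetPair_subset ha
  refine ⟨?_, ?_, code_lt hs.1, code_lt (hs.2.trans hs.1)⟩
  · rw [← pow_succ']; exact Nat.pow_le_pow_right (by norm_num) hi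
  · rw [← pow_succ']; exact Nat.pow_le_pow_right (by norm_num) hi

/-- Word register 24 and those above 30 do not matter, nor do the real registers above 2. -/
theorem PairInv.congr {c : ℕ} {σ τ : State} (h : PairInv pt l n i a c σ)
    (hw : ∀ d ≤ 30, d ≠ 24 → τ.wreg d = σ.wreg d) (hr : ∀ d ≤ 2, τ.rreg d = σ.rreg d)
    (hwm : τ.wmem = σ.wmem) (hrm : τ.rmem = σ.rmem) (ho : τ.out = σ.out) :
    PairInv pt l n i a c τ := by
  obtain ⟨hc, hE, h21, h25, h26, h27, h28, h29, h30, q0, q1, q2, hI, hR, hl, hm, hT, h0⟩ := h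
  obtain ⟨c2, c3, c10, c11, c12, c13, c14, c15, c16, c18⟩ := hc
  obtain ⟨E4, E5, E6, E7⟩ := hE
  constructor
  · constructor <;> (rw [hw _ (by norm_num) (by norm_num)]; assumption)
  · constructor <;> (rw [hw _ (by norm_num) (by norm_num)]; assumption)
  iterate 7 (rw [hw _ (by norm_num) (by norm_num)]; assumption)
  iterate 3 (rw [hr _ (by norm_num)]; assumption)
  · rwa [hrm]
  · rwa [hrm]
  · rwa [hwm]
  · rwa [hwm]
  · rwa [hwm, hrm]
  · rwa [ho]

theorem PairInv.succ {c : ℕ} {σ : State} (h : PairInv pt l n i a c σ)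
    (hne : (subsetPair a).2.Nonempty) : PairInv pt l n i (a + 1) c σ := by
  obtain ⟨hc, hE, h21, h25, h26, h27, h28, h29, h30, q0, q1, q2, hI, hR, hl, hm, hT, h0⟩ := h
  rw [← subsetPair_succ hne] at h26 hT
  exact ⟨hc, hE, h21, h25, h26, h27, h28, h29, h30, q0, q1, q2, hI, hR, hl, hm, hT, h0⟩

theorem pairPre_wp (hi : i < n) (ha : a < 3 ^ i) (hb : Bound l n b) {σ : State}
    (h : StageInv pt l n i a σ) : pairPre.wp b (MidInv pt l n i a) σ := by
  obtain ⟨f1, f2, f3, f4⟩ := pow_facts hi a ha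
  have e1 := subsetPair_even ha
  have e2 := subsetPair_odd ha
  have e3 : code (insert i (subsetPair a).2) = 2 ^ i + code (subsetPair a).2 :=
    code_insert fun h => notMem_subsetPair ha ((subsetPair_subset ha).2 h)
  obtain ⟨⟨hc, hE, h21, h25, h26, h27, h28, h29, h30, q0, q1, q2, hI, hR, hl, hm, hT, ho⟩, hbt,
    hbf⟩ := h
  have hA := hl a (by omega)
  unfold Bound at hb
  simp [pairPre, *, hc.r18]
  refine ⟨by omega, by omega, by omega, by omega, ?_⟩
  refine ⟨?_, by simpa using hbt, by simpa using hbf, by simp⟩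
  constructor <;> simp [*, mul_add, add_assoc]
  · intro x hx
    rcases Nat.lt_or_ge x (3 ^ i + 2 * a) with h | h
    · rw [Function.update_of_ne (by omega), Function.update_of_ne (by omega), hl x h]
    · rcases h.eq_or_lt with rfl | h
      · rw [Function.update_of_ne (by omega), update_eq (by omega), e1]
        simp only [e3]; ring
      · obtain rfl : x = 3 ^ i + 2 * a + 1 := by omega
        rw [update_eq (by omega), e2]
  · intro x
    have := hm x
    constructor <;> rw [Function.update_of_ne (by omega), Function.update_of_ne (by omega)]
    exacts [this.1, this.2]
  · intro T hne hTl
    refine (hT T hne hTl).congr (fun _ _ => rfl) fun k hk => ?_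
    rw [Function.update_of_ne (by omega), Function.update_of_ne (by omega)]

theorem candidatePre_wp (hi : i < n) (ha : a < 3 ^ i) (hb : Bound l n b)
    (hne : (subsetPair a).2.Nonempty) {σ : State} (h : MidInv pt l n i a σ) :
    candidatePre.wp b (fun τ => MidInv pt l n i a τ ∧
      τ.rreg 3 = treeCost pt (subsetPair a).2 +
        treeCost pt (insert i (subsetPair a).1 \ (subsetPair a).2) ∧
      τ.rreg 12 = forestCost pt l (subsetPair a).2 +
        forestCost pt l (insert i (subsetPair a).1 \ (subsetPair a).2)) σ := by
  obtain ⟨f1, f2, f3, f4⟩ := pow_facts hi a ha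
  have hpos := code_pos hne
  have hiJ := notMem_subsetPair ha
  have hsub := (subsetPair_subset ha).2.trans (Finset.subset_insert i _)
  have hcode := code_sdiff hsub
  rw [code_insert hiJ] at hcode
  obtain ⟨⟨hc, hE, h21, h25, h26, h27, h28, h29, h30, q0, q1, q2, hI, hR, hl, hm, hT, ho⟩, hbt,
    hbf, h31⟩ := h
  have hA := hT (subsetPair a).2 hne (by omega)
  have hB := hT (insert i (subsetPair a).1 \ (subsetPair a).2)
    ⟨i, Finset.mem_sdiff.2 ⟨Finset.mem_insert_self _ _, fun h =>
      hiJ ((subsetPair_subset ha).2 h)⟩⟩ (by omega)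
  have e : 8 * (2 ^ i + code (subsetPair a).1) - 8 * code (subsetPair a).2 =
    8 * code (insert i (subsetPair a).1 \ (subsetPair a).2) := by omega
  unfold Bound at hb
  simp [candidatePre, *, hE.r4, hE.r5, hA.tree, hB.tree, hA.forest, hB.forest]
  refine ⟨by omega, by omega, by omega, by omega, ?_⟩
  refine ⟨?_, by simpa using hbt, by simpa using hbf, by simpa using h31⟩
  constructor <;> simp [*] <;> assumption

theorem candidateStep_wp (hi : i < n) (ha : a < 3 ^ i) (hb : Bound l n b)
    (hne : (subsetPair a).2.Nonempty) {σ : State} (h : MidInv pt l n i a σ) :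
    candidateStep.wp b (StageInv pt l n i (a + 1)) σ := by
  rw [candidateStep, Prog.wp]
  refine Prog.wp_mono (candidatePre_wp hi ha hb hne h) ?_
  rintro τ ⟨⟨hp, hbt, hbf, h31⟩, r3, r12⟩
  obtain ⟨f1, f2, f3, f4⟩ := pow_facts hi a ha
  have hz : τ.wreg 33 = 0 ↔ τ.wreg 34 = 0 := hbt.eq_zero_iff.trans hbf.eq_zero_iff.symm
  unfold Bound at hb
  have hcb : 8 * code (subsetPair a).2 < b := by omega
  have q0 := hp.q0
  have h10 := hp.consts.r10
  have hs := hp.succ hne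
  -- The branches change only the registers for the best partitions.
  have hframe : ∀ wr rr, (∀ d ≤ 30, d ≠ 24 → wr d = τ.wreg d) → (∀ d ≤ 2, rr d = τ.rreg d) →
      PairInv pt l n i (a + 1) (a + 1) ⟨wr, rr, τ.wmem, τ.rmem, τ.out⟩ :=
    fun wr rr hw hr => hs.congr hw hr rfl rfl rfl
  simp [takeTree, takeForest, r3, r12, q0, h10, h31, hcb]
  refine ⟨fun h33 => ?_, fun h33 => ?_⟩
  · have h33' : τ.wreg 33 ≠ 0 := h33.ne'
    have h34' : τ.wreg 34 ≠ 0 := fun h => h33' (hz.2 h)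
    refine ⟨fun ht => ⟨fun hf => ?_, fun hf => ?_⟩, fun ht => ⟨fun hf => ?_, fun hf => ?_⟩⟩
    · refine ⟨hframe _ _ (fun d hd hd' => ?_) fun d hd => ?_, ?_, ?_⟩
      · iterate 2 rw [Function.update_of_ne (by omega)]
      · iterate 2 rw [Function.update_of_ne (by omega)]
      · simpa using hbt.take hne h33' ht
      · simpa using hbf.take hne h34' hf
    · refine ⟨hframe _ _ (fun d hd hd' => ?_) fun d hd => ?_, ?_, ?_⟩
      · rw [Function.update_of_ne (by omega)]
      · rw [Function.update_of_ne (by omega)]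
      · simpa using hbt.take hne h33' ht
      · simpa using hbf.keep hne h34' hf
    · refine ⟨hframe _ _ (fun d hd hd' => ?_) fun d hd => ?_, ?_, ?_⟩
      · rw [Function.update_of_ne (by omega)]
      · rw [Function.update_of_ne (by omega)]
      · simpa using hbt.keep hne h33' ht
      · simpa using hbf.take hne h34' hf
    · exact ⟨hs, hbt.keep hne h33' ht, hbf.keep hne h34' hf⟩
  · rw [h33] at hbt
    rw [hz.1 h33] at hbf
    refine ⟨hframe _ _ (fun d hd hd' => ?_) fun d hd => ?_, ?_, ?_⟩
    · iterate 2 rw [Function.update_of_ne (by omega)]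
    · iterate 2 rw [Function.update_of_ne (by omega)]
    · simpa using hbt.first hne
    · simpa using hbf.first hne

/-- The corner of the current set `insert i J`, where `J` is the first component of the entry
number `a`, has been computed. -/
structure CornerInv (pt : ℕ → Pt) (l : List Pt) (n i a : ℕ) (σ : State) : Prop where
  pair : PairInv pt l n i a (a + 1) σ
  bestTree : BestSplit (treeCost pt) i a (σ.wreg 33) (σ.rreg 5)
  bestForest : BestSplit (forestCost pt l) i a (σ.wreg 34) (σ.rreg 6)
  fst : σ.rreg 7 = (corner pt (insert i (subsetPair a).1)).1
  snd : σ.rreg 8 = (corner pt (insert i (subsetPair a).1)).2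
  row : ∃ j ∈ insert i (subsetPair a).1, σ.wreg 35 = 2 * (n * j) ∧
    (pt j).1 = (corner pt (insert i (subsetPair a).1)).1
  col : ∃ j ∈ insert i (subsetPair a).1, σ.wreg 36 = 2 * j ∧
    (pt j).2 = (corner pt (insert i (subsetPair a).1)).2

theorem cornerProg_wp (hi : i < n) (ha : a < 3 ^ i) (hb : Bound l n b) {σ : State}
    (h : MidInv pt l n i a σ) : cornerProg.wp b (CornerInv pt l n i a) σ := by
  obtain ⟨f1, f2, f3, f4⟩ := pow_facts hi a ha
  obtain ⟨hp, hbt, hbf, h31⟩ := h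
  have hE := hp.bases
  have hc := hp.consts
  have hni : 2 * (n * i) < tableBase l n ∧ 2 * i < tableBase l n := by
    have : n * i ≤ n * n := Nat.mul_le_mul_left n hi.le
    unfold tableBase
    omega
  unfold Bound at hb
  have e : 8 * (2 ^ i + code (subsetPair a).1) - 8 * 2 ^ i = 8 * code (subsetPair a).1 := by omega
  have hframe : ∀ wr rr, (∀ d ≤ 30, d ≠ 24 → wr d = σ.wreg d) → (∀ d ≤ 2, rr d = σ.rreg d) →
      PairInv pt l n i a (a + 1) ⟨wr, rr, σ.wmem, σ.rmem, σ.out⟩ :=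
    fun wr rr hw hr => hp.congr hw hr rfl rfl rfl
  by_cases hJ : (subsetPair a).1 = ∅
  · simp [cornerProg, hp.r26, hp.r27, e, hp.q0, hp.q1, hp.q2, hp.r21, hp.r25, hc.r10, hJ]
    refine ⟨by omega, by omega, hframe _ _ (fun d hd hd' => ?_) fun d hd => ?_, by simpa using hbt,
      by simpa using hbf, by simp [hJ], by simp [hJ], ⟨i, by simp, by simp [hJ]⟩,
      ⟨i, by simp, by simp [hJ]⟩⟩
    · iterate 3 rw [Function.update_of_ne (by omega)]
    · iterate 2 rw [Function.update_of_ne (by omega)]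
  · have hne := Finset.nonempty_iff_ne_empty.2 hJ
    have hpos := code_pos hne
    have hJt := hp.table _ hne (by have := Nat.two_pow_pos i; omega)
    have hcor := corner_insert (pt := pt) (i := i) hne
    obtain ⟨j, hj, hj1, hj2⟩ := hJt.row
    obtain ⟨k, hk, hk1, hk2⟩ := hJt.col
    simp [cornerProg, hp.r26, hp.r27, e, hp.q0, hp.q1, hp.q2, hp.r21, hp.r25, hc.r10, hc.r11,
      hc.r12, hE.r6, hE.r7, hpos, hJt.fst, hJt.snd]
    have hle1 : ∀ {x y : ℝ}, x < y → min y x = x := fun h => min_eq_right h.le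
    refine ⟨by omega, by omega, by omega, fun hx => ⟨by omega, by omega, fun hy => ⟨by omega, ?_⟩,
      fun hy => ?_⟩, fun hx => ⟨by omega, fun hy => ⟨by omega, ?_⟩, fun hy => ?_⟩⟩
    · refine ⟨hframe _ _ (fun d hd hd' => ?_) fun d hd => ?_, by simpa using hbt,
        by simpa using hbf, by simp [hcor, hle1 hx], by simp [hcor, hle1 hy],
        ⟨j, by simp [hj], by simp [hj1], by simp [hcor, hle1 hx, hj2]⟩,
        ⟨k, by simp [hk], by simp [hk1], by simp [hcor, hle1 hy, hk2]⟩⟩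
      · repeat rw [Function.update_of_ne (by omega)]
      · repeat rw [Function.update_of_ne (by omega)]
    · refine ⟨hframe _ _ (fun d hd hd' => ?_) fun d hd => ?_, by simpa using hbt,
        by simpa using hbf, by simp [hcor, hle1 hx], by simp [hcor, hy],
        ⟨j, by simp [hj], by simp [hj1], by simp [hcor, hle1 hx, hj2]⟩,
        ⟨i, by simp, by simp, by simp [hcor, hy]⟩⟩
      · repeat rw [Function.update_of_ne (by omega)]
      · repeat rw [Function.update_of_ne (by omega)]
    · refine ⟨hframe _ _ (fun d hd hd' => ?_) fun d hd => ?_, by simpa using hbt,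
        by simpa using hbf, by simp [hcor, hx], by simp [hcor, hle1 hy],
        ⟨i, by simp, by simp, by simp [hcor, hx]⟩,
        ⟨k, by simp [hk], by simp [hk1], by simp [hcor, hle1 hy, hk2]⟩⟩
      · repeat rw [Function.update_of_ne (by omega)]
      · repeat rw [Function.update_of_ne (by omega)]
    · refine ⟨hframe _ _ (fun d hd hd' => ?_) fun d hd => ?_, by simpa using hbt,
        by simpa using hbf, by simp [hcor, hx], by simp [hcor, hy],
        ⟨i, by simp, by simp, by simp [hcor, hx]⟩, ⟨i, by simp, by simp, by simp [hcor, hy]⟩⟩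
      · repeat rw [Function.update_of_ne (by omega)]
      · repeat rw [Function.update_of_ne (by omega)]

/-- The costs of the current set have been computed. -/
structure CostInv (pt : ℕ → Pt) (l : List Pt) (n i a : ℕ) (σ : State) : Prop where
  pair : PairInv pt l n i a (a + 1) σ
  fst : σ.rreg 7 = (corner pt (insert i (subsetPair a).1)).1
  snd : σ.rreg 8 = (corner pt (insert i (subsetPair a).1)).2
  row : ∃ j ∈ insert i (subsetPair a).1, σ.wreg 35 = 2 * (n * j) ∧
    (pt j).1 = (corner pt (insert i (subsetPair a).1)).1
  col : ∃ j ∈ insert i (subsetPair a).1, σ.wreg 36 = 2 * j ∧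
    (pt j).2 = (corner pt (insert i (subsetPair a).1)).2
  tree : σ.rreg 12 = treeCost pt (insert i (subsetPair a).1)
  forest : σ.rreg 13 = forestCost pt l (insert i (subsetPair a).1)
  treeChoice : TreeChoice pt (insert i (subsetPair a).1) (σ.wreg 33)
  forestChoice : ForestChoice pt l (insert i (subsetPair a).1) (σ.wreg 34)

theorem mul_add_lt {j k : ℕ} (hj : j < n) (hk : k < n) : n * j + k < n * n := by
  have : n * j + n ≤ n * n := by
    rw [← Nat.mul_succ]; exact Nat.mul_le_mul_left n hj
  omega

theorem costProg_wp (hi : i < n) (ha : a < 3 ^ i) (hb : Bound l n b)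
    (he : (subsetPair a).2 = ∅) {σ : State} (h : CornerInv pt l n i a σ) :
    costProg.wp b (CostInv pt l n i a) σ := by
  obtain ⟨hp, hbt, hbf, h7, h8, ⟨j, hj, hj1, hj2⟩, ⟨k, hk, hk1, hk2⟩⟩ := h
  have hiJ := notMem_subsetPair ha
  have hlt : ∀ j ∈ insert i (subsetPair a).1, j < n := by
    intro j hj
    rcases Finset.mem_insert.1 hj with rfl | hj
    · exact hi
    · exact (Finset.mem_range.1 ((subsetPair_subset ha).1 hj)).trans hi
  have hjk := mul_add_lt (hlt j hj) (hlt k hk)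
  have hroot := hp.roots j (hlt j hj) k (hlt k hk) hjk
  rw [hj2, hk2, Prod.mk.eta, mul_add, ← add_assoc] at hroot
  have hc := hp.consts
  have hdef : tableBase l n = 2 * n + 2 * l.length + 2 * (n * n) := rfl
  unfold Bound at hb
  have hframe : ∀ wr rr, (∀ d ≤ 30, d ≠ 24 → wr d = σ.wreg d) → (∀ d ≤ 2, rr d = σ.rreg d) →
      PairInv pt l n i a (a + 1) ⟨wr, rr, σ.wmem, σ.rmem, σ.out⟩ :=
    fun wr rr hw hr => hp.congr hw hr rfl rfl rfl
  by_cases hJ : (subsetPair a).1 = ∅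
  · have h33 := hbt.final_empty ha hJ
    have h34 := hbf.final_empty ha hJ
    have ht := treeCost_singleton (pt := pt) i
    have hf := forestCost_singleton (pt := pt) (l := l) i
    rw [ht] at hf
    simp only [hJ, insert_empty_eq, corner_singleton] at h7 h8 hj hk hj2 hk2 hroot hf
    simp [costProg, hc.r3, hc.r10, hc.r11, hj1, hk1, h33, h34, hroot, h7, h8, hp.q0]
    refine ⟨by omega, by omega, by omega, hframe _ _ (fun d hd hd' => ?_) fun d hd => ?_,
      by simp [h7, hJ], by simp [h8, hJ], ⟨j, by simp [hJ, hj], by simp [hj1], by simp [hJ, hj2]⟩,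
      ⟨k, by simp [hJ, hk], by simp [hk1], by simp [hJ, hk2]⟩, by simp [hJ, ht, hgt],
      ?_, .inl ⟨by simp [h33], i, by simp [hJ]⟩, .inl ⟨by simp [h34], by simp [hJ, hf, ht]⟩⟩
    · repeat rw [Function.update_of_ne (by omega)]
    · repeat rw [Function.update_of_ne (by omega)]
    · simp [hJ, hf, hgt]; ring
  · have hne := Finset.nonempty_iff_ne_empty.2 hJ
    obtain ⟨n33, t1, t2⟩ := hbt.final ha he hne
    obtain ⟨n34, u1, u2⟩ := hbf.final ha he hne
    have hcard : 1 < (insert i (subsetPair a).1).card := by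
      rw [Finset.card_insert_of_notMem hiJ]
      have := Finset.card_pos.2 hne
      omega
    have ht := treeCost_of_one_lt (pt := pt) hcard
    have hf := forestCost_of_one_lt (pt := pt) (l := l) hcard
    rw [t1] at ht
    rw [u1] at hf
    have htree : σ.rreg 5 - (σ.rreg 7 + σ.rreg 8) = treeCost pt (insert i (subsetPair a).1) := by
      rw [ht, h7, h8]; rfl
    have htc : TreeChoice pt (insert i (subsetPair a).1) (σ.wreg 33) := by
      obtain ⟨A, hA, hAne, h1, h2⟩ := t2
      exact .inr ⟨A, hA, hAne, h1, by rw [ht, h2]⟩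
    have hg : treeCost pt (insert i (subsetPair a).1) -
        hgt (bestRoot l (corner pt (insert i (subsetPair a).1))) =
        treeCost pt (insert i (subsetPair a).1) -
          (bestRoot l (corner pt (insert i (subsetPair a).1))).1 -
          (bestRoot l (corner pt (insert i (subsetPair a).1))).2 := by
      simp only [hgt]; ring
    have p33 : 0 < σ.wreg 33 := by omega
    have p34 : 0 < σ.wreg 34 := by omega
    simp [costProg, hc.r3, hc.r10, hc.r11, hj1, hk1, p33, p34, hroot, htree, hp.q0]
    refine ⟨by omega, by omega, by omega, fun hlt => ⟨by omega, ?_⟩, fun hle => ?_⟩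
    · have hf1 : forestCost pt l (insert i (subsetPair a).1) =
          treeCost pt (insert i (subsetPair a).1) -
            hgt (bestRoot l (corner pt (insert i (subsetPair a).1))) := by
        rw [hf]; exact min_eq_left (by rw [hg]; exact hlt.le)
      refine ⟨hframe _ _ (fun d hd hd' => ?_) fun d hd => ?_, by simp [h7], by simp [h8],
        ⟨j, hj, by simp [hj1], hj2⟩, ⟨k, hk, by simp [hk1], hk2⟩, by simp,
        by simp [hf1, hg], by simpa using htc, .inl ⟨by simp, hf1⟩⟩
      · repeat rw [Function.update_of_ne (by omega)]
      · repeat rw [Function.update_of_ne (by omega)]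
    · have hf1 : forestCost pt l (insert i (subsetPair a).1) = σ.rreg 6 := by
        rw [hf]; exact min_eq_right (by rw [hg]; exact hle)
      refine ⟨hframe _ _ (fun d hd hd' => ?_) fun d hd => ?_, by simp [h7], by simp [h8],
        ⟨j, hj, by simp [hj1], hj2⟩, ⟨k, hk, by simp [hk1], hk2⟩, by simp,
        by simp [hf1], by simpa using htc, .inr ?_⟩
      · repeat rw [Function.update_of_ne (by omega)]
      · repeat rw [Function.update_of_ne (by omega)]
      · obtain ⟨A, hA, hAne, h1, h2⟩ := u2
        exact ⟨A, hA, hAne, by simpa using h1, by rw [hf1, h2]⟩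

theorem enterProg_wp (hi : i < n) (ha : a < 3 ^ i) (hb : Bound l n b)
    (he : (subsetPair a).2 = ∅) {σ : State} (h : CostInv pt l n i a σ) :
    enterProg.wp b (StageInv pt l n i (a + 1)) σ := by
  obtain ⟨f1, f2, f3, f4⟩ := pow_facts hi a ha
  obtain ⟨⟨hc, hE, h21, h25, h26, h27, h28, h29, h30, q0, q1, q2, hI, hR, hl, hm, hT, ho⟩,
    h7, h8, hrow, hcol, h12, h13, htc, hfc⟩ := h
  have hsucc := code_subsetPair_succ ha
  rw [if_pos he] at hsucc
  have hcode := code_insert (notMem_subsetPair ha)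
  have hdef : 2 * n + 2 * l.length + 2 * (n * n) ≤ tableBase l n := le_rfl
  unfold Bound at hb
  rw [← hcode] at h26
  simp [enterProg, hc.r10, hc.r11, hc.r12, hc.r13, hc.r14, hc.r18, hE.r4, hE.r5, hE.r6, hE.r7, h26]
  generalize hS : insert i (subsetPair a).1 = S at *
  refine ⟨by omega, by omega, by omega, by omega, by omega, by omega, by omega, by omega, by omega,
    by omega, ?_, BestSplit.reset (.inr ⟨a, rfl, he⟩) _, BestSplit.reset (.inr ⟨a, rfl, he⟩) _⟩
  constructor <;> simp [*, -hcode, -hsucc]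
  · omega
  · iterate 4 refine InputMem.update ?_ (by omega)
    exact hI
  · intro j hj k hk hjk
    have := hR j hj k hk hjk
    constructor
    · iterate 4 rw [Function.update_of_ne (by omega)]
      exact this.1
    · iterate 4 rw [Function.update_of_ne (by omega)]
      exact this.2
  · intro x hx
    iterate 4 rw [Function.update_of_ne (by omega)]
    exact hl x hx
  · intro x
    have := hm x
    constructor
    · iterate 4 rw [Function.update_of_ne (by omega)]
      exact this.1
    · iterate 4 rw [Function.update_of_ne (by omega)]
      exact this.2
  · intro T hne hTl
    rcases (show code T ≤ code S by omega).lt_or_eq with hlt | heq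
    · refine (hT T hne (by omega)).congr (fun k hk => ?_) fun k hk => ?_
      · iterate 4 rw [Function.update_of_ne (by omega)]
      · iterate 4 rw [Function.update_of_ne (by omega)]
    · obtain rfl := code_injective heq
      obtain ⟨j, hj, hj1, hj2⟩ := hrow
      obtain ⟨k, hk, hk1, hk2⟩ := hcol
      refine ⟨?_, ?_, ?_, ?_, ⟨j, hj, ?_, hj2⟩, ⟨k, hk, ?_, hk2⟩, ?_, ?_⟩
      · iterate 3 rw [Function.update_of_ne (by omega)]
        exact Function.update_self _ _ _
      · iterate 2 rw [Function.update_of_ne (by omega)]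
        exact Function.update_self _ _ _
      · rw [Function.update_of_ne (by omega)]
        exact Function.update_self _ _ _
      · exact Function.update_self _ _ _
      · iterate 3 rw [Function.update_of_ne (by omega)]
        rw [Function.update_self, hj1]
      · iterate 2 rw [Function.update_of_ne (by omega)]
        rw [Function.update_self, hk1]
      · rw [Function.update_of_ne (by omega), Function.update_self]
        exact htc
      · rw [Function.update_self]
        exact hfc

theorem pairStep_wp (hi : i < n) (ha : a < 3 ^ i) (hb : Bound l n b) {σ : State}
    (h : StageInv pt l n i a σ) : pairStep.wp b (StageInv pt l n i (a + 1)) σ := by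
  rw [pairStep, Prog.wp]
  refine Prog.wp_mono (pairPre_wp hi ha hb h) fun τ hτ => ⟨fun hc => ?_, fun hc => ?_⟩
  · refine candidateStep_wp hi ha hb (Finset.nonempty_iff_ne_empty.2 fun he => ?_) hτ
    rw [Test.Holds, hτ.r31, hτ.pair.consts.r10, he] at hc
    exact lt_irrefl _ hc
  · have he : (subsetPair a).2 = ∅ := by
      rw [Test.Holds, hτ.r31, hτ.pair.consts.r10] at hc
      exact code_eq_zero.1 (by omega)
    refine Prog.wp_seq (cornerProg_wp hi ha hb hτ) fun τ hτ => ?_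
    exact Prog.wp_seq (costProg_wp hi ha hb he hτ) fun τ hτ => enterProg_wp hi ha hb he hτ

/-- The state before the sets with last element `i` are entered. -/
structure TableInv (pt : ℕ → Pt) (l : List Pt) (n i : ℕ) (σ : State) : Prop where
  consts : Consts n l.length σ.wreg
  bases : Bases (tableBase l n) σ.wreg
  r21 : σ.wreg 21 = 2 * i
  r25 : σ.wreg 25 = 2 * (n * i)
  r26 : σ.wreg 26 = 8 * 2 ^ i
  r28 : σ.wreg 28 = 8 * 3 ^ i
  r33 : BestSplit (treeCost pt) i 0 (σ.wreg 33) (σ.rreg 5)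
  r34 : BestSplit (forestCost pt l) i 0 (σ.wreg 34) (σ.rreg 6)
  q0 : σ.rreg 0 = 0
  inp : InputMem pt l n σ.rmem
  roots : RootTable pt l n (n * n) σ.rmem
  list : ∀ x < 3 ^ i, σ.wmem (8 * x) = 8 * code (subsetPair x).2
  marks : ∀ x, σ.wmem (8 * x + 5) = 0 ∧ σ.wmem (8 * x + 6) = 0
  table : ∀ T : Finset ℕ, T.Nonempty → code T < 2 ^ i →
    TableAt pt l n (tableBase l n) σ.rmem σ.wmem T
  out : σ.out = []

theorem stagePre_wp (hi : i < n) (hb : Bound l n b) {σ : State}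
    (h : TableInv pt l n i σ) : stagePre.wp b (StageInv pt l n i 0) σ := by
  have f := pow_facts hi 0 (by positivity)
  have hx := h.inp.pt_fst i hi
  have hy := h.inp.pt_snd i hi
  obtain ⟨hc, hE, h21, h25, h26, h28, h33, h34, q0, hI, hR, hl, hm, hT, ho⟩ := h
  have hdef : 2 * n + 2 * l.length + 2 * (n * n) ≤ tableBase l n := le_rfl
  unfold Bound at hb
  simp [stagePre, h21, h26, h28, hc.r10, hc.r11, hx, hy]
  refine ⟨by omega, by omega, by omega, by omega, ?_, by simpa using h33, by simpa using h34⟩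
  constructor <;> simp [*, subsetPair_zero] <;> assumption

theorem stagePost_wp (hi : i < n) (hb : Bound l n b) {σ : State}
    (h : StageInv pt l n i (3 ^ i) σ) : stagePost.wp b (TableInv pt l n (i + 1)) σ := by
  obtain ⟨⟨hc, hE, h21, h25, h26, h27, h28, h29, h30, q0, q1, q2, hI, hR, hl, hm, hT, ho⟩, h33,
    h34⟩ := h
  have hdef : 2 * n + 2 * l.length + 2 * (n * n) ≤ tableBase l n := le_rfl
  have hni : n * i + n ≤ n * n := by
    rw [← Nat.mul_succ]; exact Nat.mul_le_mul_left n hi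
  unfold Bound at hb
  have e1 : code (subsetPair (3 ^ i)).1 = 2 ^ i := by rw [subsetPair_pow, code_singleton]
  have e2 : 2 ^ (i + 1) = 2 ^ i + 2 ^ i := by rw [pow_succ]; ring
  have e3 : 3 ^ (i + 1) = 3 ^ i + 2 * 3 ^ i := by rw [pow_succ]; ring
  have e4 : n * (i + 1) = n * i + n := by ring
  rw [e1] at h26 hT
  rw [← e3] at h28 hl
  rw [← e2] at h26 hT
  -- No subset of `{i}` has been listed yet.
  have hseen : ∀ A, ¬ Seen (3 ^ i) A := by
    rintro A ⟨x, hx, heq⟩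
    have := notMem_subsetPair hx
    rw [heq, subsetPair_pow] at this
    exact this (Finset.mem_singleton_self i)
  have z33 := h33.eq_zero_iff.2 hseen
  have z34 := h34.eq_zero_iff.2 hseen
  simp [stagePost, h21, h25, hc.r2, hc.r12]
  refine ⟨by omega, by omega, ?_⟩
  constructor <;> simp [*, mul_add, -e3, -e2] <;>
    first | assumption | exact .inl ⟨rfl, by simp [Seen]⟩

theorem stageStep_terminates {w : ℕ} (hi : i < n) (hb : Bound l n (2 ^ w)) {σ : State}
    (hσ : σ.Fits w) (h : TableInv pt l n i σ) :
    Terminates w stageStep (100 * 3 ^ i + 20) σ (TableInv pt l n (i + 1)) := by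
  have h1 := (Prog.wp_sound (stagePre_wp hi hb h) hσ).seq
    (q := .loop (.wlt 30 29) pairStep ;; stagePost) (T₂ := 100 * 3 ^ i + 4)
    (Q := TableInv pt l n (i + 1)) ?_
  · exact h1.mono (by simp [stagePre, Prog.cost]; omega) fun _ => id
  intro τ hτ hI
  have h2 := (Terminates.loop (c := .wlt 30 29) (p := pairStep) (N := 3 ^ i)
    (T := fun _ => 90) (Inv := StageInv pt l n i)
    (fun k hk ρ hρ hI => ⟨?_, Prog.wp_terminates (by decide) hρ (pairStep_wp hi hk hb hI)⟩)
    (fun ρ hI => ?_) hτ hI).seq (q := stagePost) (T₂ := 3) (Q := TableInv pt l n (i + 1))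
      fun ρ hρ hI => Prog.wp_terminates (by simp [stagePost, Prog.cost]) hρ
        (stagePost_wp hi hb hI)
  · exact h2.mono (by simp; omega) fun _ => id
  · simp [hI.pair.r30, hI.pair.r29]; omega
  · simp [hI.pair.r30, hI.pair.r29]

theorem sum_pow_three (n : ℕ) : ∑ i ∈ Finset.range n, 3 ^ i ≤ 3 ^ n := by
  induction n with
  | zero => simp
  | succ n ih => rw [Finset.sum_range_succ, pow_succ]; omega

theorem tableProg_terminates {w : ℕ} (hb : Bound l n (2 ^ w)) {σ : State}
    (hσ : σ.Fits w) (h : TableInv pt l n 0 σ) :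
    Terminates w tableProg (150 * 3 ^ n) σ (TableInv pt l n n) := by
  have h1 := Terminates.loop (c := .wlt 21 2) (p := stageStep) (N := n)
    (T := fun i => 100 * 3 ^ i + 20) (Inv := TableInv pt l n)
    (fun k hk ρ hρ hI => ⟨?_, stageStep_terminates hk hb hρ hI⟩) (fun ρ hI => ?_) hσ h
  · refine h1.mono ?_ fun _ => id
    have h2 := sum_pow_three n
    have h3 : n < 3 ^ n := Nat.lt_pow_self (by norm_num)
    rw [Finset.sum_add_distrib, Finset.sum_add_distrib, ← Finset.mul_sum]
    simp
    omega
  · simp [hI.r21, hI.consts.r2]; omega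
  · simp [hI.r21, hI.consts.r2]

theorem basesProg_wp (hb : Bound l n b) {σ : State} (h : RowInv pt l n n σ) :
    basesProg.wp b (TableInv pt l n 0) σ := by
  obtain ⟨hc, h20, h21, q0, hI, hR, hw, ho⟩ := h
  have hdef : 2 * n + 2 * l.length + 2 * (n * n) = tableBase l n := rfl
  rw [hdef] at h20
  unfold Bound at hb
  have hpos := Nat.two_pow_pos n
  simp [basesProg, h20, hc.r10, hc.r11, hc.r12, hc.r13, hc.r18]
  refine ⟨by omega, by omega, by omega, by omega, by omega, by omega, by omega, ?_⟩
  obtain ⟨c2, c3, c10, c11, c12, c13, c14, c15, c16, c18⟩ := hc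
  constructor <;> simp [*, subsetPair_zero]
  · constructor <;> simpa
  · constructor <;> simp
  · exact BestSplit.reset (.inl rfl) _
  · exact BestSplit.reset (.inl rfl) _
  · intro T hne hT
    exact absurd hT (code_pos hne).ne'
end

/-! ### The program: output of an optimal network -/

/-- Outputs a monotone path from the point in real registers 1 and 2 to the one in 3 and 4. -/
def emitLink : Prog :=
  .ite (.rlt 1 3) (.op (.emit 1 2 3 2)) .skip ;; .ite (.rlt 2 4) (.op (.emit 3 2 3 4)) .skip

/-- Marks the two parts of the current set as sets for which a forest is to be drawn. -/
def splitForest : Prog := .block [.wsub 32 26 31, .wadd 24 31 15, .wstore 24 11, .wadd 24 32 15,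
  .wstore 24 11]

/-- Marks the current set as one for which a tree is to be drawn, and joins its corner to the best
root. -/
def rootTree : Prog :=
  .block [.wadd 24 26 16, .wstore 24 11, .wadd 24 26 11, .wload 35 24, .wadd 24 26 12,
    .wload 36 24, .wadd 24 3 35, .wadd 24 24 36, .rload 1 24, .wadd 24 24 11, .rload 2 24,
    .wadd 24 6 26, .rload 3 24, .wadd 24 7 26, .rload 4 24] ;; emitLink

/-- Replaces the current set, if it is marked for a forest, by its two parts or by a tree. -/
def forestStep : Prog :=
  .block [.wadd 24 26 15, .wload 31 24] ;;
  .ite (.wlt 10 31)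
    (.block [.wadd 24 26 14, .wload 31 24] ;; .ite (.wlt 10 31) splitForest rootTree) .skip

/-- Marks the two parts of the current set as sets for which a tree is to be drawn, and joins the
corner of the set to theirs. -/
def splitTree : Prog :=
  .block [.wsub 32 26 31, .wadd 24 31 16, .wstore 24 11, .wadd 24 32 16, .wstore 24 11,
    .wadd 24 6 26, .rload 1 24, .wadd 24 7 26, .rload 2 24,
    .wadd 24 6 31, .rload 3 24, .wadd 24 7 31, .rload 4 24] ;; emitLink ;;
  .block [.wadd 24 6 32, .rload 3 24, .wadd 24 7 32, .rload 4 24] ;; emitLink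

/-- Replaces the current set, if it is marked for a tree, by its two parts, or just drops it if it
is a singleton. -/
def treeStep : Prog :=
  .block [.wadd 24 26 16, .wload 31 24] ;;
  .ite (.wlt 10 31)
    (.block [.wadd 24 26 13, .wload 31 24] ;; .ite (.wlt 10 31) splitTree .skip) .skip

/-- Marks the set of all points for a forest. -/
def outputPre : Prog := .block [.wsub 26 26 18, .wadd 24 26 15, .wstore 24 11]

/-- Passes to the set with the next smaller code. -/
def outputPost : Prog := .block [.wsub 26 26 18]

/-- Processes the marked sets in the order of decreasing codes, so that each set comes after all
sets that can mark it. -/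
def outputProg : Prog :=
  outputPre ;; .loop (.wlt 10 26) (forestStep ;; treeStep ;; outputPost)

/-- Among the sets with codes below `c`, those in `hm` are marked in the table with offset `o`. -/
structure Marked (f : ℕ → ℕ) (o c : ℕ) (hm : Finset (Finset ℕ)) : Prop where
  lt : ∀ T ∈ hm, code T < c
  iff : ∀ T : Finset ℕ, T.Nonempty → code T < c → (0 < f (8 * code T + o) ↔ T ∈ hm)

section
variable {f : ℕ → ℕ} {o c : ℕ} {hm : Finset (Finset ℕ)} {T A : Finset ℕ}

theorem Marked.erase (h : Marked f o (code T + 1) hm) : Marked f o (code T) (hm.erase T) where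
  lt U hU := by
    have h1 := h.lt U (Finset.mem_of_mem_erase hU)
    have h2 : code U ≠ code T := fun h => Finset.ne_of_mem_erase hU (code_injective h)
    omega
  iff U hne hU := by
    rw [h.iff U hne (by omega), Finset.mem_erase]
    exact (and_iff_right (by rintro rfl; exact lt_irrefl _ hU)).symm

theorem Marked.insert (h : Marked f o c hm) (hA : code A < c) {x v : ℕ}
    (hx : x = 8 * code A + o) (hv : 0 < v) :
    Marked (Function.update f x v) o c (insert A hm) where
  lt U hU := by
    rcases Finset.mem_insert.1 hU with rfl | hU
    exacts [hA, h.lt U hU]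
  iff U hne hU := by
    by_cases hUA : U = A
    · subst hUA
      rw [update_eq hx]
      exact iff_of_true hv (Finset.mem_insert_self _ _)
    · have : code U ≠ code A := fun h => hUA (code_injective h)
      rw [Function.update_of_ne (by omega), h.iff U hne hU, Finset.mem_insert,
        or_iff_right hUA]

theorem Marked.update (h : Marked f o c hm) {x v : ℕ} (hx : ∀ y, x ≠ 8 * y + o) :
    Marked (Function.update f x v) o c hm where
  lt := h.lt
  iff U hne hU := by rw [Function.update_of_ne (hx _).symm, h.iff U hne hU]

end

/-- The state during the output: `s` is the code of the current set; forests remain to be drawn for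
some sets with codes less than `c`, and trees for some sets with codes less than `d`. -/
structure OutputInv (pt : ℕ → Pt) (l : List Pt) (n s c d : ℕ) (σ : State) : Prop where
  consts : Consts n l.length σ.wreg
  bases : Bases (tableBase l n) σ.wreg
  r26 : σ.wreg 26 = 8 * s
  roots : RootTable pt l n (n * n) σ.rmem
  table : ∀ T : Finset ℕ, T.Nonempty → code T < 2 ^ n →
    TableAt pt l n (tableBase l n) σ.rmem σ.wmem T
  pending : ∃ hm km, Pending pt l n hm km σ.out ∧ Marked σ.wmem 5 c hm ∧ Marked σ.wmem 6 d km

section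
variable {pt : ℕ → Pt} {l : List Pt} {n b : ℕ} {T : Finset ℕ}

theorem emitLink_wp {Q : State → Prop} {σ : State} : emitLink.wp b Q σ ↔
    Q ⟨σ.wreg, σ.rreg, σ.wmem, σ.rmem,
      σ.out ++ link (σ.rreg 1, σ.rreg 2) (σ.rreg 3, σ.rreg 4)⟩ := by
  by_cases h1 : σ.rreg 1 < σ.rreg 3 <;> by_cases h2 : σ.rreg 2 < σ.rreg 4 <;>
    simp [emitLink, link, h1, h2]

theorem forestStep_wp (hl : (0, 0) ∈ l) (hq : ∀ i < n, Covers (0, 0) (pt i)) (hne : T.Nonempty)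
    (hT : code T < 2 ^ n) (hb : Bound l n b) {σ : State}
    (h : OutputInv pt l n (code T) (code T + 1) (code T + 1) σ) :
    forestStep.wp b (OutputInv pt l n (code T) (code T) (code T + 1)) σ := by
  obtain ⟨hc, hE, h26, hR, ht, hm, km, hp, hm1, hm2⟩ := h
  have hdef : 2 * n + 2 * l.length + 2 * (n * n) ≤ tableBase l n := le_rfl
  have hTa := ht T hne hT
  have hpos := code_pos hne
  unfold Bound at hb
  simp [forestStep, h26, hc.r10, hc.r14, hc.r15]
  refine ⟨by omega, fun hmark => ⟨by omega, fun hch => ?_, fun hch => ?_⟩, fun hmark => ?_⟩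
  · have hmem := (hm1.iff T hne (by omega)).1 hmark
    rcases hTa.forestChoice with ⟨h0, -⟩ | ⟨A, hA, hAne, hcA, heq⟩
    · omega
    have hsub := code_sdiff hA.subset
    have hlt := code_lt_code hA
    have hApos := code_pos hAne
    have e : 8 * code T - 8 * code A = 8 * code (T \ A) := by omega
    simp [splitForest, h26, hc.r11, hc.r15, hcA, e]
    refine ⟨by omega, by omega, ?_⟩
    refine ⟨by simpa using hc, by simpa using hE, by simpa using h26, hR, fun U hU hUn => ?_, _, _,
      hp.split_forest hq hmem hA hAne heq, ?_, ?_⟩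
    · refine (ht U hU hUn).congr (fun _ _ => rfl) fun k hk => ?_
      dsimp only
      iterate 2 rw [Function.update_of_ne (by omega)]
    · rw [Finset.insert_comm]
      exact (hm1.erase.insert hlt rfl one_pos).insert (by omega) rfl one_pos
    · exact (hm2.update fun y => by omega).update fun y => by omega
  · have hmem := (hm1.iff T hne (by omega)).1 hmark
    rcases hTa.forestChoice with ⟨-, heq⟩ | ⟨A, hA, hAne, hcA, heq⟩
    · obtain ⟨j, hj, hj1, hj2⟩ := hTa.row
      obtain ⟨k, hk, hk1, hk2⟩ := hTa.col
      have hlt : ∀ j ∈ T, j < n := fun j hj => Finset.mem_range.1 (subset_range_of_code_lt hT hj)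
      have hjk := mul_add_lt (hlt j hj) (hlt k hk)
      have hroot := hR j (hlt j hj) k (hlt k hk) hjk
      rw [hj2, hk2, Prod.mk.eta, mul_add, ← add_assoc] at hroot
      simp [rootTree, emitLink_wp, h26, hc.r3, hc.r11, hc.r12, hc.r16, hE.r6, hE.r7, hj1, hk1,
        hroot, hTa.fst, hTa.snd]
      refine ⟨by omega, by omega, by omega, by omega, by omega, by omega, by omega, by omega, ?_⟩
      refine ⟨by simpa using hc, by simpa using hE, by simpa using h26, hR, fun U hU hUn => ?_,
        _, _, hp.root_tree hl hq hmem heq, ?_, ?_⟩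
      · refine (ht U hU hUn).congr (fun _ _ => rfl) fun k hk => ?_
        dsimp only
        rw [Function.update_of_ne (by omega)]
      · exact hm1.erase.update fun y => by omega
      · exact hm2.insert (by omega) rfl one_pos
    · have := code_pos hAne
      omega
  · have hmem : T ∉ hm := fun h => by
      have := (hm1.iff T hne (by omega)).2 h
      omega
    refine ⟨by simpa using hc, by simpa using hE, by simpa using h26, hR, ht, hm, km, hp, ?_, hm2⟩
    rw [← Finset.erase_eq_of_notMem hmem]
    exact hm1.erase

theorem treeStep_wp (hne : T.Nonempty) (hT : code T < 2 ^ n) (hb : Bound l n b) {σ : State}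
    (h : OutputInv pt l n (code T) (code T) (code T + 1) σ) :
    treeStep.wp b (OutputInv pt l n (code T) (code T) (code T)) σ := by
  obtain ⟨hc, hE, h26, hR, ht, hm, km, hp, hm1, hm2⟩ := h
  have hTa := ht T hne hT
  have hpos := code_pos hne
  unfold Bound at hb
  simp [treeStep, h26, hc.r10, hc.r13, hc.r16]
  refine ⟨by omega, fun hmark => ⟨by omega, fun hch => ?_, fun hch => ?_⟩, fun hmark => ?_⟩
  · have hmem := (hm2.iff T hne (by omega)).1 hmark
    rcases hTa.treeChoice with ⟨h0, -⟩ | ⟨A, hA, hAne, hcA, heq⟩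
    · omega
    have hsub := code_sdiff hA.subset
    have hlt := code_lt_code hA
    have hApos := code_pos hAne
    have hAa := ht A hAne (by omega)
    have hBa := ht (T \ A) (Finset.sdiff_nonempty.2 hA.2) (by omega)
    have e : 8 * code T - 8 * code A = 8 * code (T \ A) := by omega
    have hsplit := hp.split_tree hmem hA hAne heq
    rw [List.append_assoc] at hsplit
    simp [splitTree, emitLink_wp, h26, hc.r11, hc.r16, hE.r6, hE.r7, hcA, e, hTa.fst, hTa.snd,
      hAa.fst, hAa.snd, hBa.fst, hBa.snd]
    refine ⟨by omega, by omega, by omega, by omega, by omega, by omega, by omega, by omega, ?_⟩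
    refine ⟨by simpa using hc, by simpa using hE, by simpa using h26, hR, fun U hU hUn => ?_, _, _,
      hsplit, ?_, ?_⟩
    · refine (ht U hU hUn).congr (fun _ _ => rfl) fun k hk => ?_
      dsimp only
      iterate 2 rw [Function.update_of_ne (by omega)]
    · exact (hm1.update fun y => by omega).update fun y => by omega
    · rw [Finset.insert_comm]
      exact (hm2.erase.insert hlt rfl one_pos).insert (by omega) rfl one_pos
  · have hmem := (hm2.iff T hne (by omega)).1 hmark
    rcases hTa.treeChoice with ⟨-, i, rfl⟩ | ⟨A, hA, hAne, hcA, heq⟩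
    · exact ⟨by simpa using hc, by simpa using hE, by simpa using h26, hR, ht, hm, _, hp.leaf hmem,
        hm1, hm2.erase⟩
    · have := code_pos hAne
      omega
  · have hmem : T ∉ km := fun h => by
      have := (hm2.iff T hne (by omega)).2 h
      omega
    refine ⟨by simpa using hc, by simpa using hE, by simpa using h26, hR, ht, hm, km, hp, hm1, ?_⟩
    rw [← Finset.erase_eq_of_notMem hmem]
    exact hm2.erase

theorem outputPre_wp (hb : Bound l n b) {σ : State} (h : TableInv pt l n n σ) :
    outputPre.wp b (OutputInv pt l n (2 ^ n - 1) (2 ^ n) (2 ^ n)) σ := by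
  have hfull := code_range_add_one n
  obtain ⟨hc, hE, h21, h25, h26, h28, h33, h34, q0, hI, hR, hl, hm, hT, ho⟩ := h
  have e : 8 * 2 ^ n - 8 = 8 * code (Finset.range n) := by omega
  have e' : 2 ^ n - 1 = code (Finset.range n) := by omega
  unfold Bound at hb
  simp [outputPre, h26, hc.r11, hc.r15, hc.r18, e]
  refine ⟨by omega, by simpa using hc, by simpa using hE, by simp [e'], hR, fun U hU hUn => ?_, ?_⟩
  · refine (hT U hU hUn).congr (fun _ _ => rfl) fun k hk => ?_
    dsimp only
    rw [Function.update_of_ne (by omega)]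
  · rw [ho]
    have hk : Marked (Function.update σ.wmem (8 * code (Finset.range n) + 5) 1) 6 (2 ^ n) ∅ :=
      Marked.update ⟨by simp, fun T _ _ => by simp [(hm _).2]⟩ fun y => by omega
    rcases Nat.eq_zero_or_pos n with rfl | hn
    · refine ⟨∅, ∅, pending_of_zero, ⟨by simp, fun T hne hT => ?_⟩, hk⟩
      have := code_pos hne
      omega
    · refine ⟨_, _, pending_init hn, ?_, hk⟩
      exact Marked.insert (hm := ∅) ⟨by simp, fun T _ _ => by simp [(hm _).1]⟩ (by omega) rfl
        one_pos

theorem outputPost_wp {s c d : ℕ} {σ : State} (h : OutputInv pt l n s c d σ) :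
    outputPost.wp b (OutputInv pt l n (s - 1) c d) σ := by
  obtain ⟨hc, hE, h26, hR, ht, hp⟩ := h
  simp [outputPost, h26, hc.r18]
  exact ⟨by simpa using hc, by simpa using hE, by simp; omega, hR, ht, hp⟩

theorem outputProg_terminates {w : ℕ} (hl : (0, 0) ∈ l) (hq : ∀ i < n, Covers (0, 0) (pt i))
    (hb : Bound l n (2 ^ w)) {σ : State} (hσ : σ.Fits w) (h : TableInv pt l n n σ) :
    Terminates w outputProg (81 * 2 ^ n + 10) σ (fun τ => Pending pt l n ∅ ∅ τ.out) := by
  have hpow := Nat.two_pow_pos n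
  have h1 := (Prog.wp_sound (outputPre_wp hb h) hσ).seq
    (q := .loop (.wlt 10 26) (forestStep ;; treeStep ;; outputPost)) (T₂ := 81 * 2 ^ n + 1)
    (Q := OutputInv pt l n 0 1 1) ?_
  · refine h1.mono (by simp [outputPre, Prog.cost]; omega) fun τ hτ => ?_
    obtain ⟨hm, km, hp, hm1, hm2⟩ := hτ.pending
    obtain rfl : hm = ∅ := Finset.eq_empty_of_forall_notMem fun T hT => by
      have := hm1.lt T hT
      have := code_pos (hp.hm_sub T hT).1
      omega
    obtain rfl : km = ∅ := Finset.eq_empty_of_forall_notMem fun T hT => by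
      have := hm2.lt T hT
      have := code_pos (hp.km_sub T hT).1
      omega
    exact hp
  intro τ hτ hI
  have h2 := Terminates.loop (c := .wlt 10 26) (p := forestStep ;; treeStep ;; outputPost)
    (N := 2 ^ n - 1) (T := fun _ => 80)
    (Inv := fun k => OutputInv pt l n (2 ^ n - 1 - k) (2 ^ n - k) (2 ^ n - k))
    (fun k hk ρ hρ hI => ⟨?_, Prog.wp_terminates (by decide) hρ ?_⟩) (fun ρ hI => ?_) hτ hI
  · rw [show 2 ^ n - 1 - (2 ^ n - 1) = 0 by omega, show 2 ^ n - (2 ^ n - 1) = 1 by omega] at h2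
    exact h2.mono (by simp; omega) fun _ => id
  · simp [hI.r26, hI.consts.r10]; omega
  · obtain ⟨T, hT, hcode⟩ := exists_code n (2 ^ n - 1 - k) (by omega)
    have e1 : 2 ^ n - k = code T + 1 := by omega
    have e2 : 2 ^ n - 1 - (k + 1) = code T - 1 := by omega
    have e3 : 2 ^ n - (k + 1) = code T := by omega
    have hne : T.Nonempty := by
      rw [Finset.nonempty_iff_ne_empty]
      rintro rfl
      simp at hcode
      omega
    rw [e1, ← hcode] at hI
    rw [e2, e3]
    refine Prog.wp_seq (forestStep_wp hl hq hne (by omega) hb hI) fun ρ hI => ?_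
    exact Prog.wp_seq (treeStep_wp hne (by omega) hb hI) fun ρ hI => outputPost_wp hI
  · simp [hI.r26, hI.consts.r10]

end

/-! ### The input and the running time -/

theorem getD_flatMap (l : List Pt) (i : ℕ) :
    (l.flatMap fun p => [p.1, p.2]).getD (2 * i) 0 = (nth l i).1 ∧
      (l.flatMap fun p => [p.1, p.2]).getD (2 * i + 1) 0 = (nth l i).2 := by
  induction l generalizing i with
  | nil => simp [nth]
  | cons p l ih =>
    cases i with
    | zero => simp [nth]
    | succ i => simpa [nth, mul_add] using ih i

theorem Instance.inputMem (I : Instance) :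
    InputMem (nth I.pts) I.roots I.n I.input.rmem := by
  have h1 : ∀ i < I.n, nth (I.pts ++ I.roots) i = nth I.pts i := fun i hi =>
    List.getD_append _ _ _ _ hi
  have h2 : ∀ k, nth (I.pts ++ I.roots) (I.n + k) = nth I.roots k := fun k => by
    rw [nth, Instance.n, List.getD_append_right _ _ _ _ (Nat.le_add_right _ _),
      Nat.add_sub_cancel_left]; rfl
  have h3 := getD_flatMap (I.pts ++ I.roots)
  constructor
  · intro i hi; rw [← h1 i hi]; exact (h3 i).1
  · intro i hi; rw [← h1 i hi]; exact (h3 i).2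
  · intro k _; rw [← h2 k, ← mul_add]; exact (h3 _).1
  · intro k _; rw [← h2 k, ← mul_add]; exact (h3 _).2

theorem initProg_wp {I : Instance} {b : ℕ} (hb : Bound I.roots I.n b) :
    initProg.wp b (RowInv (nth I.pts) I.roots I.n 0) I.input := by
  have hm := I.inputMem
  have hdef : 2 * I.n + 2 * I.roots.length + 2 * (I.n * I.n) ≤ tableBase I.roots I.n := le_rfl
  have hlen : I.m = I.roots.length := rfl
  unfold Bound at hb
  have h0 : I.input.wreg 0 = I.n := rfl
  have h1 : I.input.wreg 1 = I.m := rfl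
  have h10 : I.input.wreg 10 = 0 := rfl
  have h21 : I.input.wreg 21 = 0 := rfl
  simp [initProg, h0, h1, h10]
  refine ⟨by omega, by omega, by omega, by omega, by omega, by omega, by omega, by omega, by omega,
    by omega, ?_⟩
  refine ⟨?_, ?_, ?_, rfl, hm, fun i _ j _ h => ?_, fun _ => rfl, rfl⟩
  · constructor <;> simp [h10, hlen] <;> omega
  · simp; omega
  · simp [h21]
  · simp at h

/-- The word length is linear in `n` and logarithmic in `m`, so that words suffice for tables of
size `3 ^ n` and `n * n` and for the input. -/
theorem bound_of_le {I : Instance} {w : ℕ} (hw : 500 * (I.n + Nat.log 2 I.m + 1) ≤ w) :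
    Bound I.roots I.n (2 ^ w) := by
  set k := I.n + Nat.log 2 I.m + 1 with hk
  have h1 : I.n < 2 ^ k := Nat.lt_pow_self (by norm_num) |>.trans_le
    (Nat.pow_le_pow_right (by norm_num) (by omega))
  have h2 : I.roots.length < 2 ^ k := (Nat.lt_pow_succ_log_self (by norm_num) _).trans_le
    (Nat.pow_le_pow_right (by norm_num) (by simp only [hk, Instance.m]; omega))
  have h3 : 2 ^ I.n ≤ 2 ^ k := Nat.pow_le_pow_right (by norm_num) (by omega)
  have h4 : 3 ^ I.n ≤ 2 ^ k * 2 ^ k := by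
    rw [← mul_pow]
    exact (Nat.pow_le_pow_left (by norm_num) _).trans
      (Nat.pow_le_pow_right (by norm_num) (by omega))
  have h5 : I.n * I.n ≤ 2 ^ k * 2 ^ k := Nat.mul_le_mul h1.le h1.le
  have h6 : 2 ^ k * 1 ≤ 2 ^ k * 2 ^ k := Nat.mul_le_mul_left _ Nat.one_le_two_pow
  have h7 : 128 * (2 ^ k * 2 ^ k) ≤ 2 ^ w := by
    rw [← pow_add, show 128 = 2 ^ 7 by norm_num, ← pow_add]
    exact Nat.pow_le_pow_right (by norm_num) (by omega)
  have h8 : 0 < 2 ^ k := by positivity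
  unfold Bound tableBase
  omega

/-- The program that solves the problem. -/
def solver : Prog := initProg ;; rootTableProg ;; basesProg ;; tableProg ;; outputProg

theorem solver_terminates (I : Instance) {w : ℕ} (hb : Bound I.roots I.n (2 ^ w)) :
    Terminates w solver (500 * (I.m * I.n ^ 2 + 3 ^ I.n)) I.input
      (fun τ => Pending (nth I.pts) I.roots I.n ∅ ∅ τ.out) := by
  have hdef : 2 * I.n + 2 * I.roots.length + 2 * (I.n * I.n) = tableBase I.roots I.n := rfl
  have hb' := hb
  unfold Bound at hb'
  have hq : ∀ i < I.n, Covers (0, 0) (nth I.pts i) := fun i hi => by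
    rw [nth, List.getD_eq_getElem _ _ hi]
    exact I.pts_quadrant _ (List.getElem_mem hi)
  have hfits : I.input.Fits w := by
    refine ⟨fun i => ?_, fun i => by positivity⟩
    have hm : I.m = I.roots.length := rfl
    change (if i = 0 then I.n else if i = 1 then I.m else 0) < _
    split_ifs <;> omega
  have h := (Prog.wp_sound (initProg_wp hb) hfits).seq fun τ hτ h =>
    (rootTable_terminates (by omega) hτ h).seq fun τ hτ h =>
      (Prog.wp_sound (basesProg_wp hb h) hτ).seq fun τ hτ h =>
        (tableProg_terminates hb hτ h).seq fun τ hτ h =>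
          outputProg_terminates I.origin_mem hq hb hτ h
  refine h.mono ?_ fun _ => id
  have h1 : 1 ≤ I.m := List.length_pos_of_mem I.origin_mem
  have h2 : I.n < 3 ^ I.n := Nat.lt_pow_self (by norm_num)
  have h3 : 2 ^ I.n ≤ 3 ^ I.n := Nat.pow_le_pow_left (by norm_num) _
  have h4 : I.n ^ 2 * 1 ≤ I.n ^ 2 * I.m := Nat.mul_le_mul_left _ h1
  have h5 : I.n * (I.n * (20 * I.roots.length + 21) + 11) + 1 =
      20 * (I.n ^ 2 * I.m) + 21 * I.n ^ 2 + 11 * I.n + 1 := by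
    rw [Instance.m]; ring
  have h6 : initProg.cost = 12 := by decide
  have h7 : basesProg.cost = 11 := by decide
  rw [h5, h6, h7, mul_comm I.m]
  omega

theorem image_nth (l : List Pt) : (Finset.range l.length).image (nth l) = l.toFinset := by
  ext p
  rw [Finset.mem_image, List.mem_toFinset, List.mem_iff_getElem]
  constructor
  · rintro ⟨i, hi, rfl⟩
    exact ⟨i, Finset.mem_range.1 hi, (List.getD_eq_getElem _ _ _).symm⟩
  · rintro ⟨i, hi, rfl⟩
    exact ⟨i, Finset.mem_range.2 hi, List.getD_eq_getElem _ _ hi⟩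

end RSFA

end

theorem mainTheorem1 :
    ∃ (A : RSFA.Prog) (C : ℕ), ∀ (I : RSFA.Instance) (w : ℕ),
      C * (I.n + Nat.log 2 I.m + 1) ≤ w →
      ∃ (t : ℕ) (σ : RSFA.State), RSFA.Exec w A I.input t σ ∧
        t ≤ C * (I.m * I.n ^ 2 + 3 ^ I.n) ∧
        ∃ F : RSFA.RectGraph, RSFA.Describes σ.out F ∧
          RSFA.IsMinRSFA F I.pts.toFinset I.roots.toFinset := by
  -- The constant 500 is generous, both for the number of steps and for the word length.
  refine ⟨RSFA.solver, 500, fun I w hw => ?_⟩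
  obtain ⟨t, σ, hexec, ht, -, hp⟩ := RSFA.solver_terminates I (RSFA.bound_of_le hw)
  have hget : ∀ i (hi : i < I.n), RSFA.nth I.pts i = I.pts[i]'hi := fun i hi =>
    List.getD_eq_getElem _ _ hi
  obtain ⟨F, hF, hmin⟩ := hp.exists_describes
    (fun i hi => by rw [hget i hi]; exact I.pts_quadrant _ (List.getElem_mem hi))
    (fun i hi j hj h => by
      rw [hget i hi, hget j hj] at h
      exact (I.pts_nodup.getElem_inj_iff).1 h)
    (fun i hi => by rw [hget i hi]; exact I.disjoint _ (List.getElem_mem hi))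
  rw [show I.n = I.pts.length from rfl, RSFA.image_nth] at hmin
  exact ⟨t, σ, hexec, ht, F, hF, hmin⟩
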